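/- **Setting.** For $N\ge 2$ let $\mathbb S^{N-1}(\sqrt N)=\{v\in\mathbb R^N:\ |v|^2=N\}$ with its uniform probability measure $\sigma_N$, and let $\gamma\in[0,1]$. For $i<j$ and $\theta\in\mathbb R$ let $R_{i,j,\theta}$ be the map which replaces $v_i$ by $v_i\cos\theta+v_j\sin\theta$ and $v_j$ by $-v_i\sin\theta+v_j\cos\theta$ and leaves the other coordinates of $v$ unchanged. The generator of the Kac walk is $$\mathcal L_{N,\gamma}F(v)=-N\binom N2^{-1}\sum_{i<j}\bigl(1+v_i^2+v_j^2\bigr)^{\gamma}\,\frac1{2\pi}\int_{-\pi}^{\pi}\bigl(F(v)-F(R_{i,j,\theta}v)\bigr)\,d\theta .$$ For a probability density $F$ with respect to $\sigma_N$ put $$H_N(F)=\int F\log F\,d\sigma_N,\qquad D_{N,\gamma}(F)=-\frac{d}{dt}\Big|_{t=0^+}H_N\bigl(e^{t\mathcal L_{N,\gamma}}F\bigr),$$ and let $\Pi_1(F)$ be the law of $v_1$ under $F\,d\sigma_N$ and $M_p(\Pi_1(F))=\int|v|^p\,d\Pi_1(F)(v)$ for $p\ge 0$. **Theorem 1.**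 Let $(F_N)_{N\ge2}$ be permutation symmetric probability densities on $\mathbb S^{N-1}(\sqrt N)$ (with respect to $\sigma_N$) which are log-scalable with constant $C_F>0$, i.e. $\sup_{v}|\log F_N(v)|\le C_F N$ for all $N\ge2$ (in particular $F_N>0$). (i) Let $k>1$ be such that $M_{2k}:=\sup_{N\ge2}M_{2k}(\Pi_1(F_N))<\infty$. Then for every $N\ge2$ $$\frac{D_{N,\gamma}(F_N)}N\ \ge\ \mathcal C_{k,\gamma,N}\left(\frac{H_N(F_N)}N\right)^{1+\frac{1-\gamma}{k-1}},$$ where $$\mathcal C_{k,\gamma,N}=\frac{k-1}{3^{\frac{2k-\gamma k-\gamma}{k-1}}(1-\gamma)}\left(\frac{1-\gamma}{k-\gamma}\right)^{\frac{k-\gamma}{k-1}}\frac{1}{(2C_F)^{\frac{1-\gamma}{k-1}}(1+2M_{2k})^{\frac{1-\gamma}{k-1}}}\;N^{\frac{\gamma-1}{k-1}}$$ for $\gamma<1$, and $\mathcal C_{k,1,N}=\frac13$ (the limit of this expression as $\gamma\to1$). (ii) Let $a,\mu>0$ be such that $M_{exp}:=\sup_{N\ge2}\int e^{a|v_1|^\mu}F_N\,d\sigma_N<\infty$.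 Then for every $N\ge2$ $$\frac{D_{N,\gamma}(F_N)}N\ \ge\ \frac{1}{6\cdot4^{1-\gamma}\left(\frac2a\log\left(96\,C_F\left(\frac4{a\mu e}\right)^{\frac2\mu}e^{\frac a{2^{\mu/2}}}M_{exp}\right)+\frac2a\log\left(\frac N{H_N(F_N)/N}\right)\right)^{\frac{2(1-\gamma)}\mu}}\;\frac{H_N(F_N)}N ,$$ where the right-hand side is read as $0$ if $H_N(F_N)=0$. -/

import Mathlib

open MeasureTheory Set

noncomputable section

namespace KacWalk

/-- Velocity space `ℝ^N` with its Euclidean norm. -/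
abbrev Velocities (N : ℕ) : Type := EuclideanSpace ℝ (Fin N)

/-- The Kac sphere `𝕊^{N-1}(√N)`: velocities `v ∈ ℝ^N` with `|v| = √N`. -/
abbrev KacSphere (N : ℕ) : Type := Metric.sphere (0 : Velocities N) (Real.sqrt N)

/-- The dilation by `√N` from the unit sphere onto the Kac sphere. -/
def dilation (N : ℕ) (u : Metric.sphere (0 : Velocities N) 1) : KacSphere N :=
  ⟨Real.sqrt N • (u : Velocities N), by
    have hu : ‖(u : Velocities N)‖ = 1 := by simp
    simp [norm_smul, hu, abs_of_nonneg (Real.sqrt_nonneg _)]⟩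

/-- The surface measure of the unit sphere, transported to the Kac sphere (not normalised). -/
def surfaceMeasure (N : ℕ) : Measure (KacSphere N) :=
  ((volume : Measure (Velocities N)).toSphere).map (dilation N)

/-- The uniform probability measure `σ_N` on the Kac sphere. -/
def uniformMeasure (N : ℕ) : Measure (KacSphere N) :=
  (surfaceMeasure N univ)⁻¹ • surfaceMeasure N

/-- The vector obtained from `v` by a rotation of angle `θ` in the plane of the coordinates
`i`, `j`: `v_i ↦ v_i cos θ + v_j sin θ`, `v_j ↦ -v_i sin θ + v_j cos θ`. -/
def rotateVec {N : ℕ} (i j : Fin N) (θ : ℝ) (v : Velocities N) : Velocities N :=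
  WithLp.toLp 2 fun k =>
    if k = i then v i * Real.cos θ + v j * Real.sin θ
    else if k = j then -v i * Real.sin θ + v j * Real.cos θ
    else v k

theorem norm_rotateVec {N : ℕ} {i j : Fin N} (hij : i ≠ j) (θ : ℝ) (v : Velocities N) :
    ‖rotateVec i j θ v‖ = ‖v‖ := by
  have hsplit : ∀ g : Fin N → ℝ,
      ∑ k, g k = g i + (g j + ∑ k ∈ (Finset.univ.erase i).erase j, g k) := by
    intro g
    rw [← Finset.add_sum_erase Finset.univ g (Finset.mem_univ i),
      ← Finset.add_sum_erase (Finset.univ.erase i) g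
        (Finset.mem_erase.2 ⟨hij.symm, Finset.mem_univ j⟩)]
  have hrest : ∑ k ∈ (Finset.univ.erase i).erase j, (rotateVec i j θ v k) ^ 2
      = ∑ k ∈ (Finset.univ.erase i).erase j, (v k) ^ 2 := by
    refine Finset.sum_congr rfl fun k hk => ?_
    have hkj : k ≠ j := (Finset.mem_erase.1 hk).1
    have hki : k ≠ i := (Finset.mem_erase.1 (Finset.mem_erase.1 hk).2).1
    simp [rotateVec, hkj, hki]
  have hi : rotateVec i j θ v i = v i * Real.cos θ + v j * Real.sin θ := by
    simp [rotateVec]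
  have hj : rotateVec i j θ v j = -v i * Real.sin θ + v j * Real.cos θ := by
    simp [rotateVec, hij.symm]
  have hsq : ‖rotateVec i j θ v‖ ^ 2 = ‖v‖ ^ 2 := by
    rw [EuclideanSpace.real_norm_sq_eq, EuclideanSpace.real_norm_sq_eq,
      hsplit (fun k => (rotateVec i j θ v k) ^ 2), hsplit (fun k => (v k) ^ 2), hrest, hi, hj]
    linear_combination ((v i) ^ 2 + (v j) ^ 2) * Real.sin_sq_add_cos_sq θ
  exact (sq_eq_sq₀ (norm_nonneg _) (norm_nonneg _)).1 hsq

/-- The collision map `R_{i,j,θ}` of the Kac sphere. -/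
def rotate {N : ℕ} (i j : Fin N) (hij : i ≠ j) (θ : ℝ) (v : KacSphere N) : KacSphere N :=
  ⟨rotateVec i j θ v, by
    have hv : ‖(v : Velocities N)‖ = Real.sqrt N := by simp
    simp [norm_rotateVec hij, hv]⟩

/-- The relabelling of the particles by a permutation. -/
def permute {N : ℕ} (π : Equiv.Perm (Fin N)) (v : KacSphere N) : KacSphere N :=
  ⟨WithLp.toLp 2 fun k => (v : Velocities N) (π k), by
    have hv : ‖(v : Velocities N)‖ = Real.sqrt N := by simp
    have h : ‖(WithLp.toLp 2 fun k => (v : Velocities N) (π k) : Velocities N)‖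
        = ‖(v : Velocities N)‖ := by
      rw [EuclideanSpace.norm_eq, EuclideanSpace.norm_eq]
      congr 1
      exact Equiv.sum_comp π fun k => ‖(v : Velocities N) k‖ ^ 2
    simp [h, hv]⟩

/-- The velocity `v_1` of the first particle (for `N ≥ 1`). -/
def firstVelocity {N : ℕ} (v : KacSphere N) : ℝ :=
  if h : 0 < N then (v : Velocities N) ⟨0, h⟩ else 0

/-- `F ∈ P(𝕊^{N-1}(√N))`: `F` is a probability density with respect to `σ_N`. -/
structure IsDensity {N : ℕ} (F : KacSphere N → ℝ) : Prop where
  measurable : Measurable F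
  nonneg : ∀ v, 0 ≤ F v
  integrable : Integrable F (uniformMeasure N)
  integral_eq_one : ∫ v, F v ∂(uniformMeasure N) = 1

/-- Permutation symmetry. -/
def IsSymmetric {N : ℕ} (F : KacSphere N → ℝ) : Prop :=
  ∀ (π : Equiv.Perm (Fin N)) (v : KacSphere N), F (permute π v) = F v

/-- The family `F_N`, `N ≥ 2`, is log-scalable with constant `C`:
`sup_v |log F_N(v)| ≤ C N` for every `N`, where `|log 0| = ∞`, so that `F_N > 0`. -/
def IsLogScalable (F : (N : ℕ) → KacSphere N → ℝ) (C : ℝ) : Prop :=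
  ∀ N : ℕ, 2 ≤ N → ∀ v : KacSphere N, 0 < F N v ∧ |Real.log (F N v)| ≤ C * N

/-- The generator of the Kac walk,
`(L_{N,γ} F)(v) = -N (N choose 2)⁻¹ ∑_{i<j} (1 + v_i² + v_j²)^γ
  (2π)⁻¹ ∫_{-π}^{π} (F(v) - F(R_{i,j,θ} v)) dθ`. -/
def generator {N : ℕ} (γ : ℝ) (F : KacSphere N → ℝ) (v : KacSphere N) : ℝ :=
  -((N : ℝ) / (N.choose 2 : ℝ)) *
    ∑ p : {p : Fin N × Fin N // p.1 < p.2},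
      (1 + (v : Velocities N) p.1.1 ^ 2 + (v : Velocities N) p.1.2 ^ 2) ^ γ *
        ((1 / (2 * Real.pi)) *
          ∫ θ in (-Real.pi)..Real.pi, (F v - F (rotate p.1.1 p.1.2 p.2.ne θ v)))

/-- The semigroup `e^{t L_{N,γ}} F = ∑_n (t^n / n!) L_{N,γ}^n F`. For fixed `N` the generator is
a bounded operator on the bounded measurable functions, on which the series converges. -/
def semigroup {N : ℕ} (γ t : ℝ) (F : KacSphere N → ℝ) (v : KacSphere N) : ℝ :=
  ∑' n : ℕ, t ^ n / (n.factorial : ℝ) * ((generator γ)^[n] F) v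

/-- The relative entropy `H_N(F) = ∫ F log F dσ_N`. -/
def entropy {N : ℕ} (F : KacSphere N → ℝ) : ℝ :=
  ∫ v, F v * Real.log (F v) ∂(uniformMeasure N)

/-- The entropy production `D_{N,γ}(F) = -(d/dt) H_N(e^{t L_{N,γ}} F)` at `t = 0`
(right derivative). -/
def entropyProduction {N : ℕ} (γ : ℝ) (F : KacSphere N → ℝ) : ℝ :=
  -derivWithin (fun t : ℝ => entropy (semigroup γ t F)) (Ici 0) 0

/-- The one-particle marginal `Π_1(F)`, as a law on `ℝ`: the law of `v_1` under `F dσ_N`. -/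
def marginal {N : ℕ} (F : KacSphere N → ℝ) : Measure ℝ :=
  ((uniformMeasure N).withDensity fun v => ENNReal.ofReal (F v)).map firstVelocity

/-- The absolute moment of order `p` of a law on `ℝ`. -/
def moment (p : ℝ) (ν : Measure ℝ) : ENNReal :=
  ∫⁻ x, ENNReal.ofReal (|x| ^ p) ∂ν

/-- `sup_N M_p(Π_1(F_N))`, over `N ≥ 2`. -/
def supMoment (F : (N : ℕ) → KacSphere N → ℝ) (p : ℝ) : ENNReal :=
  ⨆ (N : ℕ) (_ : 2 ≤ N), moment p (marginal (F N))

/-- `sup_N ∫ e^{a |v_1|^μ} F_N dσ_N`, over `N ≥ 2`. -/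
def supExpMoment (F : (N : ℕ) → KacSphere N → ℝ) (a μ : ℝ) : ENNReal :=
  ⨆ (N : ℕ) (_ : 2 ≤ N),
    ∫⁻ v, ENNReal.ofReal (Real.exp (a * |firstVelocity v| ^ μ) * F N v) ∂(uniformMeasure N)

/-- The constant `𝒞_{k,γ,N}`, as a function also of `C = C_F` and `M = M_{2k}`. For `γ = 1` the
general expression reads `0/0`; its limit as `γ → 1` is `1/3`. -/
def rateConst (k γ : ℝ) (N : ℕ) (C M : ℝ) : ℝ :=
  if γ = 1 then 1 / 3 else
    (k - 1) / ((3 : ℝ) ^ ((2 * k - γ * k - γ) / (k - 1)) * (1 - γ)) *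
      ((1 - γ) / (k - γ)) ^ ((k - γ) / (k - 1)) *
      (1 / ((2 * C) ^ ((1 - γ) / (k - 1)) * (1 + 2 * M) ^ ((1 - γ) / (k - 1)))) *
      (N : ℝ) ^ ((γ - 1) / (k - 1))

end KacWalk

end

/-!
# Entropy production of the Kac walk with rates `(1 + v_i² + v_j²)^γ`

Write `ψ(a, b) = (a - b)(log a - log b)` and `w = v_i² + v_j²`. Differentiating the entropy and
exchanging pre- and post-collisional velocities gives
`D_γ(F) = N (N choose 2)⁻¹ ∑_{i<j} ½ ∬ (1 + w)^γ ψ(F, F ∘ R_{i,j,θ})` (`entropyProduction_eq`).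

The heart of the proof is the case `γ = 1`, the bound `H(F) ≤ 3 D_1(F)`
(`entropy_le_entropyProduction_one`). It follows from
`N (∫ F log F - m log m) ≤ ∑_{i<j} ½ ∬ (6 + w) ψ(F, F ∘ R_{i,j,θ})` with `m = ∫ F`, for which both
sides are followed along the heat flow of the sphere. The heat flow is generated by the Casimir
operator `∑_{k,l} L_{kl}²` of the rotations, `L_{kl} = v_l ∂_k - v_k ∂_l`, so that it commutes with
every `R_{i,j,θ}`, and `F ∘ R_{i,j,θ}` is again a solution. The entropy is dissipated at the rate
`∑_{k,l} ∫ (L_{kl} F)² / F` (`integral_log_mul_casimir`). For the entropy production of one pair,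
integration by parts produces the square of the gradient of `log F - log F ∘ R`
(`integral_jeffreys_casimir`). Since `|v|² = N`, Cauchy–Schwarz (`two_mul_sum_sq_mul_le`) bounds
`w` times this square from below by `2N` times the square of the derivative in the plane `(i, j)`,
whose average over `θ` splits into a local term, the Fisher information in the plane `(i, j)`, and
a mean over the circle, which absorbs the contribution of `∑_{k,l} L_{kl}² w = 4N (2 - w)`
(`pair_dissipation`). Hence the right-hand side decreases at least as fast as the left-hand side,
and both tend to `0` as `t → ∞`.

The heat flow is needed for polynomials only, where it is a finite sum of exponentials: the Casimir
operator preserves the degree and is self-adjoint for the Fischer inner product, so that polynomials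
split into eigenvectors (`exists_casimir_eigenvectors`). Bounded positive densities are reached by
approximation almost everywhere (`entropy_le_pairProduction`).

For `γ < 1` the rate `1 + w` is split at a level `R`: below it, `1 + w ≤ R^(1-γ) (1 + w)^γ`; above
it, log-scalability gives `ψ(F, F ∘ R_{i,j,θ}) ≤ 2 C_F N (F + F ∘ R_{i,j,θ})`, and symmetry reduces
the remainder to a moment of one velocity (`entropy_le_of_rate_le`). With a polynomial moment the
level is optimised (`rateConst_mul_rpow_le`); with an exponential moment it is chosen such that the
remainder is half of the left-hand side.
-/

noncomputable section

namespace KacWalk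

variable {N : ℕ}

/-! ### The uniform measure and the rotations -/


theorem dilation_continuous (N : ℕ) : Continuous (dilation N) :=
  continuous_induced_rng.2 (continuous_subtype_val.const_smul (Real.sqrt N))

instance : IsFiniteMeasure (surfaceMeasure N) := by
  unfold surfaceMeasure; infer_instance

theorem surfaceMeasure_univ_ne_zero (hN : 2 ≤ N) : surfaceMeasure N univ ≠ 0 := by
  have : Nontrivial (Fin N) := Fin.nontrivial_iff_two_le.2 hN
  rw [surfaceMeasure, Measure.map_apply (dilation_continuous N).measurable MeasurableSet.univ,
    preimage_univ]
  exact fun h => Measure.toSphere_ne_zero (volume : Measure (Velocities N))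
    (Measure.measure_univ_eq_zero.1 h)

theorem isProbabilityMeasure_uniformMeasure (hN : 2 ≤ N) :
    IsProbabilityMeasure (uniformMeasure N) := by
  constructor
  rw [uniformMeasure, Measure.smul_apply, smul_eq_mul]
  exact ENNReal.inv_mul_cancel (surfaceMeasure_univ_ne_zero hN) (measure_ne_top _ _)

open scoped Pointwise in
/-- The uniform measure is invariant under the restriction of a linear isometry. -/
theorem measurePreserving_of_linearIsometry (f : Velocities N →ₗᵢ[ℝ] Velocities N)
    (T : KacSphere N → KacSphere N) (hT : ∀ v, (T v : Velocities N) = f v) :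
    MeasurePreserving T (uniformMeasure N) (uniformMeasure N) := by
  obtain ⟨e, he⟩ : ∃ e : Velocities N ≃ₗᵢ[ℝ] Velocities N, ∀ v, e v = f v :=
    ⟨f.toLinearIsometryEquiv rfl, fun v => rfl⟩
  let U : Metric.sphere (0 : Velocities N) 1 → Metric.sphere (0 : Velocities N) 1 :=
    fun u => ⟨e u, by simp⟩
  have hU : Measurable U :=
    (Continuous.subtype_mk (e.continuous.comp continuous_subtype_val) _).measurable
  have hTc : Continuous T := by
    refine continuous_induced_rng.2 ?_
    have : (Subtype.val ∘ T) = fun v : KacSphere N => f v := funext hT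
    rw [this]
    exact f.continuous.comp continuous_subtype_val
  have hmap : ((volume : Measure (Velocities N)).toSphere).map U
      = (volume : Measure (Velocities N)).toSphere := by
    -- the surface measure of a set is defined by the volume of the cone over it
    ext s hs
    rw [Measure.map_apply hU hs, Measure.toSphere_apply' _ (hU hs), Measure.toSphere_apply' _ hs]
    have himg : e ⁻¹' ((Ioo (0 : ℝ) 1) • ((↑) '' s : Set (Velocities N)))
        = (Ioo (0 : ℝ) 1) • ((↑) '' (U ⁻¹' s) : Set (Velocities N)) := by
      ext x
      simp only [mem_preimage, Set.mem_smul, mem_image]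
      constructor
      · rintro ⟨r, hr, _, ⟨u, hu, rfl⟩, hx⟩
        refine ⟨r, hr, e.symm u, ⟨⟨e.symm u, by simp⟩, ?_, rfl⟩, ?_⟩
        · have : U ⟨e.symm u, by simp⟩ = u := Subtype.ext (by simp [U])
          simpa [this] using hu
        · apply e.injective
          rw [map_smul, LinearIsometryEquiv.apply_symm_apply, hx]
      · rintro ⟨r, hr, _, ⟨u, hu, rfl⟩, rfl⟩
        exact ⟨r, hr, _, ⟨U u, hu, rfl⟩, by simp [U]⟩
    rw [← himg, e.measurePreserving.measure_preimage_emb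
      e.toHomeomorph.measurableEmbedding]
  have hsurf : (surfaceMeasure N).map T = surfaceMeasure N := by
    have hcomm : T ∘ dilation N = dilation N ∘ U := by
      funext u
      apply Subtype.ext
      simp [hT, dilation, U, he]
    unfold surfaceMeasure
    rw [Measure.map_map hTc.measurable (dilation_continuous N).measurable, hcomm,
      ← Measure.map_map (dilation_continuous N).measurable hU, hmap]
  refine ⟨hTc.measurable, ?_⟩
  rw [uniformMeasure, Measure.map_smul, hsurf]

theorem measurePreserving_rotate {i j : Fin N} (hij : i ≠ j) (θ : ℝ) :
    MeasurePreserving (rotate i j hij θ) (uniformMeasure N) (uniformMeasure N) := by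
  refine measurePreserving_of_linearIsometry
    ⟨{ toFun := rotateVec i j θ, map_add' := ?_, map_smul' := ?_ }, norm_rotateVec hij θ⟩ _
    fun v => rfl
  · intro v w
    ext k
    simp only [rotateVec, PiLp.add_apply]
    split_ifs <;> ring
  · intro c v
    ext k
    simp only [rotateVec, PiLp.smul_apply, smul_eq_mul, RingHom.id_apply]
    split_ifs <;> ring

theorem measurePreserving_permute (π : Equiv.Perm (Fin N)) :
    MeasurePreserving (permute π) (uniformMeasure N) (uniformMeasure N) := by
  refine measurePreserving_of_linearIsometry
    (LinearIsometryEquiv.piLpCongrLeft 2 ℝ ℝ π.symm).toLinearIsometry _ fun v => ?_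
  ext k
  simp [permute, Equiv.piCongrLeft']

theorem continuous_coord (k : Fin N) :
    Continuous fun v : KacSphere N => (v : Velocities N) k :=
  (PiLp.continuous_apply 2 _ k).comp continuous_subtype_val

theorem continuous_rotate {i j : Fin N} (hij : i ≠ j) :
    Continuous fun x : KacSphere N × ℝ => rotate i j hij x.2 x.1 := by
  refine Continuous.subtype_mk ((PiLp.continuous_toLp 2 _).comp (continuous_pi fun k => ?_)) _
  have h := fun k : Fin N => (continuous_coord k).comp (continuous_fst (X := KacSphere N) (Y := ℝ))
  simp only [Function.comp_def] at h
  split_ifs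
  · exact ((h i).mul (Real.continuous_cos.comp continuous_snd)).add
      ((h j).mul (Real.continuous_sin.comp continuous_snd))
  · exact ((h i).neg.mul (Real.continuous_sin.comp continuous_snd)).add
      ((h j).mul (Real.continuous_cos.comp continuous_snd))
  · exact h k

theorem rotate_apply {i j : Fin N} (hij : i ≠ j) (θ : ℝ) (v : KacSphere N) (k : Fin N) :
    (rotate i j hij θ v : Velocities N) k =
      if k = i then (v : Velocities N) i * Real.cos θ + (v : Velocities N) j * Real.sin θ
      else if k = j then -(v : Velocities N) i * Real.sin θ + (v : Velocities N) j * Real.cos θ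
      else (v : Velocities N) k := rfl

theorem rotate_rotate {i j : Fin N} (hij : i ≠ j) (s θ : ℝ) (v : KacSphere N) :
    rotate i j hij s (rotate i j hij θ v) = rotate i j hij (θ + s) v := by
  apply Subtype.ext
  ext k
  simp only [rotate_apply, hij.symm, if_true, if_false, Real.cos_add, Real.sin_add]
  split_ifs <;> ring

theorem rotate_zero {i j : Fin N} (hij : i ≠ j) (v : KacSphere N) : rotate i j hij 0 v = v := by
  apply Subtype.ext
  ext k
  simp only [rotate_apply, Real.cos_zero, Real.sin_zero]
  split_ifs with h1 h2 <;> simp [*]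

theorem rotate_pi {i j : Fin N} (hij : i ≠ j) (v : KacSphere N) :
    rotate i j hij Real.pi v = rotate i j hij (-Real.pi) v := by
  apply Subtype.ext
  ext k
  simp [rotate_apply]

/-- The quantity `v_i² + v_j²`, which a collision of `i` and `j` conserves. -/
def pairEnergy (i j : Fin N) (v : KacSphere N) : ℝ :=
  (v : Velocities N) i ^ 2 + (v : Velocities N) j ^ 2

theorem pairEnergy_nonneg (i j : Fin N) (v : KacSphere N) : 0 ≤ pairEnergy i j v := by
  unfold pairEnergy; positivity

theorem continuous_pairEnergy (i j : Fin N) : Continuous (pairEnergy i j) :=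
  ((continuous_coord i).pow 2).add ((continuous_coord j).pow 2)

theorem pairEnergy_rotate {i j : Fin N} (hij : i ≠ j) (θ : ℝ) (v : KacSphere N) :
    pairEnergy i j (rotate i j hij θ v) = pairEnergy i j v := by
  simp only [pairEnergy, rotate_apply, hij.symm, if_true, if_false]
  linear_combination
    ((v : Velocities N) i ^ 2 + (v : Velocities N) j ^ 2) * Real.sin_sq_add_cos_sq θ

theorem sum_sq_eq (v : KacSphere N) : ∑ k, (v : Velocities N) k ^ 2 = N := by
  have hv : ‖(v : Velocities N)‖ = Real.sqrt N := by simp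
  rw [← EuclideanSpace.real_norm_sq_eq, hv, Real.sq_sqrt (Nat.cast_nonneg N)]

/-! ### Averages over the angle and over the sphere -/

/-- The uniform probability measure on the angles `(-π, π]`. -/
def angleMeasure : Measure ℝ :=
  ENNReal.ofReal (1 / (2 * Real.pi)) • volume.restrict (Ioc (-Real.pi) Real.pi)

instance : IsProbabilityMeasure angleMeasure := by
  constructor
  rw [angleMeasure, Measure.smul_apply, Measure.restrict_apply_univ, Real.volume_Ioc, smul_eq_mul,
    ← ENNReal.ofReal_mul (by positivity)]
  rw [show 1 / (2 * Real.pi) * (Real.pi - -Real.pi) = 1 by field_simp; ring, ENNReal.ofReal_one]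

theorem integral_angleMeasure (f : ℝ → ℝ) :
    ∫ θ, f θ ∂angleMeasure = 1 / (2 * Real.pi) * ∫ θ in (-Real.pi)..Real.pi, f θ := by
  rw [angleMeasure, integral_smul_measure, ENNReal.toReal_ofReal (by positivity), smul_eq_mul,
    intervalIntegral.integral_of_le (by linarith [Real.pi_pos])]

theorem integral_angleMeasure_neg (f : ℝ → ℝ) :
    ∫ θ, f (-θ) ∂angleMeasure = ∫ θ, f θ ∂angleMeasure := by
  rw [integral_angleMeasure, integral_angleMeasure, intervalIntegral.integral_comp_neg, neg_neg]

theorem integrable_sphere (hN : 2 ≤ N) {f : KacSphere N → ℝ} (hf : Continuous f) :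
    Integrable f (uniformMeasure N) := by
  have := isProbabilityMeasure_uniformMeasure hN
  rw [← integrableOn_univ]
  exact hf.continuousOn.integrableOn_compact isCompact_univ

theorem ae_angleMeasure_mem : ∀ᵐ θ ∂angleMeasure, θ ∈ Icc (-Real.pi) Real.pi := by
  refine Measure.ae_smul_measure ?_ _
  filter_upwards [ae_restrict_mem measurableSet_Ioc] with θ hθ using Ioc_subset_Icc_self hθ

theorem integrable_angle {f : ℝ → ℝ} (hf : Continuous f) : Integrable f angleMeasure := by
  obtain ⟨C, hC⟩ := (isCompact_Icc (a := -Real.pi) (b := Real.pi)).exists_bound_of_continuousOn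
    hf.continuousOn
  refine Integrable.of_bound hf.aestronglyMeasurable C ?_
  filter_upwards [ae_angleMeasure_mem] with θ hθ using hC θ hθ

theorem integrable_sphere_angle (hN : 2 ≤ N) {f : KacSphere N × ℝ → ℝ} (hf : Continuous f) :
    Integrable f ((uniformMeasure N).prod angleMeasure) := by
  have := isProbabilityMeasure_uniformMeasure hN
  obtain ⟨C, hC⟩ := (isCompact_univ.prod
    (isCompact_Icc (a := -Real.pi) (b := Real.pi))).exists_bound_of_continuousOn hf.continuousOn
  refine Integrable.of_bound hf.aestronglyMeasurable C ?_
  have h : ∀ᵐ x ∂((uniformMeasure N).prod angleMeasure), x.2 ∈ Icc (-Real.pi) Real.pi :=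
    Measure.quasiMeasurePreserving_snd.ae ae_angleMeasure_mem
  filter_upwards [h] with x hx using hC x ⟨mem_univ _, hx⟩

theorem integral_comp_rotate {i j : Fin N} (hij : i ≠ j) (θ : ℝ)
    {f : KacSphere N → ℝ} (hf : AEStronglyMeasurable f (uniformMeasure N)) :
    ∫ v, f (rotate i j hij θ v) ∂(uniformMeasure N) = ∫ v, f v ∂(uniformMeasure N) := by
  have hp := measurePreserving_rotate hij θ
  rw [← integral_map (μ := uniformMeasure N) hp.measurable.aemeasurable, hp.map_eq]
  rwa [hp.map_eq]

/-- A continuous function may be averaged over the rotations in a fixed plane before it is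
integrated over the sphere. -/
theorem integral_average_rotate (hN : 2 ≤ N) {i j : Fin N} (hij : i ≠ j)
    {f : KacSphere N → ℝ} (hf : Continuous f) :
    ∫ v, ∫ θ, f (rotate i j hij θ v) ∂angleMeasure ∂(uniformMeasure N)
      = ∫ v, f v ∂(uniformMeasure N) := by
  have := isProbabilityMeasure_uniformMeasure hN
  rw [integral_integral_swap
    (integrable_sphere_angle hN (f := fun x => f (rotate i j hij x.2 x.1))
      (hf.comp (continuous_rotate hij)))]
  simp [integral_comp_rotate hij _ hf.aestronglyMeasurable]

/-- `u'` is the derivative of `u` along the rotations in the plane of the coordinates `i`, `j`. -/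
def HasRotDeriv (i j : Fin N) (hij : i ≠ j) (u u' : KacSphere N → ℝ) : Prop :=
  ∀ v θ, HasDerivAt (fun θ => u (rotate i j hij θ v)) (u' (rotate i j hij θ v)) θ

theorem HasRotDeriv.average_eq_zero {i j : Fin N} {hij : i ≠ j} {u u' : KacSphere N → ℝ}
    (h : HasRotDeriv i j hij u u') (hu' : Continuous u') (v : KacSphere N) :
    ∫ θ, u' (rotate i j hij θ v) ∂angleMeasure = 0 := by
  have hc : Continuous fun θ => u' (rotate i j hij θ v) :=
    hu'.comp ((continuous_rotate hij).comp (Continuous.prodMk_right v))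
  rw [integral_angleMeasure, intervalIntegral.integral_eq_sub_of_hasDerivAt (fun θ _ => h v θ)
    (hc.intervalIntegrable _ _), rotate_pi, sub_self, mul_zero]

/-- Integration by parts: derivatives along rotations have mean zero. -/
theorem HasRotDeriv.integral_eq_zero (hN : 2 ≤ N) {i j : Fin N} {hij : i ≠ j}
    {u u' : KacSphere N → ℝ} (h : HasRotDeriv i j hij u u') (hu' : Continuous u') :
    ∫ v, u' v ∂(uniformMeasure N) = 0 := by
  rw [← integral_average_rotate hN hij hu']
  simp [h.average_eq_zero hu']

/-- Exchanging pre- and post-collisional velocities. -/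
theorem integral_rotate_swap (hN : 2 ≤ N) {i j : Fin N} (hij : i ≠ j)
    {f : KacSphere N → KacSphere N → ℝ} (hf : Continuous (Function.uncurry f)) :
    ∫ v, ∫ θ, f (rotate i j hij θ v) v ∂angleMeasure ∂(uniformMeasure N)
      = ∫ v, ∫ θ, f v (rotate i j hij θ v) ∂angleMeasure ∂(uniformMeasure N) := by
  have := isProbabilityMeasure_uniformMeasure hN
  have hr := continuous_rotate (N := N) hij
  rw [integral_integral_swap (integrable_sphere_angle hN
      (f := fun x => f (rotate i j hij x.2 x.1) x.1) (hf.comp (hr.prodMk continuous_fst))),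
    integral_integral_swap (f := fun v θ => f v (rotate i j hij θ v)) (integrable_sphere_angle hN
      (f := fun x => f x.1 (rotate i j hij x.2 x.1)) (hf.comp (continuous_fst.prodMk hr))),
    ← integral_angleMeasure_neg fun θ => ∫ v, f v (rotate i j hij θ v) ∂(uniformMeasure N)]
  refine integral_congr_ae (Filter.Eventually.of_forall fun θ => ?_)
  have hrθ : Continuous fun v => rotate i j hij (-θ) v := hr.comp (Continuous.prodMk_left (-θ))
  have := integral_comp_rotate hij θ (f := fun v => f v (rotate i j hij (-θ) v))
    (hf.comp (continuous_id.prodMk hrθ)).aestronglyMeasurable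
  simp only [rotate_rotate, add_neg_cancel, rotate_zero] at this
  exact this

open MvPolynomial

/-! ### Polynomials on the Kac sphere and the Casimir operator -/

/-- The function on the Kac sphere which a polynomial in the velocities defines. -/
def polyFun (p : MvPolynomial (Fin N) ℝ) (v : KacSphere N) : ℝ :=
  eval (fun k => (v : Velocities N) k) p

@[simp] theorem polyFun_add (p q : MvPolynomial (Fin N) ℝ) (v : KacSphere N) :
    polyFun (p + q) v = polyFun p v + polyFun q v := map_add _ _ _

@[simp] theorem polyFun_sub (p q : MvPolynomial (Fin N) ℝ) (v : KacSphere N) :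
    polyFun (p - q) v = polyFun p v - polyFun q v := map_sub _ _ _

@[simp] theorem polyFun_neg (p : MvPolynomial (Fin N) ℝ) (v : KacSphere N) :
    polyFun (-p) v = -polyFun p v := map_neg _ _

@[simp] theorem polyFun_mul (p q : MvPolynomial (Fin N) ℝ) (v : KacSphere N) :
    polyFun (p * q) v = polyFun p v * polyFun q v := map_mul _ _ _

@[simp] theorem polyFun_smul (c : ℝ) (p : MvPolynomial (Fin N) ℝ) (v : KacSphere N) :
    polyFun (c • p) v = c * polyFun p v := smul_eval _ _ _

@[simp] theorem polyFun_sum {ι : Type*} (s : Finset ι) (p : ι → MvPolynomial (Fin N) ℝ)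
    (v : KacSphere N) : polyFun (∑ a ∈ s, p a) v = ∑ a ∈ s, polyFun (p a) v := map_sum _ _ _

@[simp] theorem polyFun_X (k : Fin N) (v : KacSphere N) :
    polyFun (X k) v = (v : Velocities N) k := eval_X _

@[simp] theorem polyFun_C (c : ℝ) (v : KacSphere N) : polyFun (C c) v = c := eval_C _

@[simp] theorem polyFun_zero (v : KacSphere N) : polyFun 0 v = 0 := map_zero _

theorem continuous_polyFun (p : MvPolynomial (Fin N) ℝ) : Continuous (polyFun p) :=
  (MvPolynomial.continuous_eval p).comp (continuous_pi fun k => continuous_coord k)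

/-- The infinitesimal rotation `v_l ∂_k - v_k ∂_l`, as a derivation of the polynomials. -/
def rotD (k l : Fin N) :
    Derivation ℝ (MvPolynomial (Fin N) ℝ) (MvPolynomial (Fin N) ℝ) :=
  (X l : MvPolynomial (Fin N) ℝ) • pderiv k - (X k : MvPolynomial (Fin N) ℝ) • pderiv l

theorem rotD_apply (k l : Fin N) (p : MvPolynomial (Fin N) ℝ) :
    rotD k l p = X l * pderiv k p - X k * pderiv l p := rfl

theorem rotD_self (k : Fin N) (p : MvPolynomial (Fin N) ℝ) : rotD k k p = 0 := by
  rw [rotD_apply, sub_self]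

theorem rotD_swap (k l : Fin N) (p : MvPolynomial (Fin N) ℝ) : rotD l k p = -rotD k l p := by
  rw [rotD_apply, rotD_apply, neg_sub]

theorem rotD_X (k l n : Fin N) : rotD k l (X n : MvPolynomial (Fin N) ℝ)
    = (if n = k then X l else 0) - (if n = l then X k else 0) := by
  rw [rotD_apply, pderiv_X, pderiv_X]
  simp only [Pi.single_apply]
  split_ifs <;> simp

theorem hasRotDeriv_polyFun {k l : Fin N} (hkl : k ≠ l) (p : MvPolynomial (Fin N) ℝ) :
    HasRotDeriv k l hkl (polyFun p) (polyFun (rotD k l p)) := by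
  intro v θ
  induction p using MvPolynomial.induction_on with
  | C a =>
    have h : rotD k l (C a : MvPolynomial (Fin N) ℝ) = 0 := (rotD k l).map_algebraMap a
    simpa [h] using hasDerivAt_const θ a
  | add p q hp hq => simpa using hp.fun_add hq
  | mul_X p n hp =>
    have hX : HasDerivAt (fun θ => polyFun (X n) (rotate k l hkl θ v))
        (polyFun (rotD k l (X n)) (rotate k l hkl θ v)) θ := by
      have hc := (Real.hasDerivAt_cos θ)
      have hs := (Real.hasDerivAt_sin θ)
      simp only [rotD_X, polyFun_sub, polyFun_X, rotate_apply]
      by_cases h1 : n = k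
      · subst h1
        simp only [if_true, hkl, if_false, polyFun_X, polyFun_zero, rotate_apply, hkl.symm]
        refine ((hc.const_mul ((v : Velocities N) n)).fun_add
          (hs.const_mul ((v : Velocities N) l))).congr_deriv ?_
        ring
      · by_cases h2 : n = l
        · subst h2
          simp only [if_true, h1, if_false, polyFun_X, polyFun_zero, rotate_apply]
          refine ((hs.const_mul (-(v : Velocities N) k)).fun_add
            (hc.const_mul ((v : Velocities N) n))).congr_deriv ?_
          ring
        · simpa [h1, h2] using hasDerivAt_const θ ((v : Velocities N) n)
    simp only [Derivation.leibniz, smul_eq_mul, polyFun_add, polyFun_mul]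
    refine (hp.fun_mul hX).congr_deriv ?_
    ring

/-- The Casimir operator `∑_{k,l} (v_l ∂_k - v_k ∂_l)²`. On the Kac sphere it is `2N` times the
Laplace–Beltrami operator, every plane being counted twice. -/
def casimir : MvPolynomial (Fin N) ℝ →ₗ[ℝ] MvPolynomial (Fin N) ℝ :=
  ∑ k, ∑ l, (rotD k l).toLinearMap ∘ₗ (rotD k l).toLinearMap

theorem casimir_apply (p : MvPolynomial (Fin N) ℝ) :
    casimir p = ∑ k, ∑ l, rotD k l (rotD k l p) := by
  simp [casimir]

theorem integral_rotD (hN : 2 ≤ N) (k l : Fin N) (p : MvPolynomial (Fin N) ℝ) :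
    ∫ v, polyFun (rotD k l p) v ∂(uniformMeasure N) = 0 := by
  by_cases hkl : k = l
  · subst hkl; simp [rotD_self]
  · exact (hasRotDeriv_polyFun hkl p).integral_eq_zero hN (continuous_polyFun _)

theorem integral_casimir (hN : 2 ≤ N) (p : MvPolynomial (Fin N) ℝ) :
    ∫ v, polyFun (casimir p) v ∂(uniformMeasure N) = 0 := by
  have hint : ∀ q : MvPolynomial (Fin N) ℝ, Integrable (polyFun q) (uniformMeasure N) :=
    fun q => integrable_sphere hN (continuous_polyFun q)
  simp only [casimir_apply, polyFun_sum]
  rw [integral_finsetSum _ fun k _ => integrable_finsetSum _ fun l _ => hint _]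
  refine Finset.sum_eq_zero fun k _ => ?_
  rw [integral_finsetSum _ fun l _ => hint _]
  exact Finset.sum_eq_zero fun l _ => integral_rotD hN k l _

theorem casimir_X_sq (i : Fin N) (v : KacSphere N) :
    polyFun (casimir (X i ^ 2)) v = 4 * N - 4 * N * (v : Velocities N) i ^ 2 := by
  have h1 : ∀ k l : Fin N, polyFun (rotD k l (rotD k l (X i ^ 2))) v
      = 2 * (if i = k then ((v : Velocities N) l ^ 2 - (v : Velocities N) i ^ 2) else 0)
        + 2 * (if i = l then ((v : Velocities N) k ^ 2 - (v : Velocities N) i ^ 2) else 0) := by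
    intro k l
    by_cases hkl : k = l
    · subst hkl
      rw [rotD_self]
      split_ifs with h
      · subst h; simp
      · simp
    · have : rotD k l (X i ^ 2 : MvPolynomial (Fin N) ℝ) = 2 * (X i * rotD k l (X i)) := by
        rw [pow_two, Derivation.leibniz, smul_eq_mul]; ring
      have h2 : ∀ p, rotD k l (2 * p : MvPolynomial (Fin N) ℝ) = 2 * rotD k l p := by
        intro p; rw [two_mul, map_add, ← two_mul]
      rw [this, h2, Derivation.leibniz, smul_eq_mul, smul_eq_mul, rotD_X]
      have h2v : polyFun (2 : MvPolynomial (Fin N) ℝ) v = 2 := polyFun_C 2 v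
      by_cases hik : i = k
      · subst hik
        simp only [if_true, hkl, if_false, sub_zero, rotD_X, Ne.symm hkl, zero_sub, polyFun_mul,
          polyFun_add, polyFun_X, polyFun_neg, h2v]
        ring
      · by_cases hil : i = l
        · subst hil
          simp only [if_true, hik, if_false, sub_zero, rotD_X, Ne.symm hik, zero_sub, polyFun_mul,
            polyFun_add, polyFun_X, h2v, map_neg, polyFun_neg]
          ring
        · simp [hik, hil]
  rw [casimir_apply]
  simp only [polyFun_sum, h1, Finset.sum_add_distrib, ← Finset.mul_sum, Finset.sum_ite_eq,
    Finset.mem_univ, if_true]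
  have h3 : ∀ k : Fin N, ∑ l : Fin N, (if i = k then ((v : Velocities N) l ^ 2
      - (v : Velocities N) i ^ 2) else 0)
      = if i = k then (N : ℝ) - N * (v : Velocities N) i ^ 2 else 0 := by
    intro k
    split_ifs
    · simp [Finset.sum_sub_distrib, sum_sq_eq]
    · simp
  simp only [h3, Finset.sum_ite_eq, Finset.mem_univ, if_true, Finset.sum_sub_distrib, sum_sq_eq,
    Finset.sum_const, Finset.card_univ, Fintype.card_fin, nsmul_eq_mul]
  ring

/-! ### The Casimir operator commutes with rotations -/

/-- The linear substitution `X_m ↦ ∑_n g_{mn} X_n`. -/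
def linSubst (g : Matrix (Fin N) (Fin N) ℝ) :
    MvPolynomial (Fin N) ℝ →ₐ[ℝ] MvPolynomial (Fin N) ℝ :=
  aeval fun m => ∑ n, g m n • (X n : MvPolynomial (Fin N) ℝ)

theorem linSubst_X (g : Matrix (Fin N) (Fin N) ℝ) (m : Fin N) :
    linSubst g (X m) = ∑ n, g m n • (X n : MvPolynomial (Fin N) ℝ) := aeval_X _ _

theorem pderiv_linSubst (g : Matrix (Fin N) (Fin N) ℝ) (k : Fin N) (p : MvPolynomial (Fin N) ℝ) :
    pderiv k (linSubst g p) = ∑ m, g m k • linSubst g (pderiv m p) := by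
  induction p using MvPolynomial.induction_on with
  | C a =>
    have : linSubst g (C a) = C a := AlgHom.commutes _ a
    rw [this, pderiv_C]
    simp
  | add p q hp hq => simp [hp, hq, Finset.sum_add_distrib]
  | mul_X p n hp =>
    rw [map_mul, pderiv_mul, hp, linSubst_X]
    have h1 : pderiv k (∑ n', g n n' • (X n' : MvPolynomial (Fin N) ℝ)) = C (g n k) := by
      simp only [map_sum, Derivation.map_smul, pderiv_X, Pi.single_apply, smul_ite, smul_zero]
      rw [Finset.sum_eq_single k]
      · simp [C_eq_smul_one]
      · intro b _ hb; simp [hb]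
      · simp
    rw [h1]
    simp only [pderiv_mul, map_add, map_mul, smul_add, Finset.sum_add_distrib, linSubst_X, pderiv_X,
      Pi.single_apply]
    congr 1
    · rw [Finset.sum_mul]; simp only [smul_mul_assoc]
    · rw [Finset.sum_eq_single n]
      · simp [smul_eq_C_mul, mul_comm]
      · intro b _ hb; simp [Ne.symm hb]
      · simp

theorem rotD_linSubst {g : Matrix (Fin N) (Fin N) ℝ} (hg : g.transpose * g = 1) (k l : Fin N)
    (p : MvPolynomial (Fin N) ℝ) :
    rotD k l (linSubst g p) = ∑ m, ∑ n, (g m k * g n l) • linSubst g (rotD m n p) := by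
  have hX : ∀ k, (X k : MvPolynomial (Fin N) ℝ) = ∑ n, g n k • linSubst g (X n) := by
    intro k
    simp only [linSubst_X, Finset.smul_sum, smul_smul]
    rw [Finset.sum_comm]
    simp only [← Finset.sum_smul]
    have : ∀ y, ∑ x, g x k * g x y = (1 : Matrix (Fin N) (Fin N) ℝ) k y := by
      intro y; rw [← hg, Matrix.mul_apply]; rfl
    simp [this, Matrix.one_apply]
  rw [rotD_apply, pderiv_linSubst, pderiv_linSubst]
  conv_lhs => rw [hX l, hX k]
  simp only [Finset.sum_mul_sum, rotD_apply, map_sub, map_mul, smul_sub, Finset.sum_sub_distrib]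
  congr 1
  · rw [Finset.sum_comm]
    refine Finset.sum_congr rfl fun m _ => Finset.sum_congr rfl fun n _ => ?_
    rw [smul_mul_smul_comm, mul_comm (g n l)]
  · refine Finset.sum_congr rfl fun m _ => Finset.sum_congr rfl fun n _ => ?_
    rw [smul_mul_smul_comm]

theorem casimir_linSubst {g : Matrix (Fin N) (Fin N) ℝ} (hg : g.transpose * g = 1)
    (p : MvPolynomial (Fin N) ℝ) : casimir (linSubst g p) = linSubst g (casimir p) := by
  have hg' : g * g.transpose = 1 := mul_eq_one_comm.1 hg
  have hsum : ∀ m m', ∑ k, g m k * g m' k = if m = m' then 1 else 0 := by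
    intro m m'
    rw [← Matrix.one_apply, ← hg', Matrix.mul_apply]; rfl
  have h1 : ∀ k l, rotD k l (rotD k l (linSubst g p)) = ∑ m, ∑ n, ∑ m', ∑ n',
      ((g m k * g m' k) * (g n l * g n' l)) • linSubst g (rotD m' n' (rotD m n p)) := by
    intro k l
    rw [rotD_linSubst hg]
    simp only [map_sum, Derivation.map_smul, rotD_linSubst hg, Finset.smul_sum, smul_smul]
    refine Finset.sum_congr rfl fun m _ => Finset.sum_congr rfl fun n _ =>
      Finset.sum_congr rfl fun m' _ => Finset.sum_congr rfl fun n' _ => ?_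
    congr 1; ring
  have h2 : ∀ m n m' n', ∑ k, ∑ l, ((g m k * g m' k) * (g n l * g n' l)) •
      linSubst g (rotD m' n' (rotD m n p))
      = if m = m' then if n = n' then linSubst g (rotD m' n' (rotD m n p)) else 0 else 0 := by
    intro m n m' n'
    simp only [← Finset.sum_smul, ← Finset.mul_sum, ← Finset.sum_mul, hsum]
    split_ifs <;> simp
  have hswap : ∀ f : Fin N → Fin N → Fin N → MvPolynomial (Fin N) ℝ,
      ∑ k, ∑ l, ∑ m, f k l m = ∑ m, ∑ k, ∑ l, f k l m := by
    intro f
    rw [Finset.sum_comm]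
    conv_lhs => enter [2, k]; rw [Finset.sum_comm]
    rw [Finset.sum_comm]
    exact Finset.sum_congr rfl fun m _ => Finset.sum_comm
  rw [casimir_apply, casimir_apply]
  simp only [h1, map_sum]
  calc _ = ∑ m, ∑ n, ∑ m', ∑ n', ∑ k, ∑ l, ((g m k * g m' k) * (g n l * g n' l)) •
      linSubst g (rotD m' n' (rotD m n p)) := by
        rw [hswap]; refine Finset.sum_congr rfl fun m _ => ?_
        rw [hswap]; refine Finset.sum_congr rfl fun n _ => ?_
        rw [hswap]; refine Finset.sum_congr rfl fun m' _ => ?_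
        rw [hswap]
    _ = _ := by
        simp only [h2]
        simp

/-- A collision map of the sphere is induced by an orthogonal matrix. -/
theorem exists_matrix_rotate {i j : Fin N} (hij : i ≠ j) (θ : ℝ) :
    ∃ g : Matrix (Fin N) (Fin N) ℝ, g.transpose * g = 1 ∧
      ∀ v : KacSphere N, ∀ m, (rotate i j hij θ v : Velocities N) m
        = ∑ n, g m n * (v : Velocities N) n := by
  refine ⟨Matrix.of fun m n => if m = i then (if n = i then Real.cos θ else 0)
      + (if n = j then Real.sin θ else 0) else if m = j then (if n = i then -Real.sin θ else 0)
      + (if n = j then Real.cos θ else 0) else if n = m then 1 else 0, ?_, ?_⟩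
  · ext a b
    rw [Matrix.mul_apply, Matrix.one_apply]
    set g : Matrix (Fin N) (Fin N) ℝ := Matrix.of _ with hg
    have hD : ∑ m, ((if a = m then (1 : ℝ) else 0) * (if b = m then 1 else 0))
        = if a = b then 1 else 0 := by simp
    have hsplit : ∑ m, (g.transpose a m * g m b
          - (if a = m then (1 : ℝ) else 0) * (if b = m then 1 else 0))
        = (g.transpose a i * g i b - (if a = i then (1 : ℝ) else 0) * (if b = i then 1 else 0))
        + (g.transpose a j * g j b
          - (if a = j then (1 : ℝ) else 0) * (if b = j then 1 else 0)) := by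
      refine Finset.sum_eq_add i j hij (fun m _ hm => ?_) (by simp) (by simp)
      simp [hg, hm.1, hm.2]
    rw [Finset.sum_sub_distrib, hD, sub_eq_iff_eq_add] at hsplit
    rw [hsplit, add_eq_right]
    have h := Real.sin_sq_add_cos_sq θ
    simp only [hg, Matrix.transpose_apply, Matrix.of_apply, if_true, hij.symm, if_false]
    by_cases ha : a = i <;> by_cases ha' : a = j <;> by_cases hb : b = i <;>
      by_cases hb' : b = j <;> simp [ha, ha', hb, hb', hij, hij.symm] <;>
      first | linear_combination h | ring
  · intro v m
    rw [rotate_apply]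
    simp only [Matrix.of_apply]
    split_ifs
    · simp [add_mul, Finset.sum_add_distrib]; ring
    · simp [add_mul, Finset.sum_add_distrib]; ring
    · simp

theorem polyFun_linSubst (g : Matrix (Fin N) (Fin N) ℝ) (p : MvPolynomial (Fin N) ℝ)
    (v w : KacSphere N) (h : ∀ m, (w : Velocities N) m = ∑ n, g m n * (v : Velocities N) n) :
    polyFun (linSubst g p) v = polyFun p w := by
  induction p using MvPolynomial.induction_on with
  | C a =>
    have : linSubst g (C a) = C a := AlgHom.commutes _ a
    rw [this, polyFun_C, polyFun_C]
  | add p q hp hq => simp [hp, hq]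
  | mul_X p n hp => simp [hp, linSubst_X, h]

/-! ### Diagonalising the Casimir operator -/

/-- A self-adjoint operator on a finite-dimensional space with a positive definite symmetric form
splits every vector into eigenvectors. -/
theorem exists_sum_eigenvectors {V : Type*} [AddCommGroup V] [Module ℝ V] [FiniteDimensional ℝ V]
    (B : V →ₗ[ℝ] V →ₗ[ℝ] ℝ) (hsymm : ∀ x y, B x y = B y x) (hpos : ∀ x, x ≠ 0 → 0 < B x x)
    (T : V →ₗ[ℝ] V) (hT : ∀ x y, B (T x) y = B x (T y)) (x : V) :
    ∃ (n : ℕ) (q : Fin n → V) (c : Fin n → ℝ), (∀ i, T (q i) = c i • q i) ∧ ∑ i, q i = x := by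
  let core : InnerProductSpace.Core ℝ V :=
    { inner := fun x y => B x y
      conj_inner_symm := fun x y => by simp [hsymm x y]
      re_inner_nonneg := fun x => by
        rcases eq_or_ne x 0 with rfl | hx
        · simp
        · simpa using (hpos x hx).le
      add_left := fun x y z => by simp
      smul_left := fun x y r => by simp
      definite := fun x hx => by
        by_contra h
        exact (hpos x h).ne' hx }
  let _ : NormedAddCommGroup V := core.toNormedAddCommGroup
  let _ : InnerProductSpace ℝ V := InnerProductSpace.ofCore core.toCore
  have hS : T.IsSymmetric := fun x y => hT x y
  refine ⟨_, fun i => (hS.eigenvectorBasis rfl).repr x i • hS.eigenvectorBasis rfl i,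
    hS.eigenvalues rfl, fun i => ?_, (hS.eigenvectorBasis rfl).sum_repr x⟩
  rw [map_smul, hS.apply_eigenvectorBasis, smul_comm]
  simp

/-- The Fischer inner product, for which the monomials `X^m` are orthogonal with square norm `m!`
and multiplication by `X_i` is adjoint to `∂_i`. -/
def fischer : MvPolynomial (Fin N) ℝ →ₗ[ℝ] MvPolynomial (Fin N) ℝ →ₗ[ℝ] ℝ :=
  (basisMonomials (Fin N) ℝ).constr ℝ fun m => ((∏ i, ((m i).factorial : ℝ)) • lcoeff ℝ m)

theorem fischer_monomial (m : Fin N →₀ ℕ) (a : ℝ) (q : MvPolynomial (Fin N) ℝ) :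
    fischer (monomial m a) q = a * ((∏ i, ((m i).factorial : ℝ)) * coeff m q) := by
  have h : monomial m a = a • basisMonomials (Fin N) ℝ m := by simp [smul_monomial]
  rw [h, map_smul, fischer, Module.Basis.constr_basis]
  simp

theorem fischer_apply (p q : MvPolynomial (Fin N) ℝ) :
    fischer p q = ∑ m ∈ p.support, coeff m p * ((∏ i, ((m i).factorial : ℝ)) * coeff m q) := by
  conv_lhs => rw [p.as_sum]
  simp only [map_sum, LinearMap.sum_apply, fischer_monomial]

theorem fischer_comm (p q : MvPolynomial (Fin N) ℝ) : fischer p q = fischer q p := by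
  have h : ∀ p q : MvPolynomial (Fin N) ℝ, fischer p q = ∑ m ∈ p.support ∪ q.support,
      coeff m p * ((∏ i, ((m i).factorial : ℝ)) * coeff m q) := by
    intro p q
    rw [fischer_apply]
    refine Finset.sum_subset Finset.subset_union_left fun m _ hm => ?_
    rw [notMem_support_iff.1 hm, zero_mul]
  rw [h p q, h q p, Finset.union_comm]
  exact Finset.sum_congr rfl fun m _ => by ring

theorem fischer_self_pos {p : MvPolynomial (Fin N) ℝ} (hp : p ≠ 0) : 0 < fischer p p := by
  rw [fischer_apply]
  refine Finset.sum_pos (fun m hm => ?_) (support_nonempty.2 hp)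
  have h1 : 0 < ∏ i, ((m i).factorial : ℝ) :=
    Finset.prod_pos fun i _ => by exact_mod_cast Nat.factorial_pos _
  have h2 := mul_self_pos.2 (mem_support_iff.1 hm)
  nlinarith [mul_pos h1 h2]

theorem fischer_X_mul (i : Fin N) (p q : MvPolynomial (Fin N) ℝ) :
    fischer (X i * p) q = fischer p (pderiv i q) := by
  induction p using MvPolynomial.induction_on' with
  | add p r hp hr => simp [mul_add, hp, hr]
  | monomial m a =>
    rw [X, monomial_mul, one_mul, fischer_monomial, fischer_monomial, coeff_pderiv, add_comm m]
    have h : ∏ k, (((Finsupp.single i 1 + m : Fin N →₀ ℕ) k).factorial : ℝ)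
        = (∏ k, ((m k).factorial : ℝ)) * (m i + 1) := by
      rw [← Finset.mul_prod_erase _ _ (Finset.mem_univ i),
        ← Finset.mul_prod_erase Finset.univ (fun k => ((m k).factorial : ℝ)) (Finset.mem_univ i)]
      have : ∏ k ∈ Finset.univ.erase i, (((Finsupp.single i 1 + m : Fin N →₀ ℕ) k).factorial : ℝ)
          = ∏ k ∈ Finset.univ.erase i, ((m k).factorial : ℝ) := by
        refine Finset.prod_congr rfl fun k hk => ?_
        rw [Finsupp.add_apply, Finsupp.single_eq_of_ne (Finset.ne_of_mem_erase hk), zero_add]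
      rw [this, Finsupp.add_apply, Finsupp.single_eq_same, add_comm 1, Nat.factorial_succ]
      push_cast
      ring
    rw [h]
    ring

theorem fischer_rotD (k l : Fin N) (p q : MvPolynomial (Fin N) ℝ) :
    fischer (rotD k l p) q = -fischer p (rotD k l q) := by
  have h : ∀ k l, fischer (X l * pderiv k p) q = fischer p (X k * pderiv l q) := by
    intro k l
    rw [fischer_X_mul, fischer_comm, ← fischer_X_mul, fischer_comm]
  rw [rotD_apply, rotD_apply, map_sub, LinearMap.sub_apply, map_sub, h, h]
  ring

theorem fischer_casimir_left (p q : MvPolynomial (Fin N) ℝ) :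
    fischer (casimir p) q = -∑ k, ∑ l, fischer (rotD k l p) (rotD k l q) := by
  rw [casimir_apply]
  simp only [map_sum, LinearMap.sum_apply, ← Finset.sum_neg_distrib]
  exact Finset.sum_congr rfl fun k _ => Finset.sum_congr rfl fun l _ => fischer_rotD k l _ q

theorem fischer_casimir_comm (p q : MvPolynomial (Fin N) ℝ) :
    fischer (casimir p) q = fischer p (casimir q) := by
  rw [fischer_comm p, fischer_casimir_left, fischer_casimir_left]
  simp only [fischer_comm (rotD _ _ q)]

theorem X_mul_pderiv_mem_restrictTotalDegree {d : ℕ} (k l : Fin N) {p : MvPolynomial (Fin N) ℝ}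
    (hp : p ∈ restrictTotalDegree (Fin N) ℝ d) :
    X l * pderiv k p ∈ restrictTotalDegree (Fin N) ℝ d := by
  rw [mem_restrictTotalDegree] at hp ⊢
  refine Finset.sup_le fun m hm => ?_
  rw [support_X_mul, Finset.mem_map] at hm
  obtain ⟨m', hm', rfl⟩ := hm
  rw [mem_support_iff, coeff_pderiv] at hm'
  have h := (le_totalDegree (mem_support_iff.2 (left_ne_zero_of_mul hm'))).trans hp
  change Finsupp.degree (Finsupp.single l 1 + m') ≤ d
  change Finsupp.degree (m' + Finsupp.single k 1) ≤ d at h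
  rw [map_add, Finsupp.degree_single] at h ⊢
  omega

theorem casimir_mem_restrictTotalDegree {d : ℕ} {p : MvPolynomial (Fin N) ℝ}
    (hp : p ∈ restrictTotalDegree (Fin N) ℝ d) :
    casimir p ∈ restrictTotalDegree (Fin N) ℝ d := by
  have h : ∀ k l, ∀ q ∈ restrictTotalDegree (Fin N) ℝ d,
      rotD k l q ∈ restrictTotalDegree (Fin N) ℝ d := fun k l q hq =>
    Submodule.sub_mem _ (X_mul_pderiv_mem_restrictTotalDegree k l hq)
      (X_mul_pderiv_mem_restrictTotalDegree l k hq)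
  rw [casimir_apply]
  exact Submodule.sum_mem _ fun k _ => Submodule.sum_mem _ fun l _ => h k l _ (h k l p hp)

/-- Every polynomial is a finite sum of eigenvectors of the Casimir operator; the eigenvalues are
nonpositive, and the eigenvectors of eigenvalue `0` are annihilated by all infinitesimal
rotations. -/
theorem exists_casimir_eigenvectors (p : MvPolynomial (Fin N) ℝ) :
    ∃ (n : ℕ) (q : Fin n → MvPolynomial (Fin N) ℝ) (c : Fin n → ℝ),
      (∀ i, casimir (q i) = c i • q i) ∧ (∀ i, c i ≤ 0) ∧
      (∀ i, c i = 0 → ∀ k l, rotD k l (q i) = 0) ∧ ∑ i, q i = p := by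
  let V := restrictTotalDegree (Fin N) ℝ p.totalDegree
  let T : V →ₗ[ℝ] V := casimir.restrict fun q hq => casimir_mem_restrictTotalDegree hq
  obtain ⟨n, q, c, hq, hsum⟩ := exists_sum_eigenvectors (V := V)
    (fischer.compl₁₂ V.subtype V.subtype) (fun x y => fischer_comm _ _)
    (fun x hx => fischer_self_pos fun h => hx (Subtype.ext h)) T
    (fun x y => fischer_casimir_comm _ _) ⟨p, (mem_restrictTotalDegree _ _ _).2 le_rfl⟩
  have hq' : ∀ i, casimir (q i : MvPolynomial (Fin N) ℝ) = c i • (q i : MvPolynomial (Fin N) ℝ) :=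
    fun i => congrArg Subtype.val (hq i)
  have hsum' : ∑ i, (q i : MvPolynomial (Fin N) ℝ) = p := by
    have := congrArg Subtype.val hsum
    simpa using this
  have hnonneg : ∀ q : MvPolynomial (Fin N) ℝ, 0 ≤ fischer q q := fun q => by
    rcases eq_or_ne q 0 with rfl | h
    · simp
    · exact (fischer_self_pos h).le
  -- The identity `c ⟨q, q⟩ = -∑ ⟨L q, L q⟩` gives the sign of the eigenvalue unless `q` vanishes;
  -- a vanishing `q` is assigned the eigenvalue `0`.
  have key : ∀ i, c i * fischer (q i : MvPolynomial (Fin N) ℝ) (q i)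
      = -∑ k, ∑ l, fischer (rotD k l (q i : MvPolynomial (Fin N) ℝ)) (rotD k l (q i)) := by
    intro i
    rw [← fischer_casimir_left, hq', map_smul, LinearMap.smul_apply, smul_eq_mul]
  have hS : ∀ i, 0 ≤ ∑ k, ∑ l,
      fischer (rotD k l (q i : MvPolynomial (Fin N) ℝ)) (rotD k l (q i)) := fun i =>
    Finset.sum_nonneg fun k _ => Finset.sum_nonneg fun l _ => hnonneg _
  refine ⟨n, fun i => q i, fun i => if (q i : MvPolynomial (Fin N) ℝ) = 0 then 0 else c i,
    fun i => ?_, fun i => ?_, fun i hi k l => ?_, hsum'⟩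
  · dsimp only
    split_ifs with h
    · simp [h]
    · exact hq' i
  · dsimp only
    split_ifs with h
    · exact le_rfl
    · by_contra hc
      have h1 := mul_pos (not_le.1 hc) (fischer_self_pos h)
      rw [key] at h1
      linarith [hS i]
  · dsimp only at hi ⊢
    split_ifs at hi with h
    · rw [h, map_zero]
    · have h1 := key i
      rw [hi, zero_mul, zero_eq_neg] at h1
      have h2 := (Finset.sum_eq_zero_iff_of_nonneg fun k _ =>
        Finset.sum_nonneg fun l _ => hnonneg _).1 h1 k (Finset.mem_univ k)
      have h3 := (Finset.sum_eq_zero_iff_of_nonneg fun l _ => hnonneg _).1 h2 l (Finset.mem_univ l)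
      by_contra h4
      exact (fischer_self_pos h4).ne' h3

open Filter Topology

/-! ### The heat flow on polynomials -/

/-- The rotations in coordinate planes act transitively on the sphere. -/
theorem eq_of_rotate_invariant (hN : 2 ≤ N) {f : KacSphere N → ℝ}
    (hf : ∀ (i j : Fin N) (hij : i ≠ j) θ v, f (rotate i j hij θ v) = f v) (v w : KacSphere N) :
    f v = f w := by
  let o : Fin N := ⟨0, by omega⟩
  have step : ∀ s : Finset (Fin N), o ∉ s → ∀ v : KacSphere N, ∃ w : KacSphere N, f w = f v ∧
      (∀ k ∈ s, (w : Velocities N) k = 0) ∧ (s.Nonempty → 0 ≤ (w : Velocities N) o) := by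
    intro s
    induction s using Finset.induction_on with
    | empty => exact fun _ v => ⟨v, rfl, by simp, by simp⟩
    | insert a s ha ih =>
      intro ho v
      rw [Finset.mem_insert, not_or] at ho
      obtain ⟨w, hw, hz, -⟩ := ih ho.2 v
      let z : ℂ := ⟨(w : Velocities N) o, (w : Velocities N) a⟩
      have hre : (w : Velocities N) o = ‖z‖ * Real.cos z.arg := (Complex.norm_mul_cos_arg z).symm
      have him : (w : Velocities N) a = ‖z‖ * Real.sin z.arg := (Complex.norm_mul_sin_arg z).symm
      refine ⟨rotate o a ho.1 z.arg w, (hf _ _ _ _ _).trans hw, fun k hk => ?_, fun _ => ?_⟩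
      · rw [rotate_apply]
        rcases Finset.mem_insert.1 hk with rfl | hk
        · rw [if_neg (Ne.symm ho.1), if_pos rfl, hre, him]
          ring
        · rw [if_neg (fun h : k = o => ho.2 (h ▸ hk)), if_neg (fun h : k = a => ha (h ▸ hk)), hz k hk]
      · rw [rotate_apply, if_pos rfl, hre, him]
        have : ‖z‖ * Real.cos z.arg * Real.cos z.arg + ‖z‖ * Real.sin z.arg * Real.sin z.arg
            = ‖z‖ := by linear_combination ‖z‖ * Real.sin_sq_add_cos_sq z.arg
        rw [this]
        exact norm_nonneg z
  have hne : (Finset.univ.erase o).Nonempty :=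
    ⟨⟨1, by omega⟩, Finset.mem_erase.2 ⟨by simp [o], Finset.mem_univ _⟩⟩
  have pole : ∀ v : KacSphere N, ∃ w : KacSphere N, f w = f v ∧
      ∀ k, (w : Velocities N) k = if k = o then Real.sqrt N else 0 := by
    intro v
    obtain ⟨w, hw, hz, h0⟩ := step (Finset.univ.erase o) (Finset.notMem_erase _ _) v
    refine ⟨w, hw, fun k => ?_⟩
    split_ifs with hk
    · subst hk
      have hs := sum_sq_eq w
      rw [← Finset.add_sum_erase _ _ (Finset.mem_univ o),
        Finset.sum_eq_zero fun k hk => by rw [hz k hk]; ring, add_zero] at hs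
      exact (Real.sqrt_sq (h0 hne)).symm.trans (congrArg Real.sqrt hs)
    · exact hz k (Finset.mem_erase.2 ⟨hk, Finset.mem_univ _⟩)
  obtain ⟨v', hv, hv'⟩ := pole v
  obtain ⟨w', hw, hw'⟩ := pole w
  have : v' = w' := Subtype.ext (by ext k; rw [hv', hw'])
  rw [← hv, ← hw, this]

theorem polyFun_eq_of_rotD_eq_zero (hN : 2 ≤ N) {p : MvPolynomial (Fin N) ℝ}
    (hp : ∀ k l, rotD k l p = 0) (v w : KacSphere N) : polyFun p v = polyFun p w := by
  refine eq_of_rotate_invariant hN (fun i j hij θ v => ?_) v w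
  have h := hasRotDeriv_polyFun hij p v
  have := is_const_of_deriv_eq_zero (fun θ => (h θ).differentiableAt)
    (fun θ => by rw [(h θ).deriv, hp, polyFun_zero]) θ 0
  simpa [rotate_zero] using this

/-- `P` solves the heat equation `∂_t P = C P` for the Casimir operator `C`; the regularity is
recorded for all images of `P` under linear maps. -/
structure IsHeatFlow (P : ℝ → MvPolynomial (Fin N) ℝ) : Prop where
  continuous : ∀ A : MvPolynomial (Fin N) ℝ →ₗ[ℝ] MvPolynomial (Fin N) ℝ,
    Continuous fun x : ℝ × KacSphere N => polyFun (A (P x.1)) x.2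
  hasDerivAt : ∀ (A : MvPolynomial (Fin N) ℝ →ₗ[ℝ] MvPolynomial (Fin N) ℝ) (v : KacSphere N)
    (t : ℝ), HasDerivAt (fun t => polyFun (A (P t)) v) (polyFun (A (casimir (P t))) v) t

theorem IsHeatFlow.neg {P : ℝ → MvPolynomial (Fin N) ℝ} (h : IsHeatFlow P) :
    IsHeatFlow fun t => -P t where
  continuous A := by simpa using (h.continuous (-A))
  hasDerivAt A v t := by simpa using (h.hasDerivAt (-A) v t)

/-- The heat flow issued from a polynomial exists, and it converges to the mean. -/
theorem exists_isHeatFlow (hN : 2 ≤ N) (p : MvPolynomial (Fin N) ℝ) :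
    ∃ P : ℝ → MvPolynomial (Fin N) ℝ, IsHeatFlow P ∧ P 0 = p ∧
      ∀ v, Tendsto (fun t => polyFun (P t) v) atTop (𝓝 (∫ w, polyFun p w ∂(uniformMeasure N))) := by
  have := isProbabilityMeasure_uniformMeasure hN
  obtain ⟨n, q, c, hq, hc, hc0, hsum⟩ := exists_casimir_eigenvectors p
  refine ⟨fun t => ∑ i, Real.exp (c i * t) • q i, ⟨fun A => ?_, fun A v t => ?_⟩, by simp [hsum],
    fun v => ?_⟩
  · simp only [map_sum, map_smul, polyFun_sum, polyFun_smul]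
    refine continuous_finsetSum _ fun i _ => ?_
    exact (Real.continuous_exp.comp (continuous_const.mul continuous_fst)).mul
      ((continuous_polyFun _).comp continuous_snd)
  · simp only [map_sum, map_smul, polyFun_sum, polyFun_smul, hq]
    refine HasDerivAt.fun_sum fun i _ => ?_
    refine ((((hasDerivAt_id t).const_mul (c i)).exp).mul_const (polyFun (A (q i)) v)).congr_deriv ?_
    simp only [id]
    ring
  · have hint : ∫ w, polyFun p w ∂(uniformMeasure N)
        = ∑ i, ∫ w, polyFun (q i) w ∂(uniformMeasure N) := by
      rw [← integral_finsetSum _ fun i _ => integrable_sphere hN (continuous_polyFun _)]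
      simp [← hsum]
    rw [hint]
    simp only [polyFun_sum, polyFun_smul]
    refine tendsto_finsetSum _ fun i _ => ?_
    rcases (hc i).lt_or_eq with h | h
    · have h1 : ∫ w, polyFun (q i) w ∂(uniformMeasure N) = 0 := by
        have h2 := integral_casimir hN (q i)
        simp only [hq, polyFun_smul, integral_const_mul] at h2
        exact (mul_eq_zero.1 h2).resolve_left h.ne
      rw [h1, show (0 : ℝ) = 0 * polyFun (q i) v by ring]
      refine Tendsto.mul_const _ (Real.tendsto_exp_atBot.comp ?_)
      exact tendsto_id.const_mul_atTop_of_neg h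
    · have h1 : ∀ w, polyFun (q i) w = polyFun (q i) v := fun w =>
        polyFun_eq_of_rotD_eq_zero hN (hc0 i h) w v
      simp [h, h1]

/-- The necessary second-order condition at a minimum. -/
theorem second_deriv_nonneg_of_isMin {f f' : ℝ → ℝ} {d x : ℝ} (hf : ∀ y, HasDerivAt f (f' y) y)
    (hf' : HasDerivAt f' d x) (hmin : ∀ y, f x ≤ f y) : 0 ≤ d := by
  by_contra hd
  have hderiv : deriv f = f' := funext fun y => (hf y).deriv
  have hloc : IsLocalMin f x := Eventually.of_forall hmin
  have hmax : IsLocalMax f x := isLocalMax_of_deriv_deriv_neg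
    (by rw [hderiv, hf'.deriv]; exact not_le.1 hd) hloc.deriv_eq_zero (hf x).continuousAt
  have hconst : f =ᶠ[𝓝 x] fun _ => f x := by
    filter_upwards [hmax] with y hy using le_antisymm hy (hmin y)
  have h2 := hconst.deriv.deriv_eq
  rw [hderiv, hf'.deriv] at h2
  simp at h2
  exact hd h2.ge

/-- The Casimir operator is nonnegative at a minimum. -/
theorem casimir_nonneg_of_isMin {p : MvPolynomial (Fin N) ℝ} {v : KacSphere N}
    (hv : ∀ w, polyFun p v ≤ polyFun p w) : 0 ≤ polyFun (casimir p) v := by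
  rw [casimir_apply]
  simp only [polyFun_sum]
  refine Finset.sum_nonneg fun k _ => Finset.sum_nonneg fun l _ => ?_
  by_cases hkl : k = l
  · subst hkl; simp [rotD_self]
  · have h := second_deriv_nonneg_of_isMin (x := 0) (hasRotDeriv_polyFun hkl p v)
      (hasRotDeriv_polyFun hkl (rotD k l p) v 0) (fun y => by rw [rotate_zero]; exact hv _)
    rwa [rotate_zero] at h

theorem nonpos_of_hasDerivAt_of_isMin_left {f : ℝ → ℝ} {d a t : ℝ} (hf : HasDerivAt f d t)
    (hat : a < t) (hmin : ∀ s ∈ Icc a t, f t ≤ f s) : d ≤ 0 := by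
  have h := hasDerivWithinAt_iff_tendsto_slope' (s := Iio t) (by simp) |>.1 hf.hasDerivWithinAt
  refine le_of_tendsto h ?_
  filter_upwards [Ioo_mem_nhdsLT hat] with s hs
  rw [slope_def_field]
  exact div_nonpos_of_nonneg_of_nonpos (by linarith [hmin s ⟨hs.1.le, hs.2.le⟩])
    (by linarith [hs.2])

/-- The minimum principle. -/
theorem IsHeatFlow.le_of_le {P : ℝ → MvPolynomial (Fin N) ℝ} (h : IsHeatFlow P) {c : ℝ}
    (h0 : ∀ v, c ≤ polyFun (P 0) v) {t : ℝ} (ht : 0 ≤ t) (v : KacSphere N) :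
    c ≤ polyFun (P t) v := by
  have key : ∀ ε > 0, c ≤ polyFun (P t) v + ε * t := by
    intro ε hε
    have hcont : Continuous fun x : ℝ × KacSphere N => polyFun (P x.1) x.2 + ε * x.1 :=
      (h.continuous LinearMap.id).add (continuous_const.mul continuous_fst)
    have hK : IsCompact (Icc (0 : ℝ) t ×ˢ (univ : Set (KacSphere N))) :=
      isCompact_Icc.prod isCompact_univ
    have hne : (Icc (0 : ℝ) t ×ˢ (univ : Set (KacSphere N))).Nonempty :=
      ⟨(0, v), ⟨⟨le_rfl, ht⟩, mem_univ _⟩⟩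
    obtain ⟨⟨s, w⟩, hsw, hmin⟩ := hK.exists_isMinOn hne hcont.continuousOn
    have hs0 : 0 ≤ s := hsw.1.1
    have hst : s ≤ t := hsw.1.2
    have hmin' : ∀ s' ∈ Icc 0 t, ∀ w', polyFun (P s) w + ε * s ≤ polyFun (P s') w' + ε * s' :=
      fun s' hs' w' => isMinOn_iff.1 hmin (s', w') ⟨hs', mem_univ _⟩
    rcases hs0.eq_or_lt with hs | hs
    · have := hmin' t ⟨ht, le_rfl⟩ v
      subst hs
      linarith [h0 w]
    · -- at a minimum in the interior of time, the time derivative contradicts the heat equation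
      exfalso
      have h1 := nonpos_of_hasDerivAt_of_isMin_left
        ((h.hasDerivAt LinearMap.id w s).add ((hasDerivAt_id s).const_mul ε)) hs
        (fun s' hs' => hmin' s' ⟨hs'.1, hs'.2.trans hst⟩ w)
      have h2 : 0 ≤ polyFun (casimir (P s)) w := casimir_nonneg_of_isMin fun w' => by
        have := hmin' s ⟨hs0, hst⟩ w'
        linarith
      simp only [LinearMap.id_apply, mul_one] at h1
      linarith
  refine le_of_forall_pos_le_add fun δ hδ => ?_
  have := key (δ / (t + 1)) (by positivity)
  have h2 : δ / (t + 1) * t ≤ δ := by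
    rw [div_mul_eq_mul_div, div_le_iff₀ (by positivity)]; nlinarith
  linarith

theorem IsHeatFlow.ge_of_ge {P : ℝ → MvPolynomial (Fin N) ℝ} (h : IsHeatFlow P) {c : ℝ}
    (h0 : ∀ v, polyFun (P 0) v ≤ c) {t : ℝ} (ht : 0 ≤ t) (v : KacSphere N) :
    polyFun (P t) v ≤ c := by
  have := h.neg.le_of_le (c := -c) (fun v => by simpa using h0 v) ht v
  simpa using this

/-! ### Elementary inequalities -/

/-- The integrand `(a - b)(log a - log b)` of the entropy production. -/
def jeffreys (a b : ℝ) : ℝ := (a - b) * (Real.log a - Real.log b)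

theorem jeffreys_nonneg {a b : ℝ} (ha : 0 < a) (hb : 0 < b) : 0 ≤ jeffreys a b := by
  unfold jeffreys
  rcases le_total a b with h | h
  · exact mul_nonneg_of_nonpos_of_nonpos (by linarith) (by linarith [Real.log_le_log ha h])
  · exact mul_nonneg (by linarith) (by linarith [Real.log_le_log hb h])

theorem jeffreys_comm (a b : ℝ) : jeffreys a b = jeffreys b a := by
  unfold jeffreys; ring

/-- The logarithmic mean is at most the arithmetic mean. -/
theorem two_mul_sub_le_add_mul_log {a b : ℝ} (hb : 0 < b) (hab : b ≤ a) :
    2 * (a - b) ≤ (a + b) * (Real.log a - Real.log b) := by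
  have ha : 0 < a := hb.trans_le hab
  set x := (a - b) / (a + b) with hx
  have hx0 : 0 ≤ x := div_nonneg (by linarith) (by linarith)
  have hx1 : x < 1 := by rw [hx, div_lt_one (by linarith)]; linarith
  have hs := Real.hasSum_log_sub_log_of_abs_lt_one (x := x) (by rw [abs_of_nonneg hx0]; exact hx1)
  have h1 := le_hasSum hs 0 fun k _ => by positivity
  have h2 : Real.log (1 + x) - Real.log (1 - x) = Real.log a - Real.log b := by
    rw [← Real.log_div (by linarith) (by linarith), ← Real.log_div ha.ne' hb.ne']
    congr 1
    rw [div_eq_div_iff (by linarith) hb.ne', hx]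
    field_simp
    ring
  rw [h2] at h1
  simp at h1
  have h3 : x * (a + b) = a - b := by rw [hx]; field_simp
  nlinarith

theorem jeffreys_le {a b : ℝ} (ha : 0 < a) (hb : 0 < b) :
    jeffreys a b ≤ (a + b) / 2 * (Real.log a - Real.log b) ^ 2 := by
  wlog h : b ≤ a generalizing a b
  · have := this hb ha (le_of_not_ge h)
    rw [jeffreys_comm, add_comm a b]
    linarith [this, neg_sq (Real.log b - Real.log a), neg_sub (Real.log b) (Real.log a),
      show (Real.log a - Real.log b) ^ 2 = (Real.log b - Real.log a) ^ 2 by ring]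
  · have h1 := two_mul_sub_le_add_mul_log hb h
    have h2 : 0 ≤ Real.log a - Real.log b := by linarith [Real.log_le_log hb h]
    unfold jeffreys
    nlinarith [mul_le_mul_of_nonneg_right h1 h2]

/-- The tangential gradient dominates the derivative in a coordinate plane, with a gain when
`v_i² + v_j²` is small. -/
theorem two_mul_sum_sq_mul_le (v b : Fin N → ℝ) {i j : Fin N} (hij : i ≠ j)
    (hv : 0 < ∑ k, v k ^ 2) :
    2 * (∑ k, v k ^ 2) * (v j * b i - v i * b j) ^ 2
      ≤ (v i ^ 2 + v j ^ 2) * ∑ k, ∑ l, (v l * b k - v k * b l) ^ 2 := by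
  set S := ∑ k, v k ^ 2 with hS
  set B := ∑ k, b k ^ 2 with hB
  set β := ∑ k, v k * b k with hβ
  have hsum : ∑ k, ∑ l, (v l * b k - v k * b l) ^ 2 = 2 * (S * B - β ^ 2) := by
    have : ∀ k l, (v l * b k - v k * b l) ^ 2
        = b k ^ 2 * v l ^ 2 - 2 * ((v k * b k) * (v l * b l)) + v k ^ 2 * b l ^ 2 :=
      fun k l => by ring
    simp only [this, Finset.sum_add_distrib, Finset.sum_sub_distrib, ← Finset.mul_sum,
      ← Finset.sum_mul]
    rw [← hS, ← hB, ← hβ]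
    ring
  have hproj : ∑ k, (b k - β / S * v k) ^ 2 = B - β ^ 2 / S := by
    have : ∀ k, (b k - β / S * v k) ^ 2
        = b k ^ 2 - 2 * (β / S) * (v k * b k) + (β / S) ^ 2 * v k ^ 2 := fun k => by ring
    simp only [this, Finset.sum_add_distrib, Finset.sum_sub_distrib, ← Finset.mul_sum]
    rw [← hS, ← hB, ← hβ]
    field_simp
    ring
  have htwo : (b i - β / S * v i) ^ 2 + (b j - β / S * v j) ^ 2 ≤ B - β ^ 2 / S := by
    rw [← hproj, ← Finset.sum_pair (f := fun k => (b k - β / S * v k) ^ 2) hij]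
    exact Finset.sum_le_sum_of_subset_of_nonneg (Finset.subset_univ _)
      fun _ _ _ => sq_nonneg _
  have hcs : (v j * b i - v i * b j) ^ 2
      ≤ (v i ^ 2 + v j ^ 2) * ((b i - β / S * v i) ^ 2 + (b j - β / S * v j) ^ 2) := by
    nlinarith [sq_nonneg (v i * (b i - β / S * v i) + v j * (b j - β / S * v j))]
  have h3 : (v j * b i - v i * b j) ^ 2 ≤ (v i ^ 2 + v j ^ 2) * (B - β ^ 2 / S) :=
    hcs.trans (mul_le_mul_of_nonneg_left htwo (by positivity))
  have h4 : S * (B - β ^ 2 / S) = S * B - β ^ 2 := by field_simp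
  rw [hsum]
  calc 2 * S * (v j * b i - v i * b j) ^ 2
      ≤ 2 * S * ((v i ^ 2 + v j ^ 2) * (B - β ^ 2 / S)) := by gcongr
    _ = (v i ^ 2 + v j ^ 2) * (2 * (S * (B - β ^ 2 / S))) := by ring
    _ = _ := by rw [h4]

/-- The Cauchy–Schwarz inequality for the integral of `f` against `1`. -/
theorem sq_intervalIntegral_le {f : ℝ → ℝ} (hf : Continuous f) {x : ℝ} (hx : 0 ≤ x) :
    (∫ s in (0 : ℝ)..x, f s) ^ 2 ≤ x * ∫ s in (0 : ℝ)..x, f s ^ 2 := by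
  rcases hx.eq_or_lt with rfl | hx
  · simp
  set I := ∫ s in (0 : ℝ)..x, f s
  have h0 : 0 ≤ ∫ s in (0 : ℝ)..x, (f s - I / x) ^ 2 :=
    intervalIntegral.integral_nonneg hx.le fun _ _ => sq_nonneg _
  have h1 : ∫ s in (0 : ℝ)..x, (f s - I / x) ^ 2
      = (∫ s in (0 : ℝ)..x, f s ^ 2) - 2 * (I / x) * I + x * (I / x) ^ 2 := by
    have : ∀ s, (f s - I / x) ^ 2 = f s ^ 2 - 2 * (I / x) * f s + (I / x) ^ 2 := fun s => by ring
    simp only [this]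
    rw [intervalIntegral.integral_add, intervalIntegral.integral_sub,
      intervalIntegral.integral_const_mul, intervalIntegral.integral_const]
    · simp [I]
    all_goals exact Continuous.intervalIntegrable (by fun_prop) _ _
  rw [h1] at h0
  have h2 : x * (∫ s in (0 : ℝ)..x, f s ^ 2) - I ^ 2
      = x * ((∫ s in (0 : ℝ)..x, f s ^ 2) - 2 * (I / x) * I + x * (I / x) ^ 2) := by
    field_simp
    ring
  nlinarith [mul_nonneg hx.le h0]

theorem integral_sq_sub_half_le {g g' : ℝ → ℝ} (hg : ∀ x, HasDerivAt g (g' x) x)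
    (hg' : Continuous g') :
    ∫ x in (0 : ℝ)..Real.pi, (g x - g 0) ^ 2
      ≤ Real.pi ^ 2 / 2 * ∫ x in (0 : ℝ)..Real.pi, g' x ^ 2 := by
  have hgc : Continuous g := continuous_iff_continuousAt.2 fun x => (hg x).continuousAt
  set E := ∫ x in (0 : ℝ)..Real.pi, g' x ^ 2
  have hpt : ∀ x ∈ Icc 0 Real.pi, (g x - g 0) ^ 2 ≤ x * E := by
    intro x hx
    rw [← intervalIntegral.integral_eq_sub_of_hasDerivAt (fun y _ => hg y)
      (hg'.intervalIntegrable _ _)]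
    refine (sq_intervalIntegral_le hg' hx.1).trans (mul_le_mul_of_nonneg_left ?_ hx.1)
    exact intervalIntegral.integral_mono_interval le_rfl hx.1 hx.2
      (Eventually.of_forall fun _ => sq_nonneg _) ((hg'.pow 2).intervalIntegrable _ _)
  calc _ ≤ ∫ x in (0 : ℝ)..Real.pi, x * E :=
        intervalIntegral.integral_mono_on Real.pi_pos.le
          (Continuous.intervalIntegrable (by fun_prop) _ _)
          (Continuous.intervalIntegrable (by fun_prop) _ _) hpt
    _ = _ := by rw [intervalIntegral.integral_mul_const, integral_id]; ring

/-- A Poincaré-type inequality on the circle, based at a point. -/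
theorem integral_sq_sub_le {g g' : ℝ → ℝ} (hg : ∀ x, HasDerivAt g (g' x) x)
    (hg' : Continuous g') :
    ∫ x, (g 0 - g x) ^ 2 ∂angleMeasure ≤ Real.pi ^ 2 / 2 * ∫ x, g' x ^ 2 ∂angleMeasure := by
  have hgc : Continuous g := continuous_iff_continuousAt.2 fun x => (hg x).continuousAt
  have h1 := integral_sq_sub_half_le hg hg'
  have h2 := integral_sq_sub_half_le (g := fun x => g (-x)) (g' := fun x => -g' (-x))
    (fun x => by simpa [Function.comp_def] using (hg (-x)).comp x (hasDerivAt_neg x)) (by fun_prop)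
  simp only [neg_zero, neg_sq] at h2
  rw [intervalIntegral.integral_comp_neg (fun x => (g x - g 0) ^ 2),
    intervalIntegral.integral_comp_neg (fun x => g' x ^ 2), neg_zero] at h2
  have hsplit : ∀ f : ℝ → ℝ, Continuous f → ∫ x in (-Real.pi)..Real.pi, f x
      = (∫ x in (-Real.pi)..0, f x) + ∫ x in (0 : ℝ)..Real.pi, f x := fun f hf =>
    (intervalIntegral.integral_add_adjacent_intervals (hf.intervalIntegrable _ _)
      (hf.intervalIntegrable _ _)).symm
  have hsq : ∀ x, (g 0 - g x) ^ 2 = (g x - g 0) ^ 2 := fun x => by ring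
  simp only [hsq]
  rw [integral_angleMeasure, integral_angleMeasure, hsplit _ (by fun_prop), hsplit _ (by fun_prop)]
  have h3 : 0 ≤ 1 / (2 * Real.pi) := by positivity
  nlinarith [mul_le_mul_of_nonneg_left (add_le_add h1 h2) h3]

theorem sum_sum_eq_two_mul_sum_pairs {G : Fin N → Fin N → ℝ} (hG : ∀ k, G k k = 0)
    (hsymm : ∀ k l, G k l = G l k) :
    ∑ k, ∑ l, G k l = 2 * ∑ p : {p : Fin N × Fin N // p.1 < p.2}, G p.1.1 p.1.2 := by
  have hswap : ∑ k, ∑ l, (if l < k then G k l else 0) = ∑ k, ∑ l, (if k < l then G k l else 0) := by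
    rw [Finset.sum_comm]
    exact Finset.sum_congr rfl fun k _ => Finset.sum_congr rfl fun l _ => by rw [hsymm]
  have hsub : ∑ p : {p : Fin N × Fin N // p.1 < p.2}, G p.1.1 p.1.2
      = ∑ k, ∑ l, (if k < l then G k l else 0) := by
    rw [← Fintype.sum_prod_type' (f := fun k l => if k < l then G k l else 0),
      ← Finset.sum_filter]
    exact (Finset.sum_subtype _ (by simp) fun p : Fin N × Fin N => G p.1 p.2).symm
  rw [hsub, two_mul]
  nth_rw 1 [← hswap]
  rw [← Finset.sum_add_distrib]
  refine Finset.sum_congr rfl fun k _ => ?_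
  rw [← Finset.sum_add_distrib]
  refine Finset.sum_congr rfl fun l _ => ?_
  rcases lt_trichotomy k l with h | rfl | h
  · simp [h, h.not_gt]
  · simp [hG]
  · simp [h, h.not_gt]

/-! ### Dissipation of the entropy and of the entropy production along the heat flow -/

theorem continuous_log_polyFun {p : MvPolynomial (Fin N) ℝ} (hp : ∀ v, 0 < polyFun p v) :
    Continuous fun v => Real.log (polyFun p v) :=
  (continuous_polyFun p).log fun v => (hp v).ne'

theorem continuous_rotD_div {p : MvPolynomial (Fin N) ℝ} (hp : ∀ v, 0 < polyFun p v)
    (k l : Fin N) : Continuous fun v => polyFun (rotD k l p) v / polyFun p v :=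
  (continuous_polyFun _).div (continuous_polyFun p) fun v => (hp v).ne'

theorem hasRotDeriv_log_polyFun {p : MvPolynomial (Fin N) ℝ} (hp : ∀ v, 0 < polyFun p v)
    {k l : Fin N} (hkl : k ≠ l) :
    HasRotDeriv k l hkl (fun v => Real.log (polyFun p v))
      (fun v => polyFun (rotD k l p) v / polyFun p v) :=
  fun v θ => (hasRotDeriv_polyFun hkl p v θ).log (hp _).ne'

/-- Entropy dissipation is the Fisher information. -/
theorem integral_log_mul_casimir (hN : 2 ≤ N) {p : MvPolynomial (Fin N) ℝ}
    (hp : ∀ v, 0 < polyFun p v) :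
    ∫ v, (1 + Real.log (polyFun p v)) * polyFun (casimir p) v ∂(uniformMeasure N)
      = -∑ k, ∑ l, ∫ v, polyFun (rotD k l p) v ^ 2 / polyFun p v ∂(uniformMeasure N) := by
  have hlog := continuous_log_polyFun hp
  have hc := fun q : MvPolynomial (Fin N) ℝ => continuous_polyFun q
  have hpne : ∀ v, polyFun p v ≠ 0 := fun v => (hp v).ne'
  have hc1 : ∀ k l, Continuous fun v =>
      (1 + Real.log (polyFun p v)) * polyFun (rotD k l (rotD k l p)) v :=
    fun k l => (continuous_const.add hlog).mul (hc _)
  have hc2 : ∀ k l, Continuous fun v => polyFun (rotD k l p) v ^ 2 / polyFun p v :=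
    fun k l => ((hc _).pow 2).div (hc p) hpne
  have key : ∀ k l, ∫ v, (1 + Real.log (polyFun p v)) * polyFun (rotD k l (rotD k l p)) v
      ∂(uniformMeasure N) = -∫ v, polyFun (rotD k l p) v ^ 2 / polyFun p v ∂(uniformMeasure N) := by
    intro k l
    by_cases hkl : k = l
    · subst hkl; simp [rotD_self]
    rw [eq_neg_iff_add_eq_zero, ← integral_add (integrable_sphere hN (hc1 k l))
      (integrable_sphere hN (hc2 k l))]
    refine HasRotDeriv.integral_eq_zero hN (hij := hkl)
      (u := fun v => (1 + Real.log (polyFun p v)) * polyFun (rotD k l p) v) (fun v θ => ?_)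
      ((hc1 k l).add (hc2 k l))
    have h1 := hasRotDeriv_log_polyFun hp hkl v θ
    have h2 := hasRotDeriv_polyFun hkl (rotD k l p) v θ
    refine ((h1.const_add 1).fun_mul h2).congr_deriv ?_
    field_simp [hpne]
    ring
  simp only [casimir_apply, polyFun_sum, Finset.mul_sum, ← Finset.sum_neg_distrib, ← key]
  rw [integral_finsetSum _ fun k _ => integrable_finsetSum _ fun l _ =>
    integrable_sphere hN (hc1 k l)]
  exact Finset.sum_congr rfl fun k _ => integral_finsetSum _ fun l _ =>
    integrable_sphere hN (hc1 k l)

/-- The partial derivative of `jeffreys` with respect to its first argument; by symmetry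
`jeffreysDeriv b a` is the other one. -/
def jeffreysDeriv (a b : ℝ) : ℝ := Real.log a - Real.log b + (a - b) / a

theorem continuous_jeffreys_comp {X : Type*} [TopologicalSpace X] {f g : X → ℝ} (hf : Continuous f)
    (hg : Continuous g) (hf0 : ∀ x, 0 < f x) (hg0 : ∀ x, 0 < g x) :
    Continuous fun x => jeffreys (f x) (g x) :=
  (hf.sub hg).mul ((hf.log fun x => (hf0 x).ne').sub (hg.log fun x => (hg0 x).ne'))

theorem continuous_jeffreysDeriv_comp {X : Type*} [TopologicalSpace X] {f g : X → ℝ}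
    (hf : Continuous f) (hg : Continuous g) (hf0 : ∀ x, 0 < f x) (hg0 : ∀ x, 0 < g x) :
    Continuous fun x => jeffreysDeriv (f x) (g x) :=
  ((hf.log fun x => (hf0 x).ne').sub (hg.log fun x => (hg0 x).ne')).add
    ((hf.sub hg).div hf fun x => (hf0 x).ne')

theorem hasDerivAt_jeffreys {f g : ℝ → ℝ} {f' g' x : ℝ} (hf : HasDerivAt f f' x)
    (hg : HasDerivAt g g' x) (hf0 : 0 < f x) (hg0 : 0 < g x) :
    HasDerivAt (fun y => jeffreys (f y) (g y))
      (jeffreysDeriv (f x) (g x) * f' + jeffreysDeriv (g x) (f x) * g') x := by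
  refine ((hf.fun_sub hg).fun_mul ((hf.log hf0.ne').fun_sub (hg.log hg0.ne'))).congr_deriv ?_
  simp only [jeffreysDeriv]
  have e1 := hf0.ne'
  have e2 := hg0.ne'
  field_simp
  ring

theorem hasDerivAt_jeffreysDeriv {f g : ℝ → ℝ} {f' g' x : ℝ} (hf : HasDerivAt f f' x)
    (hg : HasDerivAt g g' x) (hf0 : 0 < f x) (hg0 : 0 < g x) :
    HasDerivAt (fun y => jeffreysDeriv (f y) (g y))
      ((1 / f x + g x / f x ^ 2) * f' - (1 / f x + 1 / g x) * g') x := by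
  refine (((hf.log hf0.ne').fun_sub (hg.log hg0.ne')).fun_add
    ((hf.fun_sub hg).fun_div hf hf0.ne')).congr_deriv ?_
  have e1 := hf0.ne'
  have e2 := hg0.ne'
  field_simp
  ring

/-- Integration by parts in one plane: the Hessian of `(a - b)(log a - log b)` is
`(a + b)(ȧ/a - ḃ/b)²`. -/
theorem integral_jeffreys_rotDeriv (hN : 2 ≤ N) {k l : Fin N} {hkl : k ≠ l}
    {F F' F'' K K' K'' W W' W'' : KacSphere N → ℝ}
    (hF : HasRotDeriv k l hkl F F') (hF' : HasRotDeriv k l hkl F' F'')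
    (hK : HasRotDeriv k l hkl K K') (hK' : HasRotDeriv k l hkl K' K'')
    (hW : HasRotDeriv k l hkl W W') (hW' : HasRotDeriv k l hkl W' W'')
    (cF : Continuous F) (cF' : Continuous F') (cF'' : Continuous F'') (cK : Continuous K)
    (cK' : Continuous K') (cK'' : Continuous K'') (cW : Continuous W) (cW'' : Continuous W'')
    (hF0 : ∀ v, 0 < F v) (hK0 : ∀ v, 0 < K v) :
    ∫ v, (W v * (jeffreysDeriv (F v) (K v) * F'' v + jeffreysDeriv (K v) (F v) * K'' v)
      - (W'' v * jeffreys (F v) (K v)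
        - W v * (F v + K v) * (F' v / F v - K' v / K v) ^ 2)) ∂(uniformMeasure N) = 0 := by
  refine HasRotDeriv.integral_eq_zero hN (hij := hkl)
    (u := fun v => W v * (jeffreysDeriv (F v) (K v) * F' v + jeffreysDeriv (K v) (F v) * K' v)
      - W' v * jeffreys (F v) (K v)) (fun v θ => ?_) ?_
  · have h1 := hasDerivAt_jeffreysDeriv (hF v θ) (hK v θ) (hF0 _) (hK0 _)
    have h2 := hasDerivAt_jeffreysDeriv (hK v θ) (hF v θ) (hK0 _) (hF0 _)
    have h3 := hasDerivAt_jeffreys (hF v θ) (hK v θ) (hF0 _) (hK0 _)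
    refine (((hW v θ).fun_mul ((h1.fun_mul (hF' v θ)).fun_add (h2.fun_mul (hK' v θ)))).fun_sub
      ((hW' v θ).fun_mul h3)).congr_deriv ?_
    have e1 := (hF0 (rotate k l hkl θ v)).ne'
    have e2 := (hK0 (rotate k l hkl θ v)).ne'
    generalize jeffreysDeriv (F (rotate k l hkl θ v)) (K (rotate k l hkl θ v)) = A
    generalize jeffreysDeriv (K (rotate k l hkl θ v)) (F (rotate k l hkl θ v)) = B
    generalize jeffreys (F (rotate k l hkl θ v)) (K (rotate k l hkl θ v)) = C
    generalize rotate k l hkl θ v = w at *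
    field_simp
    ring
  · have h1 := continuous_jeffreysDeriv_comp cF cK hF0 hK0
    have h2 := continuous_jeffreysDeriv_comp cK cF hK0 hF0
    have h3 := continuous_jeffreys_comp cF cK hF0 hK0
    have h4 := cF'.div cF fun v => (hF0 v).ne'
    have h5 := cK'.div cK fun v => (hK0 v).ne'
    exact (cW.mul ((h1.mul cF'').add (h2.mul cK''))).sub
      ((cW''.mul h3).sub ((cW.mul (cF.add cK)).mul ((h4.sub h5).pow 2)))

/-- The weighted relative entropy `∫ ω (F - K)(log F - log K)` of two solutions of the heat equation
is dissipated through the gradient of `log F - log K`. -/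
theorem integral_jeffreys_casimir (hN : 2 ≤ N) {p q ω : MvPolynomial (Fin N) ℝ}
    (hp : ∀ v, 0 < polyFun p v) (hq : ∀ v, 0 < polyFun q v) :
    ∫ v, polyFun ω v * (jeffreysDeriv (polyFun p v) (polyFun q v) * polyFun (casimir p) v
        + jeffreysDeriv (polyFun q v) (polyFun p v) * polyFun (casimir q) v) ∂(uniformMeasure N)
      = ∫ v, (polyFun (casimir ω) v * jeffreys (polyFun p v) (polyFun q v)
        - polyFun ω v * (polyFun p v + polyFun q v) * ∑ k, ∑ l,
          (polyFun (rotD k l p) v / polyFun p v - polyFun (rotD k l q) v / polyFun q v) ^ 2)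
        ∂(uniformMeasure N) := by
  have hc := fun r : MvPolynomial (Fin N) ℝ => continuous_polyFun r
  have h1 := continuous_jeffreysDeriv_comp (hc p) (hc q) hp hq
  have h2 := continuous_jeffreysDeriv_comp (hc q) (hc p) hq hp
  have h3 := continuous_jeffreys_comp (hc p) (hc q) hp hq
  have h4 := fun k l => continuous_rotD_div hp k l
  have h5 := fun k l => continuous_rotD_div hq k l
  have hcu : ∀ k l, Continuous fun v => polyFun ω v *
      (jeffreysDeriv (polyFun p v) (polyFun q v) * polyFun (rotD k l (rotD k l p)) v
        + jeffreysDeriv (polyFun q v) (polyFun p v) * polyFun (rotD k l (rotD k l q)) v)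
      - (polyFun (rotD k l (rotD k l ω)) v * jeffreys (polyFun p v) (polyFun q v)
        - polyFun ω v * (polyFun p v + polyFun q v) *
          (polyFun (rotD k l p) v / polyFun p v - polyFun (rotD k l q) v / polyFun q v) ^ 2) :=
    fun k l => ((hc ω).mul ((h1.mul (hc _)).add (h2.mul (hc _)))).sub
      (((hc _).mul h3).sub (((hc ω).mul ((hc p).add (hc q))).mul (((h4 k l).sub (h5 k l)).pow 2)))
  have key : ∀ k l, ∫ v, (polyFun ω v *
      (jeffreysDeriv (polyFun p v) (polyFun q v) * polyFun (rotD k l (rotD k l p)) v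
        + jeffreysDeriv (polyFun q v) (polyFun p v) * polyFun (rotD k l (rotD k l q)) v)
      - (polyFun (rotD k l (rotD k l ω)) v * jeffreys (polyFun p v) (polyFun q v)
        - polyFun ω v * (polyFun p v + polyFun q v) *
          (polyFun (rotD k l p) v / polyFun p v - polyFun (rotD k l q) v / polyFun q v) ^ 2))
        ∂(uniformMeasure N) = 0 := by
    intro k l
    by_cases hkl : k = l
    · subst hkl; simp [rotD_self]
    · have hd := fun r : MvPolynomial (Fin N) ℝ => hasRotDeriv_polyFun hkl r
      exact integral_jeffreys_rotDeriv hN (hd p) (hd _) (hd q) (hd _) (hd ω) (hd _) (hc _) (hc _)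
        (hc _) (hc _) (hc _) (hc _) (hc _) (hc _) hp hq
  have hsum := Finset.sum_eq_zero fun k (_ : k ∈ (Finset.univ : Finset (Fin N))) =>
    Finset.sum_eq_zero fun l (_ : l ∈ (Finset.univ : Finset (Fin N))) => key k l
  have hI1 := integrable_sphere hN
    ((hc ω).mul ((h1.mul (hc (casimir p))).add (h2.mul (hc (casimir q)))))
  have hI2 := integrable_sphere hN (((hc (casimir ω)).mul h3).sub
    (((hc ω).mul ((hc p).add (hc q))).mul (continuous_finsetSum Finset.univ fun k _ =>
      continuous_finsetSum Finset.univ fun l _ => ((h4 k l).sub (h5 k l)).pow 2)))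
  rw [← sub_eq_zero]
  refine (integral_sub hI1 hI2).symm.trans ?_
  have hswap : ∑ k, ∑ l, ∫ v, _ ∂(uniformMeasure N) = ∫ v, ∑ k, ∑ l, _ ∂(uniformMeasure N) :=
    (Finset.sum_congr rfl fun k _ => (integral_finsetSum Finset.univ fun l _ =>
      integrable_sphere hN (hcu k l)).symm).trans (integral_finsetSum Finset.univ fun k _ =>
        integrable_finsetSum Finset.univ fun l _ => integrable_sphere hN (hcu k l)).symm
  rw [hswap] at hsum
  rw [← hsum]
  refine integral_congr_ae (Eventually.of_forall fun v => ?_)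
  simp only [Pi.mul_apply, Pi.add_apply, Pi.sub_apply, Pi.pow_apply, casimir_apply, polyFun_sum,
    Finset.mul_sum, Finset.sum_mul, mul_add, Finset.sum_add_distrib, Finset.sum_sub_distrib]

/-! ### Dissipation of the entropy production of one pair -/

/-- The polynomial `6 + X_i² + X_j²`. Its constant term is chosen so that
`w * max 1 (10 - 5 w) ≤ 6 + w`, which `weight_mul_gradient_ge` needs. -/
def weightPoly (i j : Fin N) : MvPolynomial (Fin N) ℝ := C 6 + (X i ^ 2 + X j ^ 2)

theorem polyFun_weightPoly (i j : Fin N) (v : KacSphere N) :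
    polyFun (weightPoly i j) v = 6 + pairEnergy i j v := by
  simp [weightPoly, polyFun, pairEnergy]

theorem polyFun_casimir_weightPoly (i j : Fin N) (v : KacSphere N) :
    polyFun (casimir (weightPoly i j)) v = 8 * N - 4 * N * pairEnergy i j v := by
  have h : casimir (C 6 : MvPolynomial (Fin N) ℝ) = 0 := by
    rw [casimir_apply]
    refine Finset.sum_eq_zero fun k _ => Finset.sum_eq_zero fun l _ => ?_
    rw [show rotD k l (C 6 : MvPolynomial (Fin N) ℝ) = 0 from (rotD k l).map_algebraMap 6, map_zero]
  rw [weightPoly, map_add, map_add, h, polyFun_add, polyFun_add, casimir_X_sq, casimir_X_sq,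
    polyFun_zero, pairEnergy]
  ring

/-- The derivative of the rotated function in the plane of the rotation. -/
theorem polyFun_rotD_linSubst {i j : Fin N} (hij : i ≠ j) (θ : ℝ)
    {g : Matrix (Fin N) (Fin N) ℝ} (hg : ∀ v : KacSphere N, ∀ m,
      (rotate i j hij θ v : Velocities N) m = ∑ n, g m n * (v : Velocities N) n)
    (p : MvPolynomial (Fin N) ℝ) (v : KacSphere N) :
    polyFun (rotD i j (linSubst g p)) v = polyFun (rotD i j p) (rotate i j hij θ v) := by
  have h1 := hasRotDeriv_polyFun hij (linSubst g p) v 0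
  have h2 := (hasRotDeriv_polyFun hij p (rotate i j hij θ v)) 0
  have h3 : ∀ s, polyFun (linSubst g p) (rotate i j hij s v)
      = polyFun p (rotate i j hij s (rotate i j hij θ v)) := by
    intro s
    rw [polyFun_linSubst g p _ _ (hg _), rotate_rotate, rotate_rotate, add_comm]
  simp only [h3] at h1
  have := h1.unique h2
  rwa [rotate_zero, rotate_zero] at this

/-- The pointwise lower bound for the gradient, in terms of the derivative in the plane `(i, j)`. -/
theorem weight_mul_gradient_ge {p q : MvPolynomial (Fin N) ℝ} {i j : Fin N} (hij : i ≠ j)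
    (v : KacSphere N) :
    2 * N * max 1 (10 - 5 * pairEnergy i j v) *
        (polyFun (rotD i j p) v / polyFun p v - polyFun (rotD i j q) v / polyFun q v) ^ 2
      ≤ (6 + pairEnergy i j v) * ∑ k, ∑ l,
        (polyFun (rotD k l p) v / polyFun p v - polyFun (rotD k l q) v / polyFun q v) ^ 2 := by
  set w := pairEnergy i j v with hw
  have hw0 : 0 ≤ w := pairEnergy_nonneg i j v
  have hN : (0 : ℝ) < N := by exact_mod_cast (Fin.pos i)
  have hform : ∀ k l, polyFun (rotD k l p) v / polyFun p v - polyFun (rotD k l q) v / polyFun q v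
      = (v : Velocities N) l * (polyFun (pderiv k p) v / polyFun p v
          - polyFun (pderiv k q) v / polyFun q v)
        - (v : Velocities N) k * (polyFun (pderiv l p) v / polyFun p v
          - polyFun (pderiv l q) v / polyFun q v) := by
    intro k l
    simp only [rotD_apply, polyFun_sub, polyFun_mul, polyFun_X]
    ring
  simp only [hform]
  have h := two_mul_sum_sq_mul_le (fun k => (v : Velocities N) k)
    (fun k => polyFun (pderiv k p) v / polyFun p v - polyFun (pderiv k q) v / polyFun q v) hij
    (by rw [sum_sq_eq]; exact hN)
  rw [sum_sq_eq, ← pairEnergy, ← hw] at h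
  have hS : 0 ≤ ∑ k : Fin N, ∑ l : Fin N, ((v : Velocities N) l * (polyFun (pderiv k p) v
      / polyFun p v - polyFun (pderiv k q) v / polyFun q v)
        - (v : Velocities N) k * (polyFun (pderiv l p) v / polyFun p v
          - polyFun (pderiv l q) v / polyFun q v)) ^ 2 :=
    Finset.sum_nonneg fun k _ => Finset.sum_nonneg fun l _ => sq_nonneg _
  generalize ∑ k : Fin N, ∑ l : Fin N, ((v : Velocities N) l * (polyFun (pderiv k p) v / polyFun p v
          - polyFun (pderiv k q) v / polyFun q v)
        - (v : Velocities N) k * (polyFun (pderiv l p) v / polyFun p v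
          - polyFun (pderiv l q) v / polyFun q v)) ^ 2 = S at *
  generalize ((v : Velocities N) j * (polyFun (pderiv i p) v / polyFun p v
          - polyFun (pderiv i q) v / polyFun q v)
        - (v : Velocities N) i * (polyFun (pderiv j p) v / polyFun p v
          - polyFun (pderiv j q) v / polyFun q v)) ^ 2 = a at *
  have hρ0 : 0 ≤ max 1 (10 - 5 * w) := le_trans zero_le_one (le_max_left _ _)
  have hρ : w * max 1 (10 - 5 * w) ≤ 6 + w := by
    rcases max_choice 1 (10 - 5 * w) with h1 | h1 <;> rw [h1] <;>
      nlinarith [sq_nonneg (w - 9 / 10)]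
  calc 2 * N * max 1 (10 - 5 * w) * a = max 1 (10 - 5 * w) * (2 * N * a) := by ring
    _ ≤ max 1 (10 - 5 * w) * (w * S) := mul_le_mul_of_nonneg_left h hρ0
    _ = w * max 1 (10 - 5 * w) * S := by ring
    _ ≤ (6 + w) * S := mul_le_mul_of_nonneg_right hρ hS

section

attribute [local irreducible] polyFun rotate pairEnergy jeffreys jeffreysDeriv

/-- A function of the pre- and the post-collisional velocity which, once symmetrised, bounds the
time derivative of the entropy production of the pair `(i, j)` along the heat flow. -/
def pairBound (p : MvPolynomial (Fin N) ℝ) (i j : Fin N) (x y : KacSphere N) : ℝ :=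
  polyFun p x * (N * max (4 - 2 * pairEnergy i j x) 0 *
    (Real.log (polyFun p x) - Real.log (polyFun p y)) ^ 2
    - 2 * N * max 1 (10 - 5 * pairEnergy i j x) *
      (polyFun (rotD i j p) x / polyFun p x - polyFun (rotD i j p) y / polyFun p y) ^ 2)

theorem continuous_pairBound {p : MvPolynomial (Fin N) ℝ} (hp : ∀ v, 0 < polyFun p v)
    (i j : Fin N) : Continuous (Function.uncurry (pairBound p i j)) := by
  have hF := continuous_polyFun p
  have hw := continuous_pairEnergy i j
  have hh := continuous_log_polyFun hp
  have hd := continuous_rotD_div hp i j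
  have c1 := continuous_fst (X := KacSphere N) (Y := KacSphere N)
  have c2 := continuous_snd (X := KacSphere N) (Y := KacSphere N)
  exact (hF.comp c1).mul (((continuous_const.mul
    ((continuous_const.sub (continuous_const.mul (hw.comp c1))).max continuous_const)).mul
    (((hh.comp c1).sub (hh.comp c2)).pow 2)).sub ((continuous_const.mul
    (continuous_const.max (continuous_const.sub (continuous_const.mul (hw.comp c1))))).mul
    (((hd.comp c1).sub (hd.comp c2)).pow 2)))

/-- The time derivative of the integrand of the entropy production of the pair `(i, j)`. -/
def pairDeriv (p : MvPolynomial (Fin N) ℝ) {i j : Fin N} (hij : i ≠ j) (v : KacSphere N)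
    (θ : ℝ) : ℝ :=
  (6 + pairEnergy i j v) *
    (jeffreysDeriv (polyFun p v) (polyFun p (rotate i j hij θ v)) * polyFun (casimir p) v
    + jeffreysDeriv (polyFun p (rotate i j hij θ v)) (polyFun p v)
      * polyFun (casimir p) (rotate i j hij θ v))

theorem continuous_pairDeriv {p : MvPolynomial (Fin N) ℝ} (hp : ∀ v, 0 < polyFun p v)
    {i j : Fin N} (hij : i ≠ j) :
    Continuous fun x : KacSphere N × ℝ => pairDeriv p hij x.1 x.2 := by
  have hr := continuous_rotate (N := N) hij
  have hC := continuous_polyFun (casimir p)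
  have hFr : Continuous fun x : KacSphere N × ℝ => polyFun p (rotate i j hij x.2 x.1) :=
    (continuous_polyFun p).comp hr
  have hF1 : Continuous fun x : KacSphere N × ℝ => polyFun p x.1 :=
    (continuous_polyFun p).comp continuous_fst
  exact (continuous_const.add ((continuous_pairEnergy i j).comp continuous_fst)).mul
      (((continuous_jeffreysDeriv_comp hF1 hFr (fun _ => hp _) fun _ => hp _).mul
        (hC.comp continuous_fst)).add
      ((continuous_jeffreysDeriv_comp hFr hF1 (fun _ => hp _) fun _ => hp _).mul (hC.comp hr)))

/-- The weight satisfies `C ω = N (8 - 4w)` with `w = v_i² + v_j²`, so that only small `w` make the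
first term of `integral_jeffreys_casimir` positive; the gradient term compensates it. -/
theorem integral_pairDeriv_le (hN : 2 ≤ N) {p : MvPolynomial (Fin N) ℝ} (hp : ∀ v, 0 < polyFun p v)
    {i j : Fin N} (hij : i ≠ j) (θ : ℝ) :
    ∫ v, pairDeriv p hij v θ ∂(uniformMeasure N)
      ≤ ∫ v, (pairBound p i j v (rotate i j hij θ v) + pairBound p i j (rotate i j hij θ v) v)
        ∂(uniformMeasure N) := by
  have hN0 : (0 : ℝ) < N := by exact_mod_cast (by omega : 0 < N)
  have hrθ : Continuous fun v => rotate i j hij θ v :=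
    (continuous_rotate (N := N) hij).comp (Continuous.prodMk_left θ)
  have hF := continuous_polyFun p
  have hw := continuous_pairEnergy i j
  have hf := continuous_pairBound hp i j
  obtain ⟨g, hg, hgr⟩ := exists_matrix_rotate hij θ
  have hK : ∀ v, polyFun (linSubst g p) v = polyFun p (rotate i j hij θ v) := fun v =>
    polyFun_linSubst g p _ _ (hgr v)
  have hK0 : ∀ v, 0 < polyFun (linSubst g p) v := fun v => by rw [hK]; exact hp _
  have hCK : ∀ v, polyFun (casimir (linSubst g p)) v = polyFun (casimir p) (rotate i j hij θ v) :=
    fun v => by rw [casimir_linSubst hg]; exact polyFun_linSubst g _ _ _ (hgr v)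
  have key := integral_jeffreys_casimir hN (ω := weightPoly i j) hp hK0
  simp only [polyFun_weightPoly, hCK, polyFun_casimir_weightPoly, hK] at key
  simp only [pairDeriv]
  rw [key]
  refine integral_mono ?_ ?_ fun v => ?_
  · have c1 := continuous_jeffreys_comp hF (hF.comp hrθ) hp fun v => hp _
    have c2 : ∀ k l, Continuous fun v => polyFun (rotD k l p) v / polyFun p v
        - polyFun (rotD k l (linSubst g p)) v / polyFun p (rotate i j hij θ v) := fun k l =>
      (continuous_rotD_div hp k l).sub
        ((continuous_polyFun _).div (hF.comp hrθ) fun v => (hp _).ne')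
    have c3 : Continuous fun v => ∑ k, ∑ l, (polyFun (rotD k l p) v / polyFun p v
        - polyFun (rotD k l (linSubst g p)) v / polyFun p (rotate i j hij θ v)) ^ 2 :=
      continuous_finsetSum _ fun k _ => continuous_finsetSum _ fun l _ => (c2 k l).pow 2
    exact integrable_sphere hN (((continuous_const.sub (continuous_const.mul hw)).mul c1).sub
      (((continuous_const.add hw).mul (hF.add (hF.comp hrθ))).mul c3))
  · exact integrable_sphere hN ((hf.comp (continuous_id.prodMk hrθ)).add
      (hf.comp (hrθ.prodMk continuous_id)))
  · have e1 := weight_mul_gradient_ge (p := p) (q := linSubst g p) hij v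
    rw [hK, polyFun_rotD_linSubst hij θ hgr] at e1
    have e2 := jeffreys_le (hp v) (hp (rotate i j hij θ v))
    have e3 := jeffreys_nonneg (hp v) (hp (rotate i j hij θ v))
    have e4 : 0 < polyFun p v + polyFun p (rotate i j hij θ v) := add_pos (hp _) (hp _)
    simp only [pairBound, pairEnergy_rotate]
    generalize ∑ k, ∑ l, (polyFun (rotD k l p) v / polyFun p v
        - polyFun (rotD k l (linSubst g p)) v / polyFun p (rotate i j hij θ v)) ^ 2 = S at *
    generalize polyFun (rotD i j p) v / polyFun p v = d at *
    generalize polyFun (rotD i j p) (rotate i j hij θ v) / polyFun p (rotate i j hij θ v) = d' at *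
    generalize jeffreys (polyFun p v) (polyFun p (rotate i j hij θ v)) = J at *
    generalize Real.log (polyFun p v) = h at *
    generalize Real.log (polyFun p (rotate i j hij θ v)) = h' at *
    generalize polyFun p v = a at *
    generalize polyFun p (rotate i j hij θ v) = b at *
    generalize pairEnergy i j v = w at *
    have e5 : (8 * N - 4 * N * w) * J
        ≤ 2 * N * max (4 - 2 * w) 0 * ((a + b) / 2 * (h - h') ^ 2) := by
      have m1 : (8 * N - 4 * N * w) ≤ 2 * N * max (4 - 2 * w) 0 := by
        nlinarith [le_max_left (4 - 2 * w) 0]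
      have m2 : 0 ≤ 2 * N * max (4 - 2 * w) 0 := by positivity
      exact (mul_le_mul_of_nonneg_right m1 e3).trans (mul_le_mul_of_nonneg_left e2 m2)
    have e6 := mul_le_mul_of_nonneg_left e1 e4.le
    linear_combination e5 + e6

/-- Averaged over the angle, the gradient term is `|d|² + ⨍ |d|²` with `d` the derivative of
`log F` in the plane of the pair, and the Poincaré-type inequality on the circle lets `⨍ |d|²`
absorb the term in `log F`. -/
theorem integral_pairBound_le {p : MvPolynomial (Fin N) ℝ} (hp : ∀ v, 0 < polyFun p v)
    {i j : Fin N} (hij : i ≠ j) (v : KacSphere N) :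
    ∫ θ, pairBound p i j v (rotate i j hij θ v) ∂angleMeasure
      ≤ -(2 * N * (polyFun (rotD i j p) v ^ 2 / polyFun p v)) := by
  have hh := continuous_log_polyFun hp
  have hd := continuous_rotD_div hp i j
  have hrv : Continuous fun θ => rotate i j hij θ v :=
    (continuous_rotate hij).comp (Continuous.prodMk_right v)
  have hl := hasRotDeriv_log_polyFun hp hij
  have e4 : polyFun (rotD i j p) v ^ 2 / polyFun p v
      = polyFun p v * (polyFun (rotD i j p) v / polyFun p v) ^ 2 := by
    have := (hp v).ne'
    field_simp
  have hF0 := (hp v).le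
  have hN0 : (0 : ℝ) ≤ N := Nat.cast_nonneg N
  rw [e4]
  simp only [pairBound]
  set h : KacSphere N → ℝ := fun v => Real.log (polyFun p v) with hhdef
  set d : KacSphere N → ℝ := fun v => polyFun (rotD i j p) v / polyFun p v with hddef
  change ∫ θ, polyFun p v * (N * max (4 - 2 * pairEnergy i j v) 0 * (h v - h (rotate i j hij θ v)) ^ 2
    - 2 * N * max 1 (10 - 5 * pairEnergy i j v) * (d v - d (rotate i j hij θ v)) ^ 2) ∂angleMeasure
    ≤ -(2 * N * (polyFun p v * d v ^ 2))
  clear_value h d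
  generalize polyFun p v = a at *
  generalize pairEnergy i j v = w at *
  set A := ∫ θ, d (rotate i j hij θ v) ^ 2 ∂angleMeasure with hA
  have hA0 : 0 ≤ A := integral_nonneg fun θ => sq_nonneg _
  have i1 : Integrable (fun θ => (h v - h (rotate i j hij θ v)) ^ 2) angleMeasure :=
    integrable_angle ((continuous_const.sub (hh.comp hrv)).pow 2)
  have i2 : Integrable (fun θ => (d v - d (rotate i j hij θ v)) ^ 2) angleMeasure :=
    integrable_angle ((continuous_const.sub (hd.comp hrv)).pow 2)
  have e1 : ∫ θ, (h v - h (rotate i j hij θ v)) ^ 2 ∂angleMeasure ≤ Real.pi ^ 2 / 2 * A := by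
    have := integral_sq_sub_le (hl v) (hd.comp hrv)
    simpa only [rotate_zero] using this
  have e2 : ∫ θ, (d v - d (rotate i j hij θ v)) ^ 2 ∂angleMeasure = d v ^ 2 + A := by
    have h0 := hl.average_eq_zero hd v
    have : ∀ θ, (d v - d (rotate i j hij θ v)) ^ 2
        = d v ^ 2 - 2 * d v * d (rotate i j hij θ v) + d (rotate i j hij θ v) ^ 2 :=
      fun θ => by ring
    simp only [this]
    rw [integral_add, integral_sub, integral_const_mul, h0]
    · simp [hA]
    · exact integrable_const _
    · exact integrable_angle (continuous_const.mul (hd.comp hrv))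
    · exact integrable_angle (continuous_const.sub (continuous_const.mul (hd.comp hrv)))
    · exact integrable_angle ((hd.comp hrv).pow 2)
  rw [integral_const_mul, integral_sub (i1.const_mul _) (i2.const_mul _), integral_const_mul,
    integral_const_mul, e2]
  generalize ∫ θ, (h v - h (rotate i j hij θ v)) ^ 2 ∂angleMeasure = I at *
  have m0 : 0 ≤ N * max (4 - 2 * w) 0 := by positivity
  have m1 := mul_le_mul_of_nonneg_left e1 m0
  have hpi : Real.pi ^ 2 ≤ 10 := by nlinarith [Real.pi_lt_d2, Real.pi_pos]
  have m2 : max (4 - 2 * w) 0 * (Real.pi ^ 2 / 2) ≤ 2 * max 1 (10 - 5 * w) := by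
    have : max (4 - 2 * w) 0 * (Real.pi ^ 2 / 2) ≤ max (4 - 2 * w) 0 * 5 :=
      mul_le_mul_of_nonneg_left (by linarith) (le_max_right _ _)
    rcases max_choice (4 - 2 * w) 0 with h1 | h1 <;> rw [h1] at this ⊢ <;>
      linarith [le_max_left 1 (10 - 5 * w), le_max_right 1 (10 - 5 * w)]
  have m3 := mul_le_mul_of_nonneg_right m2 (mul_nonneg hN0 hA0)
  have m4 : (N : ℝ) * d v ^ 2 ≤ max 1 (10 - 5 * w) * (N * d v ^ 2) :=
    le_mul_of_one_le_left (by positivity) (le_max_left _ _)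
  have m5 : N * max (4 - 2 * w) 0 * I - 2 * N * max 1 (10 - 5 * w) * (d v ^ 2 + A)
      ≤ -(2 * N * d v ^ 2) := by
    linear_combination m1 + m3 + 2 * m4
  calc _ ≤ a * -(2 * N * d v ^ 2) := mul_le_mul_of_nonneg_left m5 hF0
    _ = _ := by ring

/-- Along the heat flow, the entropy production of one pair of particles is dissipated at least at
the rate of the Fisher information in the plane of that pair. -/
theorem pair_dissipation (hN : 2 ≤ N) {p : MvPolynomial (Fin N) ℝ} (hp : ∀ v, 0 < polyFun p v)
    {i j : Fin N} (hij : i ≠ j) :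
    ∫ v, ∫ θ, pairDeriv p hij v θ ∂angleMeasure ∂(uniformMeasure N)
      ≤ -(4 * N * ∫ v, polyFun (rotD i j p) v ^ 2 / polyFun p v ∂(uniformMeasure N)) := by
  have hprob := isProbabilityMeasure_uniformMeasure hN
  have hr := continuous_rotate (N := N) hij
  have hf := continuous_pairBound hp i j
  have hint0 := integrable_sphere_angle hN (continuous_pairDeriv hp hij)
  have hint1 := integrable_sphere_angle hN
    (f := fun x => pairBound p i j x.1 (rotate i j hij x.2 x.1)) (hf.comp (continuous_fst.prodMk hr))
  have hint2 := integrable_sphere_angle hN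
    (f := fun x => pairBound p i j (rotate i j hij x.2 x.1) x.1) (hf.comp (hr.prodMk continuous_fst))
  calc _ = ∫ θ, ∫ v, pairDeriv p hij v θ ∂(uniformMeasure N) ∂angleMeasure :=
        integral_integral_swap hint0
    _ ≤ ∫ θ, ∫ v, (pairBound p i j v (rotate i j hij θ v) + pairBound p i j (rotate i j hij θ v) v)
          ∂(uniformMeasure N) ∂angleMeasure :=
        integral_mono hint0.integral_prod_right
          (hint1.add hint2).integral_prod_right (integral_pairDeriv_le hN hp hij)
    _ = ∫ v, ∫ θ, (pairBound p i j v (rotate i j hij θ v) + pairBound p i j (rotate i j hij θ v) v)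
          ∂angleMeasure ∂(uniformMeasure N) :=
        (integral_integral_swap (hint1.add hint2)).symm
    _ = 2 * ∫ v, ∫ θ, pairBound p i j v (rotate i j hij θ v) ∂angleMeasure ∂(uniformMeasure N) := by
        rw [integral_integral_add hint1 hint2, integral_rotate_swap hN hij hf, two_mul]
    _ ≤ 2 * ∫ v, -(2 * N * (polyFun (rotD i j p) v ^ 2 / polyFun p v)) ∂(uniformMeasure N) := by
        refine mul_le_mul_of_nonneg_left (integral_mono hint1.integral_prod_left ?_
          (integral_pairBound_le hp hij)) (by simp)
        exact integrable_sphere hN (continuous_const.mul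
          (((continuous_polyFun _).pow 2).div (continuous_polyFun p) fun v => (hp v).ne')).neg
    _ = _ := by
        rw [integral_neg, integral_const_mul]; ring

/-! ### The entropy inequality for polynomials -/

/-- If the time derivative of a family of functions of the velocities and the angle has nonpositive
integral, then the integral decreases. The derivative need only be continuous for
nonnegative times, whence the `max`. -/
theorem integral_le_integral_of_deriv_nonpos (hN : 2 ≤ N) {φ φ' : ℝ → KacSphere N × ℝ → ℝ}
    (hφ : ∀ t, 0 ≤ t → Continuous (φ t))
    (hφ' : Continuous fun y : ℝ × (KacSphere N × ℝ) => φ' (max y.1 0) y.2)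
    (hd : ∀ t, 0 ≤ t → ∀ x, HasDerivAt (fun t => φ t x) (φ' t x) t)
    (hneg : ∀ t, 0 ≤ t → ∫ x, φ' t x ∂((uniformMeasure N).prod angleMeasure) ≤ 0)
    {T : ℝ} (hT : 0 ≤ T) :
    ∫ x, φ T x ∂((uniformMeasure N).prod angleMeasure)
      ≤ ∫ x, φ 0 x ∂((uniformMeasure N).prod angleMeasure) := by
  have := isProbabilityMeasure_uniformMeasure hN
  have hftc : ∀ x, φ T x - φ 0 x = ∫ t in Ioc 0 T, φ' (max t 0) x := by
    intro x
    have hc : Continuous fun t => φ' (max t 0) x := hφ'.comp (Continuous.prodMk_left x)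
    rw [← intervalIntegral.integral_of_le hT]
    refine (intervalIntegral.integral_eq_sub_of_hasDerivAt (f := fun t => φ t x)
      (fun t ht => ?_) (hc.intervalIntegrable _ _)).symm
    rw [uIcc_of_le hT] at ht
    rw [max_eq_left ht.1]
    exact hd t ht.1 x
  have hint : Integrable (fun y : (KacSphere N × ℝ) × ℝ => φ' (max y.2 0) y.1)
      (((uniformMeasure N).prod angleMeasure).prod (volume.restrict (Ioc 0 T))) := by
    have hc : Continuous fun y : (KacSphere N × ℝ) × ℝ => φ' (max y.2 0) y.1 :=
      hφ'.comp (continuous_snd.prodMk continuous_fst)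
    have hK : IsCompact ((univ ×ˢ Icc (-Real.pi) Real.pi) ×ˢ Icc 0 T :
        Set ((KacSphere N × ℝ) × ℝ)) := (isCompact_univ.prod isCompact_Icc).prod isCompact_Icc
    obtain ⟨C, hC⟩ := hK.exists_bound_of_continuousOn hc.continuousOn
    refine Integrable.of_bound hc.aestronglyMeasurable C ?_
    have h1 : ∀ᵐ y ∂(((uniformMeasure N).prod angleMeasure).prod (volume.restrict (Ioc 0 T))),
        y.1.2 ∈ Icc (-Real.pi) Real.pi :=
      Measure.quasiMeasurePreserving_fst.ae
        (Measure.quasiMeasurePreserving_snd.ae ae_angleMeasure_mem)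
    have h2 : ∀ᵐ y ∂(((uniformMeasure N).prod angleMeasure).prod (volume.restrict (Ioc 0 T))),
        y.2 ∈ Ioc 0 T := Measure.quasiMeasurePreserving_snd.ae (ae_restrict_mem measurableSet_Ioc)
    filter_upwards [h1, h2] with y hy1 hy2
    exact hC y ⟨⟨mem_univ _, hy1⟩, Ioc_subset_Icc_self hy2⟩
  rw [← sub_nonpos, ← integral_sub (integrable_sphere_angle hN (hφ T hT))
    (integrable_sphere_angle hN (hφ 0 le_rfl))]
  simp only [hftc]
  rw [integral_integral_swap hint]
  refine setIntegral_nonpos measurableSet_Ioc fun t ht => ?_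
  simp only [max_eq_left ht.1.le]
  exact hneg t ht.1.le

/-- The entropy along the heat flow converges to that of the constant limit. -/
theorem tendsto_integral_mul_log (hN : 2 ≤ N) {P : ℝ → MvPolynomial (Fin N) ℝ} (hP : IsHeatFlow P)
    {c m : ℝ} (h0 : ∀ v, c ≤ polyFun (P 0) v)
    (hlim : ∀ v, Tendsto (fun t => polyFun (P t) v) atTop (𝓝 m)) :
    Tendsto (fun t => ∫ v, polyFun (P t) v * Real.log (polyFun (P t) v) ∂(uniformMeasure N)) atTop
      (𝓝 (m * Real.log m)) := by
  have := isProbabilityMeasure_uniformMeasure hN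
  obtain ⟨M, hM⟩ := (isCompact_univ (X := KacSphere N)).exists_bound_of_continuousOn
    (continuous_polyFun (P 0)).continuousOn
  have h0' : ∀ v, polyFun (P 0) v ≤ M := fun v => (le_abs_self _).trans (hM v (mem_univ v))
  obtain ⟨B, hB⟩ := (isCompact_Icc (a := c) (b := M)).exists_bound_of_continuousOn
    (f := fun x => x * Real.log x) Real.continuous_mul_log.continuousOn
  have hmu : ∫ _, m * Real.log m ∂(uniformMeasure N) = m * Real.log m := by simp
  rw [← hmu]
  refine tendsto_integral_filter_of_dominated_convergence (fun _ => B) ?_ ?_ (integrable_const B) ?_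
  · exact Eventually.of_forall fun t =>
      (Real.continuous_mul_log.comp (continuous_polyFun (P t))).aestronglyMeasurable
  · filter_upwards [eventually_ge_atTop 0] with t ht
    exact Eventually.of_forall fun v => hB _ ⟨hP.le_of_le h0 ht v, hP.ge_of_ge h0' ht v⟩
  · exact Eventually.of_forall fun v => (Real.continuous_mul_log.tendsto m).comp (hlim v)

/-- The integrand of the weighted entropy production of a pair. -/
def pairProduction (F : KacSphere N → ℝ) {i j : Fin N} (hij : i ≠ j) (v : KacSphere N)
    (θ : ℝ) : ℝ :=
  (6 + pairEnergy i j v) * jeffreys (F v) (F (rotate i j hij θ v))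

theorem pairProduction_nonneg {F : KacSphere N → ℝ} (hF : ∀ v, 0 < F v) {i j : Fin N}
    (hij : i ≠ j) (v : KacSphere N) (θ : ℝ) : 0 ≤ pairProduction F hij v θ :=
  mul_nonneg (by linarith [pairEnergy_nonneg i j v]) (jeffreys_nonneg (hF _) (hF _))

theorem continuous_pairProduction {F : KacSphere N → ℝ} (hF : ∀ v, 0 < F v) (hc : Continuous F)
    {i j : Fin N} (hij : i ≠ j) :
    Continuous fun x : KacSphere N × ℝ => pairProduction F hij x.1 x.2 :=
  (continuous_const.add ((continuous_pairEnergy i j).comp continuous_fst)).mul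
    (continuous_jeffreys_comp (hc.comp continuous_fst) (hc.comp (continuous_rotate hij))
      (fun _ => hF _) fun _ => hF _)

theorem IsHeatFlow.hasDerivAt_pairProduction {P : ℝ → MvPolynomial (Fin N) ℝ} (hP : IsHeatFlow P)
    {t : ℝ} (ht : ∀ v, 0 < polyFun (P t) v) {i j : Fin N} (hij : i ≠ j) (v : KacSphere N) (θ : ℝ) :
    HasDerivAt (fun t => pairProduction (polyFun (P t)) hij v θ) (pairDeriv (P t) hij v θ) t :=
  (hasDerivAt_jeffreys (hP.hasDerivAt LinearMap.id v t)
    (hP.hasDerivAt LinearMap.id (rotate i j hij θ v) t) (ht _) (ht _)).const_mul _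

/-- Summed over all pairs, the dissipation of the entropy production dominates that of `N` times the
entropy. -/
theorem integral_sum_pairDeriv_le (hN : 2 ≤ N) {p : MvPolynomial (Fin N) ℝ}
    (hp : ∀ v, 0 < polyFun p v) :
    ∫ x : KacSphere N × ℝ, (∑ e : {e : Fin N × Fin N // e.1 < e.2},
        1 / 2 * pairDeriv p e.2.ne x.1 x.2
      - N * ((1 + Real.log (polyFun p x.1)) * polyFun (casimir p) x.1))
      ∂((uniformMeasure N).prod angleMeasure) ≤ 0 := by
  have := isProbabilityMeasure_uniformMeasure hN
  have hi1 : ∀ e : {e : Fin N × Fin N // e.1 < e.2},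
      Integrable (fun x : KacSphere N × ℝ => 1 / 2 * pairDeriv p e.2.ne x.1 x.2)
      ((uniformMeasure N).prod angleMeasure) := fun e =>
    (integrable_sphere_angle hN (continuous_pairDeriv hp e.2.ne)).const_mul _
  have hc2 : Continuous fun v => N * ((1 + Real.log (polyFun p v)) * polyFun (casimir p) v) :=
    continuous_const.mul ((continuous_const.add (continuous_log_polyFun hp)).mul
      (continuous_polyFun _))
  have hi2 := integrable_sphere_angle hN (hc2.comp continuous_fst)
  have hfst : ∫ x : KacSphere N × ℝ, N * ((1 + Real.log (polyFun p x.1)) * polyFun (casimir p) x.1)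
      ∂((uniformMeasure N).prod angleMeasure)
      = ∫ v, N * ((1 + Real.log (polyFun p v)) * polyFun (casimir p) v) ∂(uniformMeasure N) := by
    rw [integral_fun_fst (fun v => N * ((1 + Real.log (polyFun p v)) * polyFun (casimir p) v))]
    simp
  have hsub := integral_sub (integrable_finsetSum Finset.univ fun e _ => hi1 e) hi2
  simp only [Function.comp_def] at hsub
  rw [hsub, integral_finsetSum _ fun e _ => hi1 e, hfst, integral_const_mul,
    integral_log_mul_casimir hN hp, sum_sum_eq_two_mul_sum_pairs]
  · have h1 : ∀ e : {e : Fin N × Fin N // e.1 < e.2},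
        ∫ x : KacSphere N × ℝ, 1 / 2 * pairDeriv p e.2.ne x.1 x.2
          ∂((uniformMeasure N).prod angleMeasure)
        ≤ -(2 * N * ∫ v, polyFun (rotD e.1.1 e.1.2 p) v ^ 2 / polyFun p v
          ∂(uniformMeasure N)) := by
      intro e
      have h := pair_dissipation hN hp e.2.ne
      rw [integral_const_mul,
        integral_prod _ (integrable_sphere_angle hN (continuous_pairDeriv hp e.2.ne))]
      linarith
    have h2 := Finset.sum_le_sum fun e (_ : e ∈ Finset.univ) => h1 e
    rw [Finset.sum_neg_distrib, ← Finset.mul_sum] at h2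
    linarith
  · intro k; simp [rotD_self]
  · intro k l
    simp [rotD_swap k l]

/-- The entropy of a positive polynomial is controlled by its weighted entropy production: the
difference of the two sides decreases along the heat flow, and tends to a nonnegative limit. -/
theorem entropy_le_pairProduction_polyFun (hN : 2 ≤ N) {p : MvPolynomial (Fin N) ℝ} {c : ℝ}
    (hc : 0 < c) (hp : ∀ v, c ≤ polyFun p v) :
    N * (∫ v, polyFun p v * Real.log (polyFun p v) ∂(uniformMeasure N)
        - (∫ v, polyFun p v ∂(uniformMeasure N)) * Real.log (∫ v, polyFun p v ∂(uniformMeasure N)))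
      ≤ ∑ e : {e : Fin N × Fin N // e.1 < e.2}, 1 / 2 *
        ∫ v, ∫ θ, pairProduction (polyFun p) e.2.ne v θ ∂angleMeasure ∂(uniformMeasure N) := by
  have := isProbabilityMeasure_uniformMeasure hN
  obtain ⟨P, hP, hP0, hlim⟩ := exists_isHeatFlow hN p
  have h0 : ∀ v, c ≤ polyFun (P 0) v := fun v => by rw [hP0]; exact hp v
  have hpos : ∀ t, 0 ≤ t → ∀ v, 0 < polyFun (P t) v := fun t ht v =>
    hc.trans_le (hP.le_of_le h0 ht v)
  have hcl : ∀ t, Continuous fun x : KacSphere N × ℝ =>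
      N * (polyFun (P t) x.1 * Real.log (polyFun (P t) x.1)) := fun t =>
    continuous_const.mul (Real.continuous_mul_log.comp
      ((continuous_polyFun (P t)).comp continuous_fst))
  have hcp : ∀ t, 0 ≤ t → ∀ e : {e : Fin N × Fin N // e.1 < e.2},
      Continuous fun x : KacSphere N × ℝ => 1 / 2 *
        pairProduction (polyFun (P t)) e.2.ne x.1 x.2 := fun t ht e =>
    continuous_const.mul (continuous_pairProduction (hpos t ht) (continuous_polyFun _) e.2.ne)
  -- the difference of the two sides decreases along the flow
  have hmono := fun T (hT : 0 ≤ T) => integral_le_integral_of_deriv_nonpos hN (T := T)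
    (φ := fun t x => ∑ e : {e : Fin N × Fin N // e.1 < e.2},
        1 / 2 * pairProduction (polyFun (P t)) e.2.ne x.1 x.2
      - N * (polyFun (P t) x.1 * Real.log (polyFun (P t) x.1)))
    (φ' := fun t x => ∑ e : {e : Fin N × Fin N // e.1 < e.2},
        1 / 2 * pairDeriv (P t) e.2.ne x.1 x.2
      - N * ((1 + Real.log (polyFun (P t) x.1)) * polyFun (casimir (P t)) x.1))
    (fun t ht => (continuous_finsetSum _ fun e _ => hcp t ht e).sub (hcl t))
    (by
      have hx : Continuous fun y : ℝ × (KacSphere N × ℝ) => (max y.1 0, y.2.1) :=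
        (continuous_fst.max continuous_const).prodMk (continuous_fst.comp continuous_snd)
      have hy : ∀ e : {e : Fin N × Fin N // e.1 < e.2},
          Continuous fun y : ℝ × (KacSphere N × ℝ) =>
            (max y.1 0, rotate e.1.1 e.1.2 e.2.ne y.2.2 y.2.1) := fun e =>
        (continuous_fst.max continuous_const).prodMk
          ((continuous_rotate e.2.ne).comp continuous_snd)
      have k1 := (hP.continuous LinearMap.id).comp hx
      have k2 := fun e => (hP.continuous LinearMap.id).comp (hy e)
      have k3 := (hP.continuous casimir).comp hx
      have k4 := fun e => (hP.continuous casimir).comp (hy e)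
      simp only [LinearMap.id_apply, Function.comp_def] at k1 k2 k3 k4
      have hq : ∀ (y : ℝ × (KacSphere N × ℝ)) v, 0 < polyFun (P (max y.1 0)) v := fun y v =>
        hpos _ (le_max_right _ _) v
      refine (continuous_finsetSum _ fun e _ => continuous_const.mul ?_).sub
        (continuous_const.mul ((continuous_const.add (k1.log fun y => (hq y _).ne')).mul k3))
      exact (continuous_const.add ((continuous_pairEnergy _ _).comp
        (continuous_fst.comp continuous_snd))).mul
        (((continuous_jeffreysDeriv_comp k1 (k2 e) (fun y => hq y _) fun y => hq y _).mul k3).add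
        ((continuous_jeffreysDeriv_comp (k2 e) k1 (fun y => hq y _) fun y => hq y _).mul (k4 e))))
    (fun t ht x => by
      refine (HasDerivAt.fun_sum fun e _ =>
        (hP.hasDerivAt_pairProduction (hpos t ht) e.2.ne x.1 x.2).const_mul _).fun_sub
        (HasDerivAt.const_mul _ ?_)
      have hF : HasDerivAt (fun t => polyFun (P t) x.1) (polyFun (casimir (P t)) x.1) t :=
        hP.hasDerivAt LinearMap.id x.1 t
      have hne : polyFun (P t) x.1 ≠ 0 := (hpos t ht x.1).ne'
      refine (hF.fun_mul (hF.log hne)).congr_deriv ?_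
      field_simp
      ring)
    (fun t ht => integral_sum_pairDeriv_le hN (hpos t ht)) hT
  have heval : ∀ t, 0 ≤ t → ∫ x : KacSphere N × ℝ, (∑ e : {e : Fin N × Fin N // e.1 < e.2},
        1 / 2 * pairProduction (polyFun (P t)) e.2.ne x.1 x.2
      - N * (polyFun (P t) x.1 * Real.log (polyFun (P t) x.1)))
        ∂((uniformMeasure N).prod angleMeasure)
      = (∑ e : {e : Fin N × Fin N // e.1 < e.2}, 1 / 2 * ∫ v, ∫ θ,
          pairProduction (polyFun (P t)) e.2.ne v θ ∂angleMeasure ∂(uniformMeasure N))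
        - N * ∫ v, polyFun (P t) v * Real.log (polyFun (P t) v) ∂(uniformMeasure N) := by
    intro t ht
    have hi := fun e => integrable_sphere_angle hN (hcp t ht e)
    rw [integral_sub (integrable_finsetSum Finset.univ fun e _ => hi e)
      (integrable_sphere_angle hN (hcl t)), integral_finsetSum _ fun e _ => hi e,
      integral_const_mul,
      integral_fun_fst (fun v => polyFun (P t) v * Real.log (polyFun (P t) v))]
    congr 1
    · refine Finset.sum_congr rfl fun e _ => ?_
      rw [integral_const_mul, integral_prod _ (integrable_sphere_angle hN
        (continuous_pairProduction (hpos t ht) (continuous_polyFun _) e.2.ne))]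
    · simp
  have hbound : ∀ T, 0 ≤ T →
      -(N * ∫ v, polyFun (P T) v * Real.log (polyFun (P T) v) ∂(uniformMeasure N))
      ≤ (∑ e : {e : Fin N × Fin N // e.1 < e.2}, 1 / 2 * ∫ v, ∫ θ,
          pairProduction (polyFun p) e.2.ne v θ ∂angleMeasure ∂(uniformMeasure N))
        - N * ∫ v, polyFun p v * Real.log (polyFun p v) ∂(uniformMeasure N) := by
    intro T hT
    have h1 := hmono T hT
    rw [heval T hT, heval 0 le_rfl, hP0] at h1
    have h2 : 0 ≤ ∑ e : {e : Fin N × Fin N // e.1 < e.2}, 1 / 2 * ∫ v, ∫ θ,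
          pairProduction (polyFun (P T)) e.2.ne v θ ∂angleMeasure ∂(uniformMeasure N) :=
      Finset.sum_nonneg fun e _ => mul_nonneg (by norm_num) (integral_nonneg fun v =>
        integral_nonneg fun θ => pairProduction_nonneg (hpos T hT) e.2.ne v θ)
    linarith
  have hlim' := ((tendsto_integral_mul_log hN hP h0 hlim).const_mul (N : ℝ)).neg
  have := le_of_tendsto hlim' ((eventually_ge_atTop 0).mono hbound)
  linarith

end

/-! ### Collisions as measure-preserving maps of velocities and angle -/

theorem measurePreserving_neg_angle :
    MeasurePreserving (fun θ : ℝ => -θ) angleMeasure angleMeasure := by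
  have h := (Measure.measurePreserving_neg (volume : Measure ℝ)).restrict_preimage
    (measurableSet_Ico (a := -Real.pi) (b := Real.pi))
  have hpre : (fun θ : ℝ => -θ) ⁻¹' Ico (-Real.pi) Real.pi = Ioc (-Real.pi) Real.pi := by
    ext θ
    simp only [mem_preimage, mem_Ico, mem_Ioc]
    constructor <;> rintro ⟨h1, h2⟩ <;> constructor <;> linarith
  have hpre' : (Neg.neg : ℝ → ℝ) ⁻¹' Ico (-Real.pi) Real.pi = Ioc (-Real.pi) Real.pi := hpre
  rw [hpre', Measure.restrict_congr_set (Ico_ae_eq_Ioc (μ := (volume : Measure ℝ)))] at h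
  exact h.smul_measure _

/-- The collision of `i` and `j` with angle `θ`, together with the angle `-θ` of the inverse
collision, preserves the product measure. -/
theorem measurePreserving_collision (hN : 2 ≤ N) {i j : Fin N} (hij : i ≠ j) :
    MeasurePreserving (fun x : KacSphere N × ℝ => (rotate i j hij x.2 x.1, -x.2))
      ((uniformMeasure N).prod angleMeasure) ((uniformMeasure N).prod angleMeasure) := by
  have := isProbabilityMeasure_uniformMeasure hN
  have h := measurePreserving_neg_angle.skew_product (μc := uniformMeasure N)
    (μd := uniformMeasure N) (g := fun θ v => rotate i j hij θ v)
    ((continuous_rotate hij).comp continuous_swap).measurable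
    (Eventually.of_forall fun θ => (measurePreserving_rotate hij θ).map_eq)
  exact (Measure.measurePreserving_swap.comp h).comp Measure.measurePreserving_swap

theorem measurePreserving_rotate_prod (hN : 2 ≤ N) {i j : Fin N} (hij : i ≠ j) :
    MeasurePreserving (fun x : KacSphere N × ℝ => rotate i j hij x.2 x.1)
      ((uniformMeasure N).prod angleMeasure) (uniformMeasure N) := by
  have := isProbabilityMeasure_uniformMeasure hN
  exact measurePreserving_fst.comp (measurePreserving_collision hN hij)

/-! ### Approximation of densities by polynomials -/

/-- Polynomials are uniformly dense in the continuous functions on the Kac sphere. -/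
theorem exists_polyFun_near {f : KacSphere N → ℝ} (hf : Continuous f) {ε : ℝ} (hε : 0 < ε) :
    ∃ p : MvPolynomial (Fin N) ℝ, ∀ v, |polyFun p v - f v| < ε := by
  let φ : MvPolynomial (Fin N) ℝ →ₐ[ℝ] C(KacSphere N, ℝ) :=
    aeval fun k => ⟨fun v => (v : Velocities N) k, continuous_coord k⟩
  have hφ : ∀ p v, φ p v = polyFun p v := by
    intro p v
    induction p using MvPolynomial.induction_on with
    | C a => simp [φ]
    | add p q hp hq => simp [hp, hq]
    | mul_X p n hp =>
      rw [map_mul, ContinuousMap.mul_apply, hp, polyFun_mul, polyFun_X]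
      simp [φ]
  have hsep : φ.range.SeparatesPoints := by
    intro x y hxy
    obtain ⟨k, hk⟩ : ∃ k, (x : Velocities N) k ≠ (y : Velocities N) k := by
      by_contra! h
      exact hxy (Subtype.ext (PiLp.ext h))
    exact ⟨_, ⟨φ (X k), ⟨X k, rfl⟩, rfl⟩, by simpa only [hφ, polyFun_X] using hk⟩
  obtain ⟨⟨g, p, rfl⟩, hg⟩ :=
    ContinuousMap.exists_mem_subalgebra_near_continuous_of_separatesPoints φ.range hsep f hf ε hε
  exact ⟨p, fun v => by rw [← hφ]; exact hg v⟩

/-- A function with values in `[c, K]` is the limit, almost everywhere, of polynomials with values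
in `[c/2, K+1]`. -/
theorem exists_seq_polyFun (hN : 2 ≤ N) {F : KacSphere N → ℝ} (hF : Measurable F) {c K : ℝ}
    (hc : 0 < c) (hcF : ∀ v, c ≤ F v) (hFK : ∀ v, F v ≤ K) :
    ∃ p : ℕ → MvPolynomial (Fin N) ℝ, (∀ n v, polyFun (p n) v ∈ Icc (c / 2) (K + 1)) ∧
      ∀ᵐ v ∂(uniformMeasure N), Tendsto (fun n => polyFun (p n) v) atTop (𝓝 (F v)) := by
  have := isProbabilityMeasure_uniformMeasure hN
  have hFi : Integrable F (uniformMeasure N) := by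
    refine Integrable.of_bound hF.aestronglyMeasurable K (Eventually.of_forall fun v => ?_)
    rw [Real.norm_eq_abs, abs_of_pos (hc.trans_le (hcF v))]
    exact hFK v
  have key : ∀ n : ℕ, ∃ p : MvPolynomial (Fin N) ℝ, (∀ v, polyFun p v ∈ Icc (c / 2) (K + 1)) ∧
      ∫ v, ‖polyFun p v - F v‖ ∂(uniformMeasure N) ≤ 2 * (1 / ((n : ℝ) + 1)) := by
    intro n
    have hε : (0 : ℝ) < 1 / ((n : ℝ) + 1) := by positivity
    obtain ⟨g, hg, hgi⟩ := hFi.exists_boundedContinuous_integral_sub_le hε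
    have hcl : Continuous fun v => max c (min (g v) K) :=
      continuous_const.max (g.continuous.min continuous_const)
    obtain ⟨p, hp⟩ := exists_polyFun_near hcl (lt_min hε (lt_min (half_pos hc) one_pos))
    have hcK : ∀ v : KacSphere N, c ≤ K := fun v => (hcF v).trans (hFK v)
    refine ⟨p, fun v => ?_, ?_⟩
    · have h1 := abs_lt.1 ((hp v).trans_le ((min_le_right _ _).trans (min_le_left _ _)))
      have h2 := abs_lt.1 ((hp v).trans_le ((min_le_right _ _).trans (min_le_right _ _)))
      have h3 : c ≤ max c (min (g v) K) := le_max_left _ _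
      have h4 : max c (min (g v) K) ≤ K := max_le (hcK v) (min_le_right _ _)
      constructor <;> linarith [h1.1, h2.2]
    · have hpt : ∀ v, ‖polyFun p v - F v‖ ≤ 1 / ((n : ℝ) + 1) + ‖F v - g v‖ := by
        intro v
        have h1 := (hp v).trans_le (min_le_left _ _)
        -- truncation to `[c, K]` only brings `g` closer to `F`
        have h2 : |max c (min (g v) K) - F v| ≤ |F v - g v| := by
          have := hcF v
          have := hFK v
          rw [abs_sub_comm (F v)]
          rcases max_cases c (min (g v) K) with h | h <;>
            rcases min_cases (g v) K with h' | h' <;>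
            exact abs_le.2 ⟨by linarith [neg_abs_le (g v - F v), abs_nonneg (g v - F v)],
              by linarith [le_abs_self (g v - F v), abs_nonneg (g v - F v)]⟩
        have h3 := abs_sub_le (polyFun p v) (max c (min (g v) K)) (F v)
        rw [Real.norm_eq_abs, Real.norm_eq_abs]
        linarith
      have hi := (hFi.sub hgi).norm
      have := integral_mono (((integrable_sphere hN (continuous_polyFun p)).sub hFi).norm)
        ((integrable_const (1 / ((n : ℝ) + 1))).add hi) hpt
      refine this.trans ?_
      refine (integral_add (integrable_const _) hi).le.trans ?_
      simp only [integral_const, probReal_univ, one_smul, Pi.sub_apply]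
      linarith
  choose p hp1 hp2 using key
  have hlim : Tendsto (fun n => eLpNorm (polyFun (p n) - F) 1 (uniformMeasure N)) atTop (𝓝 0) := by
    have h0 : Tendsto (fun n : ℕ => ENNReal.ofReal (2 * (1 / ((n : ℝ) + 1)))) atTop (𝓝 0) := by
      have := (tendsto_one_div_add_atTop_nhds_zero_nat (𝕜 := ℝ)).const_mul 2
      rw [mul_zero] at this
      simpa using ENNReal.tendsto_ofReal this
    refine tendsto_of_tendsto_of_tendsto_of_le_of_le tendsto_const_nhds h0
      (fun n => zero_le) fun n => ?_
    have hi := (integrable_sphere hN (continuous_polyFun (p n))).sub hFi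
    rw [eLpNorm_one_eq_lintegral_enorm, ← ofReal_integral_norm_eq_lintegral_enorm hi]
    exact ENNReal.ofReal_le_ofReal (hp2 n)
  obtain ⟨ns, -, hns⟩ := (tendstoInMeasure_of_tendsto_eLpNorm one_ne_zero
    (fun n => (continuous_polyFun (p n)).aestronglyMeasurable) hF.aestronglyMeasurable
    hlim).exists_seq_tendsto_ae
  exact ⟨fun n => p (ns n), fun n v => hp1 _ v, hns⟩

theorem measurable_jeffreys {X : Type*} [MeasurableSpace X] {f g : X → ℝ} (hf : Measurable f)
    (hg : Measurable g) : Measurable fun x => jeffreys (f x) (g x) :=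
  (hf.sub hg).mul (hf.log.sub hg.log)

theorem jeffreys_le_of_mem {a b c K : ℝ} (hc : 0 < c) (ha : a ∈ Icc c K) (hb : b ∈ Icc c K) :
    |jeffreys a b| ≤ K * (Real.log K - Real.log c) := by
  have ha0 := hc.trans_le ha.1
  have hb0 := hc.trans_le hb.1
  have h1 : |a - b| ≤ K := abs_le.2 ⟨by linarith [ha.2, hb.2], by linarith [ha.2, hb.2]⟩
  have h2 : |Real.log a - Real.log b| ≤ Real.log K - Real.log c := by
    have := Real.log_le_log hc ha.1
    have := Real.log_le_log hc hb.1
    have := Real.log_le_log ha0 ha.2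
    have := Real.log_le_log hb0 hb.2
    exact abs_le.2 ⟨by linarith, by linarith⟩
  rw [jeffreys, abs_mul]
  exact mul_le_mul h1 h2 (abs_nonneg _) ((abs_nonneg _).trans h1)

theorem pairEnergy_le {i j : Fin N} (hij : i ≠ j) (v : KacSphere N) : pairEnergy i j v ≤ N := by
  have h := Finset.add_le_sum (s := Finset.univ) (f := fun k => (v : Velocities N) k ^ 2)
    (fun k _ => sq_nonneg _) (Finset.mem_univ i) (Finset.mem_univ j) hij
  rw [sum_sq_eq] at h
  exact h

/-- The entropy of a bounded positive function is controlled by its weighted entropy production,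
by approximation from the case of polynomials. -/
theorem entropy_le_pairProduction (hN : 2 ≤ N) {F : KacSphere N → ℝ} (hF : Measurable F) {c K : ℝ}
    (hc : 0 < c) (hcF : ∀ v, c ≤ F v) (hFK : ∀ v, F v ≤ K) :
    N * (∫ v, F v * Real.log (F v) ∂(uniformMeasure N)
        - (∫ v, F v ∂(uniformMeasure N)) * Real.log (∫ v, F v ∂(uniformMeasure N)))
      ≤ ∑ e : {e : Fin N × Fin N // e.1 < e.2}, 1 / 2 *
        ∫ x, pairProduction F e.2.ne x.1 x.2 ∂((uniformMeasure N).prod angleMeasure) := by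
  have := isProbabilityMeasure_uniformMeasure hN
  obtain ⟨p, hp, hlim⟩ := exists_seq_polyFun hN hF hc hcF hFK
  have hc2 := half_pos hc
  have hppos : ∀ n v, 0 < polyFun (p n) v := fun n v => hc2.trans_le (hp n v).1
  have hFpos : ∀ v, 0 < F v := fun v => hc.trans_le (hcF v)
  have h1 : Tendsto (fun n => ∫ v, polyFun (p n) v ∂(uniformMeasure N)) atTop
      (𝓝 (∫ v, F v ∂(uniformMeasure N))) := by
    refine tendsto_integral_of_dominated_convergence (fun _ => K + 1)
      (fun n => (continuous_polyFun _).aestronglyMeasurable) (integrable_const _)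
      (fun n => Eventually.of_forall fun v => ?_) hlim
    rw [Real.norm_eq_abs, abs_of_pos (hppos n v)]
    exact (hp n v).2
  have h2 : Tendsto (fun n => ∫ v, polyFun (p n) v * Real.log (polyFun (p n) v)
      ∂(uniformMeasure N)) atTop (𝓝 (∫ v, F v * Real.log (F v) ∂(uniformMeasure N))) := by
    obtain ⟨B, hB⟩ := (isCompact_Icc (a := c / 2) (b := K + 1)).exists_bound_of_continuousOn
      (f := fun x => x * Real.log x) Real.continuous_mul_log.continuousOn
    refine tendsto_integral_of_dominated_convergence (fun _ => B)
      (fun n => (Real.continuous_mul_log.comp (continuous_polyFun _)).aestronglyMeasurable)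
      (integrable_const _) (fun n => Eventually.of_forall fun v => hB _ (hp n v)) ?_
    filter_upwards [hlim] with v hv using (Real.continuous_mul_log.tendsto _).comp hv
  have h3 : ∀ e : {e : Fin N × Fin N // e.1 < e.2}, Tendsto (fun n =>
      ∫ x, pairProduction (polyFun (p n)) e.2.ne x.1 x.2 ∂((uniformMeasure N).prod angleMeasure))
      atTop (𝓝 (∫ x, pairProduction F e.2.ne x.1 x.2
        ∂((uniformMeasure N).prod angleMeasure))) := by
    intro e
    refine tendsto_integral_of_dominated_convergence
      (fun _ => (6 + N) * ((K + 1) * (Real.log (K + 1) - Real.log (c / 2))))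
      (fun n => (continuous_pairProduction (hppos n) (continuous_polyFun _)
        e.2.ne).aestronglyMeasurable) (integrable_const _)
      (fun n => Eventually.of_forall fun x => ?_) ?_
    · have hw := pairEnergy_nonneg e.1.1 e.1.2 x.1
      have hw' := pairEnergy_le e.2.ne x.1
      rw [pairProduction, Real.norm_eq_abs, abs_mul, abs_of_nonneg (by linarith)]
      exact mul_le_mul (by linarith) (jeffreys_le_of_mem hc2 (hp n _) (hp n _)) (abs_nonneg _)
        (by positivity)
    · have ha := Measure.quasiMeasurePreserving_fst (μ := uniformMeasure N)
        (ν := angleMeasure) |>.ae hlim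
      have hb := (measurePreserving_rotate_prod hN e.2.ne).quasiMeasurePreserving.ae hlim
      filter_upwards [ha, hb] with x hx hy
      exact ((hx.sub hy).mul ((hx.log (hFpos _).ne').sub (hy.log (hFpos _).ne'))).const_mul _
  have hm : 0 < ∫ v, F v ∂(uniformMeasure N) := by
    have hi : Integrable F (uniformMeasure N) := by
      refine Integrable.of_bound hF.aestronglyMeasurable K (Eventually.of_forall fun v => ?_)
      rw [Real.norm_eq_abs, abs_of_pos (hFpos v)]
      exact hFK v
    refine hc.trans_le ?_
    have := integral_mono (integrable_const c) hi hcF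
    simpa using this
  refine le_of_tendsto_of_tendsto' ((h2.sub (h1.mul (h1.log hm.ne'))).const_mul (N : ℝ))
    (tendsto_finsetSum Finset.univ fun e _ => (h3 e).const_mul (1 / 2)) fun n => ?_
  refine (entropy_le_pairProduction_polyFun hN hc2 fun v => (hp n v).1).trans_eq ?_
  refine Finset.sum_congr rfl fun e _ => ?_
  rw [integral_prod _ (integrable_sphere_angle hN
    (continuous_pairProduction (hppos n) (continuous_polyFun _) e.2.ne))]

/-! ### The entropy production of the Kac walk -/

theorem nonempty_kacSphere (hN : 2 ≤ N) : Nonempty (KacSphere N) := by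
  have := isProbabilityMeasure_uniformMeasure hN
  by_contra h
  rw [not_nonempty_iff] at h
  have := measure_univ (μ := uniformMeasure N)
  rw [univ_eq_empty_iff.2 h, measure_empty] at this
  exact zero_ne_one this

theorem one_le_one_add_pairEnergy (i j : Fin N) (v : KacSphere N) : 1 ≤ 1 + pairEnergy i j v := by
  linarith [pairEnergy_nonneg i j v]

theorem measurable_comp_rotate {i j : Fin N} (hij : i ≠ j) {F : KacSphere N → ℝ}
    (hF : Measurable F) : Measurable fun x : KacSphere N × ℝ => F (rotate i j hij x.2 x.1) :=
  hF.comp (continuous_rotate hij).measurable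

theorem measurable_rate (γ : ℝ) (i j : Fin N) :
    Measurable fun v : KacSphere N => (1 + pairEnergy i j v) ^ γ :=
  ((continuous_pairEnergy i j).measurable.const_add 1).pow_const γ

theorem rate_le {γ : ℝ} (hγ : γ ≤ 1) {i j : Fin N} (hij : i ≠ j) (v : KacSphere N) :
    (1 + pairEnergy i j v) ^ γ ≤ 1 + N := by
  refine (Real.rpow_le_rpow_of_exponent_le (one_le_one_add_pairEnergy i j v) hγ).trans ?_
  rw [Real.rpow_one]
  linarith [pairEnergy_le hij v]

theorem rate_nonneg (γ : ℝ) (i j : Fin N) (v : KacSphere N) : 0 ≤ (1 + pairEnergy i j v) ^ γ :=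
  Real.rpow_nonneg (by linarith [pairEnergy_nonneg i j v]) γ

/-- The generator in terms of the normalised measure on the angles. -/
theorem generator_eq (γ : ℝ) (F : KacSphere N → ℝ) (v : KacSphere N) :
    generator γ F v = -((N : ℝ) / (N.choose 2 : ℝ)) * ∑ e : {e : Fin N × Fin N // e.1 < e.2},
      (1 + pairEnergy e.1.1 e.1.2 v) ^ γ *
        ∫ θ, (F v - F (rotate e.1.1 e.1.2 e.2.ne θ v)) ∂angleMeasure := by
  simp only [generator, integral_angleMeasure, pairEnergy, add_assoc]

theorem measurable_generator (γ : ℝ) {F : KacSphere N → ℝ} (hF : Measurable F) :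
    Measurable (generator γ F) := by
  have h : generator γ F = fun v => -((N : ℝ) / (N.choose 2 : ℝ)) *
      ∑ e : {e : Fin N × Fin N // e.1 < e.2}, (1 + pairEnergy e.1.1 e.1.2 v) ^ γ *
        ∫ θ, (F v - F (rotate e.1.1 e.1.2 e.2.ne θ v)) ∂angleMeasure :=
    funext (generator_eq γ F)
  rw [h]
  refine (Finset.measurable_fun_sum _ fun e _ => (measurable_rate γ _ _).mul ?_).const_mul _
  exact ((hF.comp measurable_fst).sub
    (measurable_comp_rotate e.2.ne hF)).stronglyMeasurable.integral_prod_right.measurable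

/-- For fixed `N` the generator is bounded in the supremum norm. -/
theorem exists_generator_bound (N : ℕ) {γ : ℝ} (hγ : γ ≤ 1) :
    ∃ Λ : ℝ, 0 ≤ Λ ∧ ∀ (F : KacSphere N → ℝ) (B : ℝ), (∀ v, |F v| ≤ B) →
      ∀ v, |generator γ F v| ≤ Λ * B := by
  refine ⟨(N : ℝ) / (N.choose 2 : ℝ) * ∑ _e : {e : Fin N × Fin N // e.1 < e.2}, (1 + (N : ℝ)) * 2,
    by positivity, fun F B hB v => ?_⟩
  rw [generator_eq, abs_mul, abs_neg, abs_of_nonneg (by positivity), mul_assoc, Finset.sum_mul]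
  refine mul_le_mul_of_nonneg_left ((Finset.abs_sum_le_sum_abs _ _).trans
    (Finset.sum_le_sum fun e _ => ?_)) (by positivity)
  rw [abs_mul, abs_of_nonneg (rate_nonneg γ _ _ v), mul_assoc]
  refine mul_le_mul (rate_le hγ e.2.ne v) ?_ (abs_nonneg _) (by positivity)
  have h := norm_integral_le_of_norm_le_const (μ := angleMeasure) (C := 2 * B)
    (f := fun θ => F v - F (rotate e.1.1 e.1.2 e.2.ne θ v)) (Eventually.of_forall fun θ => by
      rw [Real.norm_eq_abs]
      linarith [abs_sub (F v) (F (rotate e.1.1 e.1.2 e.2.ne θ v)), hB v,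
        hB (rotate e.1.1 e.1.2 e.2.ne θ v)])
  simpa using h

/-- On bounded measurable functions the semigroup is `1 + t L + O(t²)`, uniformly. -/
theorem exists_semigroup_bound {γ : ℝ} (hγ : γ ≤ 1) {F : KacSphere N → ℝ} (hF : Measurable F)
    {B : ℝ} (hB : ∀ v, |F v| ≤ B) :
    (∀ t, Measurable (semigroup γ t F)) ∧ ∃ A, ∀ t ∈ Icc (0 : ℝ) 1, ∀ v,
      |semigroup γ t F v - F v - t * generator γ F v| ≤ A * t ^ 2 := by
  obtain ⟨Λ, hΛ, hbound⟩ := exists_generator_bound N hγ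
  have hiter : ∀ n v, |(generator γ)^[n] F v| ≤ Λ ^ n * B := by
    intro n
    induction n with
    | zero => simpa using hB
    | succ n ih =>
      intro v
      rw [Function.iterate_succ_apply', pow_succ']
      exact (hbound _ _ ih v).trans_eq (mul_assoc _ _ _).symm
  have hmeas : ∀ n, Measurable ((generator γ)^[n] F) := by
    intro n
    induction n with
    | zero => exact hF
    | succ n ih => rw [Function.iterate_succ_apply']; exact measurable_generator γ ih
  have hterm : ∀ t n v, |t ^ n / (n.factorial : ℝ) * ((generator γ)^[n] F) v|
      ≤ (|t| * Λ) ^ n / n.factorial * B := by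
    intro t n v
    rw [abs_mul, abs_div, abs_pow, Nat.abs_cast, mul_pow, mul_div_right_comm, mul_assoc]
    exact mul_le_mul_of_nonneg_left (hiter n v) (by positivity)
  have hsum : ∀ t v, Summable fun n => t ^ n / (n.factorial : ℝ) * ((generator γ)^[n] F) v :=
    fun t v => Summable.of_norm_bounded ((Real.summable_pow_div_factorial _).mul_right B)
      fun n => hterm t n v
  constructor
  · intro t
    refine measurable_of_tendsto_metrizable (f := fun n v => ∑ k ∈ Finset.range n,
      t ^ k / (k.factorial : ℝ) * ((generator γ)^[k] F) v)
      (fun n => Finset.measurable_fun_sum _ fun k _ => (hmeas k).const_mul _)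
      (tendsto_pi_nhds.2 fun v => (hsum t v).hasSum.tendsto_sum_nat)
  · have hs := (summable_nat_add_iff 2).2 ((Real.summable_pow_div_factorial Λ).mul_right B)
    refine ⟨∑' n, Λ ^ (n + 2) / ((n + 2).factorial : ℝ) * B, fun t ht v => ?_⟩
    have hsplit := (hsum t v).sum_add_tsum_nat_add 2
    have hS : semigroup γ t F v - F v - t * generator γ F v
        = ∑' n, t ^ (n + 2) / ((n + 2).factorial : ℝ) * ((generator γ)^[n + 2] F) v := by
      rw [semigroup, ← hsplit]
      simp [Finset.sum_range_succ]
      ring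
    rw [hS, ← Real.norm_eq_abs]
    refine tsum_of_norm_bounded (hs.hasSum.mul_right (t ^ 2)) fun n =>
      (hterm t (n + 2) v).trans ?_
    have h1 : t ^ n ≤ 1 := pow_le_one₀ ht.1 ht.2
    have h2 : 0 ≤ Λ ^ (n + 2) / ((n + 2).factorial : ℝ) * B * t ^ 2 := by
      have : 0 ≤ B := (abs_nonneg _).trans (hB v)
      positivity
    rw [abs_of_nonneg ht.1, mul_pow, pow_add t]
    calc t ^ n * t ^ 2 * Λ ^ (n + 2) / ((n + 2).factorial : ℝ) * B
        = t ^ n * (Λ ^ (n + 2) / ((n + 2).factorial : ℝ) * B * t ^ 2) := by ring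
      _ ≤ _ := mul_le_of_le_one_left h2 h1

/-- Second order Taylor bound for `x log x`. -/
theorem abs_mul_log_sub_le {m x y : ℝ} (hm : 0 < m) (hx : m ≤ x) (hy : 0 < y) :
    |y * Real.log y - x * Real.log x - (1 + Real.log x) * (y - x)| ≤ (y - x) ^ 2 / m := by
  have hx0 := hm.trans_le hx
  have h1 : y * Real.log y - x * Real.log x - (1 + Real.log x) * (y - x)
      = y * Real.log (y / x) - (y - x) := by
    rw [Real.log_div hy.ne' hx0.ne']; ring
  have h2 := Real.log_le_sub_one_of_pos (div_pos hy hx0)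
  have h3 := Real.one_sub_inv_le_log_of_pos (div_pos hy hx0)
  have h4 : y * (y / x - 1) - (y - x) = (y - x) ^ 2 / x := by field_simp
  have h5 : y * (1 - (y / x)⁻¹) = y - x := by field_simp
  have h6 : (y - x) ^ 2 / x ≤ (y - x) ^ 2 / m := div_le_div_of_nonneg_left (sq_nonneg _) hm hx
  rw [h1, abs_of_nonneg]
  · linarith [mul_le_mul_of_nonneg_left h2 hy.le]
  · linarith [mul_le_mul_of_nonneg_left h3 hy.le]

theorem integrable_of_abs_le (hN : 2 ≤ N) {f : KacSphere N → ℝ} (hf : Measurable f) {B : ℝ}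
    (hB : ∀ v, |f v| ≤ B) : Integrable f (uniformMeasure N) :=
  have := isProbabilityMeasure_uniformMeasure hN
  Integrable.of_bound hf.aestronglyMeasurable B (Eventually.of_forall hB)

theorem integrable_prod_of_abs_le (hN : 2 ≤ N) {f : KacSphere N × ℝ → ℝ} (hf : Measurable f) {B : ℝ}
    (hB : ∀ x, |f x| ≤ B) : Integrable f ((uniformMeasure N).prod angleMeasure) :=
  have := isProbabilityMeasure_uniformMeasure hN
  Integrable.of_bound hf.aestronglyMeasurable B (Eventually.of_forall hB)

theorem abs_log_le {c K x : ℝ} (hc : 0 < c) (hx : x ∈ Icc c K) :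
    |Real.log x| ≤ |Real.log c| + |Real.log K| := by
  have h1 := Real.log_le_log hc hx.1
  have h2 := Real.log_le_log (hc.trans_le hx.1) hx.2
  exact abs_le.2 ⟨by linarith [neg_abs_le (Real.log c), abs_nonneg (Real.log K)],
    by linarith [le_abs_self (Real.log K), abs_nonneg (Real.log c)]⟩

/-- The derivative of the entropy along the Kac walk. -/
theorem entropyProduction_eq_integral (hN : 2 ≤ N) {γ : ℝ} (hγ : γ ≤ 1) {F : KacSphere N → ℝ}
    (hF : Measurable F) {c K : ℝ} (hc : 0 < c) (hcK : ∀ v, F v ∈ Icc c K) :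
    entropyProduction γ F
      = -∫ v, (1 + Real.log (F v)) * generator γ F v ∂(uniformMeasure N) := by
  have := isProbabilityMeasure_uniformMeasure hN
  have hFpos : ∀ v, 0 < F v := fun v => hc.trans_le (hcK v).1
  have hB : ∀ v, |F v| ≤ K := fun v => by rw [abs_of_pos (hFpos v)]; exact (hcK v).2
  obtain ⟨hSm, A, hA⟩ := exists_semigroup_bound hγ hF hB
  obtain ⟨Λ, hΛ, hΛb⟩ := exists_generator_bound N hγ
  have hG := hΛb F K hB
  have hGm := measurable_generator γ hF
  obtain ⟨v₀⟩ := nonempty_kacSphere hN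
  have hK : 0 ≤ K := (abs_nonneg _).trans (hB v₀)
  have hA0 : 0 ≤ A := by
    have := (abs_nonneg _).trans (hA 1 ⟨zero_le_one, le_rfl⟩ v₀)
    simpa using this
  set L := 1 + (|Real.log c| + |Real.log K|) with hL
  have hlog : ∀ v, |1 + Real.log (F v)| ≤ L := fun v =>
    (abs_add_le _ _).trans (by rw [abs_one]; linarith [abs_log_le hc (hcK v)])
  have hlm : Measurable fun v => 1 + Real.log (F v) := hF.log.const_add 1
  set A₁ := A + Λ * K with hA₁
  have hA₁0 : 0 ≤ A₁ := by positivity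
  have hS1 : ∀ t ∈ Icc (0 : ℝ) 1, ∀ v, |semigroup γ t F v - F v| ≤ A₁ * t := by
    intro t ht v
    have h1 := hA t ht v
    have h2 := abs_add_le (semigroup γ t F v - F v - t * generator γ F v) (t * generator γ F v)
    rw [sub_add_cancel, abs_mul, abs_of_nonneg ht.1] at h2
    have h3 := mul_le_mul_of_nonneg_left (hG v) ht.1
    nlinarith [mul_nonneg hA0 (mul_nonneg ht.1 (sub_nonneg.2 ht.2))]
  have hS0 : semigroup γ 0 F = F := by
    funext v
    have := hS1 0 ⟨le_rfl, zero_le_one⟩ v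
    rw [mul_zero] at this
    linarith [abs_eq_zero.1 (le_antisymm this (abs_nonneg _))]
  have hmain : ∀ t ∈ Icc (0 : ℝ) 1, A₁ * t < c →
      |entropy (semigroup γ t F) - entropy F
        - t * ∫ v, (1 + Real.log (F v)) * generator γ F v ∂(uniformMeasure N)|
      ≤ (A₁ ^ 2 / c + L * A) * t ^ 2 := by
    intro t ht htc
    have hpos : ∀ v, 0 < semigroup γ t F v := fun v => by
      linarith [(abs_le.1 (hS1 t ht v)).1, (hcK v).1]
    have hup : ∀ v, semigroup γ t F v ≤ K + A₁ * t := fun v => by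
      linarith [(abs_le.1 (hS1 t ht v)).2, (hcK v).2]
    have hi1 : Integrable (fun v => semigroup γ t F v * Real.log (semigroup γ t F v))
        (uniformMeasure N) := by
      obtain ⟨C, hC⟩ := (isCompact_Icc (a := 0) (b := K + A₁ * t)).exists_bound_of_continuousOn
        (f := fun x => x * Real.log x) Real.continuous_mul_log.continuousOn
      exact integrable_of_abs_le hN ((hSm t).mul (hSm t).log) fun v => hC _ ⟨(hpos v).le, hup v⟩
    have hi2 : Integrable (fun v => F v * Real.log (F v)) (uniformMeasure N) := by
      refine integrable_of_abs_le hN (hF.mul hF.log) (B := K * (|Real.log c| + |Real.log K|))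
        fun v => ?_
      rw [abs_mul]
      exact mul_le_mul (hB v) (abs_log_le hc (hcK v)) (abs_nonneg _) hK
    have hi3 : Integrable (fun v => (1 + Real.log (F v)) * generator γ F v) (uniformMeasure N) := by
      refine integrable_of_abs_le hN (hlm.mul hGm) (B := L * (Λ * K)) fun v => ?_
      rw [abs_mul]
      exact mul_le_mul (hlog v) (hG v) (abs_nonneg _) (by positivity)
    rw [entropy, entropy, ← integral_const_mul, ← integral_sub hi1 hi2,
      ← integral_sub (f := fun v => semigroup γ t F v * Real.log (semigroup γ t F v)
        - F v * Real.log (F v)) (hi1.sub hi2) (hi3.const_mul t), ← Real.norm_eq_abs]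
    have h := norm_integral_le_of_norm_le_const (μ := uniformMeasure N)
      (C := (A₁ ^ 2 / c + L * A) * t ^ 2)
      (f := fun v => semigroup γ t F v * Real.log (semigroup γ t F v) - F v * Real.log (F v)
        - t * ((1 + Real.log (F v)) * generator γ F v)) (Eventually.of_forall fun v => ?_)
    · simpa using h
    · have h1 := abs_mul_log_sub_le hc (hcK v).1 (hpos v)
      have h2 := hS1 t ht v
      have h3 : (semigroup γ t F v - F v) ^ 2 / c ≤ (A₁ * t) ^ 2 / c := by
        rw [← sq_abs]
        gcongr
      have h4 : |(1 + Real.log (F v)) * (semigroup γ t F v - F v - t * generator γ F v)|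
          ≤ L * (A * t ^ 2) := by
        rw [abs_mul]
        exact mul_le_mul (hlog v) (hA t ht v) (abs_nonneg _) (by positivity)
      have h5 := abs_add_le (semigroup γ t F v * Real.log (semigroup γ t F v)
          - F v * Real.log (F v) - (1 + Real.log (F v)) * (semigroup γ t F v - F v))
        ((1 + Real.log (F v)) * (semigroup γ t F v - F v - t * generator γ F v))
      rw [Real.norm_eq_abs]
      calc _ = _ := by congr 1; ring
        _ ≤ _ := h5
        _ ≤ (A₁ * t) ^ 2 / c + L * (A * t ^ 2) := add_le_add (h1.trans h3) h4
        _ = _ := by ring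
  have hderiv : HasDerivWithinAt (fun t => entropy (semigroup γ t F))
      (∫ v, (1 + Real.log (F v)) * generator γ F v ∂(uniformMeasure N)) (Ici 0) 0 := by
    rw [hasDerivWithinAt_iff_isLittleO]
    have hO : (fun t : ℝ => entropy (semigroup γ t F) - entropy (semigroup γ 0 F)
        - (t - 0) • ∫ v, (1 + Real.log (F v)) * generator γ F v ∂(uniformMeasure N))
        =O[𝓝[Ici 0] 0] fun t : ℝ => t ^ 2 := by
      refine Asymptotics.IsBigO.of_bound (A₁ ^ 2 / c + L * A) ?_
      have hε : 0 < min 1 (c / (A₁ + 1)) := lt_min one_pos (by positivity)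
      filter_upwards [self_mem_nhdsWithin,
        mem_nhdsWithin_of_mem_nhds (Iio_mem_nhds hε)] with t ht0 ht1
      have ht0' : (0 : ℝ) ≤ t := ht0
      have ht2 : t < c / (A₁ + 1) := lt_of_lt_of_le ht1 (min_le_right _ _)
      rw [lt_div_iff₀ (by positivity)] at ht2
      have := hmain t ⟨ht0, (lt_of_lt_of_le ht1 (min_le_left _ _)).le⟩ (by nlinarith)
      rw [hS0, sub_zero, smul_eq_mul, Real.norm_eq_abs, Real.norm_eq_abs, abs_of_nonneg (sq_nonneg t)]
      exact this
    refine hO.trans_isLittleO ?_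
    have : (fun t : ℝ => t ^ 2) =o[𝓝 0] fun t : ℝ => t - 0 := by
      simpa using (Asymptotics.isLittleO_pow_id (𝕜 := ℝ) one_lt_two)
    exact this.mono nhdsWithin_le_nhds
  rw [entropyProduction, hderiv.derivWithin (uniqueDiffOn_Ici 0 0 self_mem_Ici)]

theorem integral_comp_collision (hN : 2 ≤ N) {i j : Fin N} (hij : i ≠ j) {f : KacSphere N × ℝ → ℝ}
    (hf : Measurable f) :
    ∫ x, f (rotate i j hij x.2 x.1, -x.2) ∂((uniformMeasure N).prod angleMeasure)
      = ∫ x, f x ∂((uniformMeasure N).prod angleMeasure) := by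
  have h := measurePreserving_collision hN hij
  conv_rhs => rw [← h.map_eq]
  exact (integral_map h.measurable.aemeasurable hf.aestronglyMeasurable).symm

/-- The contribution `∬ (1 + v_i² + v_j²)^γ ψ(F, F ∘ R_{i,j,θ})` of the pair `i, j` to the entropy
production, where `ψ(a, b) = (a - b)(log a - log b)`. -/
def pairDissipation (γ : ℝ) (F : KacSphere N → ℝ) {i j : Fin N} (hij : i ≠ j) : ℝ :=
  ∫ x, (1 + pairEnergy i j x.1) ^ γ * jeffreys (F x.1) (F (rotate i j hij x.2 x.1))
    ∂((uniformMeasure N).prod angleMeasure)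

theorem entropyProduction_eq (hN : 2 ≤ N) {γ : ℝ} (hγ : γ ≤ 1) {F : KacSphere N → ℝ}
    (hF : Measurable F) {c K : ℝ} (hc : 0 < c) (hcK : ∀ v, F v ∈ Icc c K) :
    entropyProduction γ F = (N : ℝ) / (N.choose 2 : ℝ) *
      ∑ e : {e : Fin N × Fin N // e.1 < e.2}, 1 / 2 * pairDissipation γ F e.2.ne := by
  have := isProbabilityMeasure_uniformMeasure hN
  have hFpos : ∀ v, 0 < F v := fun v => hc.trans_le (hcK v).1
  have hB : ∀ v, |F v| ≤ K := fun v => by rw [abs_of_pos (hFpos v)]; exact (hcK v).2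
  have hlog : ∀ v, |1 + Real.log (F v)| ≤ 1 + (|Real.log c| + |Real.log K|) := fun v =>
    (abs_add_le _ _).trans (by rw [abs_one]; linarith [abs_log_le hc (hcK v)])
  have hlm : Measurable fun v => 1 + Real.log (F v) := hF.log.const_add 1
  have hterm : ∀ e : {e : Fin N × Fin N // e.1 < e.2},
      Integrable (fun v => (1 + Real.log (F v)) * ((1 + pairEnergy e.1.1 e.1.2 v) ^ γ *
        ∫ θ, (F v - F (rotate e.1.1 e.1.2 e.2.ne θ v)) ∂angleMeasure)) (uniformMeasure N) ∧
      ∫ v, (1 + Real.log (F v)) * ((1 + pairEnergy e.1.1 e.1.2 v) ^ γ *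
        ∫ θ, (F v - F (rotate e.1.1 e.1.2 e.2.ne θ v)) ∂angleMeasure) ∂(uniformMeasure N)
        = 1 / 2 * pairDissipation γ F e.2.ne := by
    intro e
    set h : KacSphere N × ℝ → ℝ := fun x => (1 + Real.log (F x.1)) *
      ((1 + pairEnergy e.1.1 e.1.2 x.1) ^ γ *
        (F x.1 - F (rotate e.1.1 e.1.2 e.2.ne x.2 x.1))) with hh
    have hm : Measurable h := (hlm.comp measurable_fst).mul
      (((measurable_rate γ e.1.1 e.1.2).comp measurable_fst).mul
        ((hF.comp measurable_fst).sub (measurable_comp_rotate e.2.ne hF)))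
    have hb : ∀ x, |h x| ≤ (1 + (|Real.log c| + |Real.log K|)) * ((1 + N) * (2 * K)) := by
      intro x
      have hK : 0 ≤ K := (abs_nonneg _).trans (hB x.1)
      rw [hh, abs_mul, abs_mul, abs_of_nonneg (rate_nonneg γ _ _ _)]
      refine mul_le_mul (hlog _) (mul_le_mul (rate_le hγ e.2.ne _) ?_ (abs_nonneg _)
        (by positivity)) (mul_nonneg (rate_nonneg γ _ _ _) (abs_nonneg _)) (by positivity)
      linarith [abs_sub (F x.1) (F (rotate e.1.1 e.1.2 e.2.ne x.2 x.1)), hB x.1,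
        hB (rotate e.1.1 e.1.2 e.2.ne x.2 x.1)]
    have hi := integrable_prod_of_abs_le hN hm hb
    have hfib : ∀ v, ∫ θ, h (v, θ) ∂angleMeasure = (1 + Real.log (F v)) *
        ((1 + pairEnergy e.1.1 e.1.2 v) ^ γ *
        ∫ θ, (F v - F (rotate e.1.1 e.1.2 e.2.ne θ v)) ∂angleMeasure) := by
      intro v
      rw [hh]
      simp only
      rw [integral_const_mul, integral_const_mul]
    have hi' := hi.integral_prod_left
    have hip := integral_prod _ hi
    simp only [hfib] at hi' hip
    refine ⟨hi', ?_⟩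
    rw [← hip]
    -- average the integrand with its image under the exchange of `v` and `R_{i,j,θ} v`
    have hsw := integral_comp_collision hN e.2.ne hm
    have hi2 : Integrable (fun x : KacSphere N × ℝ =>
        h (rotate e.1.1 e.1.2 e.2.ne x.2 x.1, -x.2)) ((uniformMeasure N).prod angleMeasure) :=
      integrable_prod_of_abs_le hN (hm.comp (measurePreserving_collision hN e.2.ne).measurable)
        fun x => hb _
    have hadd := integral_add hi hi2
    rw [hsw] at hadd
    have : pairDissipation γ F e.2.ne
        = ∫ x, h x ∂((uniformMeasure N).prod angleMeasure)
          + ∫ x, h x ∂((uniformMeasure N).prod angleMeasure) := by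
      rw [← hadd, pairDissipation]
      refine integral_congr_ae (Eventually.of_forall fun x => ?_)
      simp only [hh, rotate_rotate, add_neg_cancel, rotate_zero, pairEnergy_rotate, jeffreys]
      ring
    linarith
  rw [entropyProduction_eq_integral hN hγ hF hc hcK]
  have hgen : ∀ v, (1 + Real.log (F v)) * generator γ F v = -((N : ℝ) / (N.choose 2 : ℝ)) *
      ∑ e : {e : Fin N × Fin N // e.1 < e.2}, (1 + Real.log (F v)) *
        ((1 + pairEnergy e.1.1 e.1.2 v) ^ γ *
        ∫ θ, (F v - F (rotate e.1.1 e.1.2 e.2.ne θ v)) ∂angleMeasure) := by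
    intro v
    rw [generator_eq, ← Finset.mul_sum]
    ring
  simp only [hgen]
  rw [integral_const_mul, integral_finsetSum _ fun e _ => (hterm e).1,
    Finset.sum_congr rfl fun e _ => (hterm e).2]
  ring

/-! ### Comparison of collision rates -/

theorem measurable_pairDissipation_integrand (γ : ℝ) {F : KacSphere N → ℝ} (hF : Measurable F)
    {i j : Fin N} (hij : i ≠ j) : Measurable fun x : KacSphere N × ℝ =>
      (1 + pairEnergy i j x.1) ^ γ * jeffreys (F x.1) (F (rotate i j hij x.2 x.1)) :=
  ((measurable_rate γ i j).comp measurable_fst).mul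
    (measurable_jeffreys (hF.comp measurable_fst) (measurable_comp_rotate hij hF))

theorem integrable_pairDissipation (hN : 2 ≤ N) {γ : ℝ} (hγ : γ ≤ 1) {F : KacSphere N → ℝ}
    (hF : Measurable F) {c K : ℝ} (hc : 0 < c) (hcK : ∀ v, F v ∈ Icc c K) {i j : Fin N}
    (hij : i ≠ j) : Integrable (fun x : KacSphere N × ℝ =>
      (1 + pairEnergy i j x.1) ^ γ * jeffreys (F x.1) (F (rotate i j hij x.2 x.1)))
      ((uniformMeasure N).prod angleMeasure) := by
  refine integrable_prod_of_abs_le hN (measurable_pairDissipation_integrand γ hF hij)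
    (B := (1 + N) * (K * (Real.log K - Real.log c))) fun x => ?_
  rw [abs_mul, abs_of_nonneg (rate_nonneg γ _ _ _)]
  exact mul_le_mul (rate_le hγ hij _) (jeffreys_le_of_mem hc (hcK _) (hcK _)) (abs_nonneg _)
    (by positivity)

theorem pairDissipation_nonneg (γ : ℝ) {F : KacSphere N → ℝ} (hF : ∀ v, 0 < F v) {i j : Fin N}
    (hij : i ≠ j) : 0 ≤ pairDissipation γ F hij :=
  integral_nonneg fun _ => mul_nonneg (rate_nonneg γ _ _ _) (jeffreys_nonneg (hF _) (hF _))

theorem entropyProduction_nonneg (hN : 2 ≤ N) {γ : ℝ} (hγ : γ ≤ 1) {F : KacSphere N → ℝ}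
    (hF : Measurable F) {c K : ℝ} (hc : 0 < c) (hcK : ∀ v, F v ∈ Icc c K) :
    0 ≤ entropyProduction γ F := by
  rw [entropyProduction_eq hN hγ hF hc hcK]
  exact mul_nonneg (by positivity) (Finset.sum_nonneg fun e _ => mul_nonneg (by norm_num)
    (pairDissipation_nonneg γ (fun v => hc.trans_le (hcK v).1) e.2.ne))

/-- Entropy inequality for the collision rate `1 + v_i² + v_j²`. -/
theorem entropy_le_entropyProduction_one (hN : 2 ≤ N) {F : KacSphere N → ℝ} (hF : IsDensity F)
    {c K : ℝ} (hc : 0 < c) (hcK : ∀ v, F v ∈ Icc c K) :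
    entropy F ≤ 3 * entropyProduction 1 F := by
  have hFpos : ∀ v, 0 < F v := fun v => hc.trans_le (hcK v).1
  have h := entropy_le_pairProduction hN hF.measurable hc (fun v => (hcK v).1) fun v => (hcK v).2
  rw [hF.integral_eq_one, Real.log_one, mul_zero, sub_zero] at h
  have hD := entropyProduction_eq hN le_rfl hF.measurable hc hcK
  have hle : ∀ e : {e : Fin N × Fin N // e.1 < e.2},
      ∫ x, pairProduction F e.2.ne x.1 x.2 ∂((uniformMeasure N).prod angleMeasure)
        ≤ 6 * pairDissipation 1 F e.2.ne := by
    intro e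
    have hi := integrable_pairDissipation hN le_rfl hF.measurable hc hcK e.2.ne
    rw [pairDissipation, ← integral_const_mul]
    refine integral_mono_of_nonneg
      (Eventually.of_forall fun x => pairProduction_nonneg hFpos e.2.ne x.1 x.2)
      (hi.const_mul 6) (Eventually.of_forall fun x => ?_)
    have h1 := jeffreys_nonneg (hFpos x.1) (hFpos (rotate e.1.1 e.1.2 e.2.ne x.2 x.1))
    have h2 := mul_nonneg (pairEnergy_nonneg e.1.1 e.1.2 x.1) h1
    simp only [pairProduction, Real.rpow_one]
    linarith
  have hsum : (∑ e : {e : Fin N × Fin N // e.1 < e.2}, 1 / 2 *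
        ∫ x, pairProduction F e.2.ne x.1 x.2 ∂((uniformMeasure N).prod angleMeasure))
      ≤ 6 * ∑ e : {e : Fin N × Fin N // e.1 < e.2}, 1 / 2 * pairDissipation 1 F e.2.ne := by
    rw [Finset.mul_sum]
    exact Finset.sum_le_sum fun e _ => by linarith [hle e]
  have hnn : 0 ≤ ∑ e : {e : Fin N × Fin N // e.1 < e.2}, 1 / 2 * pairDissipation 1 F e.2.ne :=
    Finset.sum_nonneg fun e _ => mul_nonneg (by norm_num) (pairDissipation_nonneg 1 hFpos e.2.ne)
  set S := ∑ e : {e : Fin N × Fin N // e.1 < e.2}, 1 / 2 * pairDissipation 1 F e.2.ne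
  have hN' : (2 : ℝ) ≤ N := by exact_mod_cast hN
  have hN1 : (0 : ℝ) < N - 1 := by linarith
  have hNS : N * entropy F ≤ 6 * S := h.trans hsum
  rw [hD, Nat.cast_choose_two]
  have h1 : 3 * ((N : ℝ) / (N * (N - 1) / 2) * S) = 6 * S / (N - 1) := by
    field_simp
    ring
  rw [h1, le_div_iff₀ hN1]
  rcases le_total 0 (entropy F) with h2 | h2
  · nlinarith
  · exact (mul_nonpos_of_nonpos_of_nonneg h2 hN1.le).trans (by linarith)

/-- If the rate `1 + v_i² + v_j²` exceeds `A (1 + v_i² + v_j²)^γ` by at most `g (1 + v_i² + v_j²)`,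
then the entropy is controlled by the entropy production at rate `γ` and by the integrals of `g`
against the density. -/
theorem entropy_le_of_rate_le (hN : 2 ≤ N) {γ : ℝ} (hγ : γ ≤ 1) {F : KacSphere N → ℝ}
    (hF : IsDensity F) {C : ℝ} (hpos : ∀ v, 0 < F v) (hlog : ∀ v, |Real.log (F v)| ≤ C * N)
    {A G : ℝ} {g : ℝ → ℝ} (hg0 : ∀ w, 1 ≤ w → 0 ≤ g w)
    (hrate : ∀ w, 1 ≤ w → w ≤ A * w ^ γ + g w)
    (hgi : ∀ i j : Fin N, i ≠ j →
      Integrable (fun v => g (1 + pairEnergy i j v) * F v) (uniformMeasure N))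
    (hG : ∀ i j : Fin N, i ≠ j →
      ∫ v, g (1 + pairEnergy i j v) * F v ∂(uniformMeasure N) ≤ G) :
    entropy F / N / 3 ≤ A * (entropyProduction γ F / N) + 2 * C * N * G := by
  have := isProbabilityMeasure_uniformMeasure hN
  have hcK : ∀ v, F v ∈ Icc (Real.exp (-(C * N))) (Real.exp (C * N)) := fun v =>
    ⟨(Real.le_log_iff_exp_le (hpos v)).1 (abs_le.1 (hlog v)).1,
      (Real.log_le_iff_le_exp (hpos v)).1 (abs_le.1 (hlog v)).2⟩
  have hc := Real.exp_pos (-(C * N))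
  have h1 := entropy_le_entropyProduction_one hN hF hc hcK
  rw [entropyProduction_eq hN le_rfl hF.measurable hc hcK] at h1
  rw [entropyProduction_eq hN hγ hF.measurable hc hcK]
  have hpair : ∀ e : {e : Fin N × Fin N // e.1 < e.2},
      1 / 2 * pairDissipation 1 F e.2.ne
        ≤ A * (1 / 2 * pairDissipation γ F e.2.ne) + 2 * C * N * G := by
    intro e
    set i := e.1.1
    set j := e.1.2
    have hij : i ≠ j := e.2.ne
    have hCN : 0 ≤ C * N := by
      obtain ⟨v⟩ := nonempty_kacSphere hN
      exact (abs_nonneg _).trans (hlog v)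
    have hiγ := integrable_pairDissipation hN hγ hF.measurable hc hcK hij
    have hi1 := integrable_pairDissipation hN le_rfl hF.measurable hc hcK hij
    have hga : Integrable (fun x : KacSphere N × ℝ => g (1 + pairEnergy i j x.1) * F x.1)
        ((uniformMeasure N).prod angleMeasure) := (hgi i j hij).comp_fst angleMeasure
    have hmp := measurePreserving_rotate_prod hN hij
    have hgb : Integrable (fun x : KacSphere N × ℝ =>
        g (1 + pairEnergy i j x.1) * F (rotate i j hij x.2 x.1))
        ((uniformMeasure N).prod angleMeasure) := by
      have := hmp.integrable_comp_of_integrable (hgi i j hij)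
      simpa only [Function.comp_def, pairEnergy_rotate] using this
    have hIa : ∫ x : KacSphere N × ℝ, g (1 + pairEnergy i j x.1) * F x.1
        ∂((uniformMeasure N).prod angleMeasure) ≤ G := by
      rw [integral_fun_fst (fun v => g (1 + pairEnergy i j v) * F v)]
      simpa using hG i j hij
    have hIb : ∫ x : KacSphere N × ℝ, g (1 + pairEnergy i j x.1) * F (rotate i j hij x.2 x.1)
        ∂((uniformMeasure N).prod angleMeasure) ≤ G := by
      have h2 := integral_map (μ := (uniformMeasure N).prod angleMeasure)
        hmp.measurable.aemeasurable (f := fun v => g (1 + pairEnergy i j v) * F v)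
        (by rw [hmp.map_eq]; exact (hgi i j hij).aestronglyMeasurable)
      rw [hmp.map_eq] at h2
      simp only [pairEnergy_rotate] at h2
      exact h2.symm.trans_le (hG i j hij)
    have hmono := integral_mono hi1 ((hiγ.const_mul A).add
      ((hga.add hgb).const_mul (2 * (C * N)))) fun x => by
      have hw := one_le_one_add_pairEnergy i j x.1
      have hψ := jeffreys_nonneg (hpos x.1) (hpos (rotate i j hij x.2 x.1))
      have hψ2 : jeffreys (F x.1) (F (rotate i j hij x.2 x.1))
          ≤ 2 * (C * N) * (F x.1 + F (rotate i j hij x.2 x.1)) := by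
        have h3 : |F x.1 - F (rotate i j hij x.2 x.1)| ≤ F x.1 + F (rotate i j hij x.2 x.1) :=
          abs_le.2 ⟨by linarith [hpos x.1], by linarith [hpos (rotate i j hij x.2 x.1)]⟩
        have h4 : |Real.log (F x.1) - Real.log (F (rotate i j hij x.2 x.1))| ≤ 2 * (C * N) := by
          linarith [abs_sub (Real.log (F x.1)) (Real.log (F (rotate i j hij x.2 x.1))),
            hlog x.1, hlog (rotate i j hij x.2 x.1)]
        refine (le_abs_self _).trans ?_
        rw [jeffreys, abs_mul, mul_comm (2 * (C * N))]
        exact mul_le_mul h3 h4 (abs_nonneg _) ((abs_nonneg _).trans h3)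
      have h5 := mul_le_mul_of_nonneg_right (hrate _ hw) hψ
      have h6 := mul_le_mul_of_nonneg_left hψ2 (hg0 _ hw)
      simp only [Real.rpow_one, Pi.add_apply]
      linarith
    have hsplit := integral_add (hiγ.const_mul A) ((hga.add hgb).const_mul (2 * (C * N)))
    rw [integral_const_mul, integral_const_mul, integral_add' hga hgb] at hsplit
    have h7 := hmono.trans_eq hsplit
    have h8 : 2 * (C * N) * (∫ x : KacSphere N × ℝ, g (1 + pairEnergy i j x.1) * F x.1
        ∂((uniformMeasure N).prod angleMeasure) + ∫ x : KacSphere N × ℝ,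
          g (1 + pairEnergy i j x.1) * F (rotate i j hij x.2 x.1)
        ∂((uniformMeasure N).prod angleMeasure)) ≤ 2 * (C * N) * (G + G) :=
      mul_le_mul_of_nonneg_left (add_le_add hIa hIb) (by linarith)
    unfold pairDissipation
    linarith
  have hsum := Finset.sum_le_sum fun e (_ : e ∈ Finset.univ) => hpair e
  rw [Finset.sum_add_distrib, ← Finset.mul_sum _ _ A, Finset.sum_const, nsmul_eq_mul] at hsum
  have hcard : ((Finset.univ : Finset {e : Fin N × Fin N // e.1 < e.2}).card : ℝ)
      = N.choose 2 := by
    have h := sum_sum_eq_two_mul_sum_pairs (G := fun k l : Fin N => if k = l then (0 : ℝ) else 1)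
      (fun k => if_pos rfl) fun k l => by simp only [eq_comm]
    have h1 : ∀ e : {e : Fin N × Fin N // e.1 < e.2},
        (if e.1.1 = e.1.2 then (0 : ℝ) else 1) = 1 := fun e => if_neg e.2.ne
    have h2 : ∀ k : Fin N, ∑ l, (if k = l then (0 : ℝ) else 1) = N - 1 := by
      intro k
      have : ∀ l, (if k = l then (0 : ℝ) else 1) = 1 - if k = l then 1 else 0 := fun l => by
        split_ifs <;> norm_num
      simp [this]
    simp only [h1, h2] at h
    rw [Nat.cast_choose_two]
    simp at h ⊢
    linarith
  rw [hcard] at hsum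
  set S₁ := ∑ e : {e : Fin N × Fin N // e.1 < e.2}, 1 / 2 * pairDissipation 1 F e.2.ne
  set S := ∑ e : {e : Fin N × Fin N // e.1 < e.2}, 1 / 2 * pairDissipation γ F e.2.ne
  have hN0 : (0 : ℝ) < N := by exact_mod_cast (by omega : 0 < N)
  have hch : (0 : ℝ) < N.choose 2 := by exact_mod_cast Nat.choose_pos hN
  have h9 : entropy F / N / 3 ≤ S₁ / N.choose 2 := by
    rw [div_div, div_le_div_iff₀ (by positivity) hch]
    rw [div_mul_eq_mul_div, ← mul_div_assoc, le_div_iff₀ hch] at h1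
    linarith
  refine h9.trans ?_
  rw [div_le_iff₀ hch]
  refine hsum.trans_eq ?_
  field_simp

/-- By symmetry the moments of each velocity are those of the first one. -/
theorem integral_coord_le (hN : 2 ≤ N) {F : KacSphere N → ℝ} (hF : IsDensity F)
    (hsymm : IsSymmetric F) {h : ℝ → ℝ} (hm : Measurable h) (h0 : ∀ x, 0 ≤ h x) {M : ENNReal}
    (hM : M < ⊤)
    (hle : ∫⁻ v, ENNReal.ofReal (h (firstVelocity v) * F v) ∂(uniformMeasure N) ≤ M) (i : Fin N) :
    Integrable (fun v : KacSphere N => h ((v : Velocities N) i) * F v) (uniformMeasure N) ∧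
      ∫ v : KacSphere N, h ((v : Velocities N) i) * F v ∂(uniformMeasure N) ≤ M.toReal := by
  have hN0 : 0 < N := by omega
  have hmi : Measurable fun v : KacSphere N => h ((v : Velocities N) i) * F v :=
    (hm.comp (continuous_coord i).measurable).mul hF.measurable
  have h00 : ∀ v : KacSphere N, 0 ≤ h ((v : Velocities N) i) * F v := fun v =>
    mul_nonneg (h0 _) (hF.nonneg v)
  have heq : ∫⁻ v : KacSphere N, ENNReal.ofReal (h ((v : Velocities N) i) * F v) ∂(uniformMeasure N)
      = ∫⁻ v, ENNReal.ofReal (h (firstVelocity v) * F v) ∂(uniformMeasure N) := by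
    rw [← (measurePreserving_permute (Equiv.swap (⟨0, hN0⟩ : Fin N) i)).lintegral_comp
      hmi.ennreal_ofReal]
    refine lintegral_congr fun v => ?_
    rw [hsymm, firstVelocity, dif_pos hN0]
    simp [permute]
  have hlt := (heq.trans_le hle).trans_lt hM
  refine ⟨(lintegral_ofReal_ne_top_iff_integrable hmi.aestronglyMeasurable
    (Eventually.of_forall h00)).1 hlt.ne, ?_⟩
  rw [integral_eq_lintegral_of_nonneg_ae (Eventually.of_forall h00) hmi.aestronglyMeasurable]
  exact ENNReal.toReal_mono hM.ne (heq.trans_le hle)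

/-! ### Polynomial moments -/

/-- Above the level `R`, the rate is absorbed by a higher power. -/
theorem le_rpow_mul_add {γ k R w : ℝ} (hγ : γ ≤ 1) (hk : 1 < k) (hR : 0 < R) (hw : 1 ≤ w) :
    w ≤ R ^ (1 - γ) * w ^ γ + R ^ (1 - k) * w ^ k := by
  have hw0 : 0 < w := by linarith
  rcases le_total w R with h | h
  · have h1 : w = w ^ (1 - γ) * w ^ γ := by
      rw [← Real.rpow_add hw0, sub_add_cancel, Real.rpow_one]
    have h2 : w ^ (1 - γ) * w ^ γ ≤ R ^ (1 - γ) * w ^ γ :=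
      mul_le_mul_of_nonneg_right (Real.rpow_le_rpow hw0.le h (by linarith)) (by positivity)
    have h3 : 0 ≤ R ^ (1 - k) * w ^ k := by positivity
    linarith
  · have h1 : w = w ^ (1 - k) * w ^ k := by
      rw [← Real.rpow_add hw0, sub_add_cancel, Real.rpow_one]
    have h2 : w ^ (1 - k) * w ^ k ≤ R ^ (1 - k) * w ^ k :=
      mul_le_mul_of_nonneg_right (Real.rpow_le_rpow_of_nonpos hR h (by linarith)) (by positivity)
    have h3 : 0 ≤ R ^ (1 - γ) * w ^ γ := by positivity
    linarith

/-- Convexity of `x^k`, applied to the mean of `1`, `v_i²` and `v_j²`. -/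
theorem one_add_pairEnergy_rpow_le {k : ℝ} (hk : 1 < k) (i j : Fin N) (v : KacSphere N) :
    (1 + pairEnergy i j v) ^ k ≤ (3 : ℝ) ^ (k - 1) *
      (1 + |(v : Velocities N) i| ^ (2 * k) + |(v : Velocities N) j| ^ (2 * k)) := by
  have h := Real.rpow_sum_le_const_mul_sum_rpow_of_nonneg (Finset.univ : Finset (Fin 3)) hk.le
    (f := ![1, (v : Velocities N) i ^ 2, (v : Velocities N) j ^ 2]) (by
      intro a _
      fin_cases a
      · simp
      · exact sq_nonneg _
      · exact sq_nonneg _)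
  have hp : ∀ x : ℝ, (x ^ 2) ^ k = |x| ^ (2 * k) := fun x => by
    rw [Real.rpow_mul (abs_nonneg x), Real.rpow_two, sq_abs]
  simp only [Fin.sum_univ_three, Finset.card_univ, Fintype.card_fin] at h
  simpa [pairEnergy, hp, add_assoc] using h

/-- The constant in the polynomial bound results from the choice of the threshold which optimises
`x / 3 ≤ R^(1-γ) d + Y R^(1-k)`. -/
theorem rateConst_mul_rpow_le {k γ C M x d n : ℝ} (hk : 1 < k) (hγ : γ < 1)
    (hC : 0 < C) (hM : 0 ≤ M) (hn : 0 < n) (hx : 0 ≤ x) (hd : 0 ≤ d)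
    (h : ∀ R : ℝ, 0 < R → x / 3 ≤ R ^ (1 - γ) * d
      + 2 * C * n * (R ^ (1 - k) * ((3 : ℝ) ^ (k - 1) * (1 + 2 * M)))) :
    (k - 1) / ((3 : ℝ) ^ ((2 * k - γ * k - γ) / (k - 1)) * (1 - γ)) *
      ((1 - γ) / (k - γ)) ^ ((k - γ) / (k - 1)) *
      (1 / ((2 * C) ^ ((1 - γ) / (k - 1)) * (1 + 2 * M) ^ ((1 - γ) / (k - 1)))) *
      n ^ ((γ - 1) / (k - 1)) * x ^ (1 + (1 - γ) / (k - 1)) ≤ d := by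
  have hk1 : 0 < k - 1 := by linarith
  have hγ1 : 0 < 1 - γ := by linarith
  have hkγ : 0 < k - γ := by linarith
  set q := (1 - γ) / (k - 1) with hq
  have hq0 : 0 < q := div_pos hγ1 hk1
  have hqk : q * (k - 1) = 1 - γ := by rw [hq]; field_simp
  rcases hx.eq_or_lt with rfl | hx0
  · rwa [Real.zero_rpow (by linarith), mul_zero]
  set Y := 2 * C * (1 + 2 * M) * n * (3 : ℝ) ^ (k - 1) with hY
  have hM1 : 0 < 1 + 2 * M := by linarith
  have hY0 : 0 < Y := by positivity
  -- the optimal threshold `R`, in terms of `s = R^(1-k)`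
  set s := q / (1 + q) * (x / 3) / Y with hs
  have hs0 : 0 < s := by positivity
  have hR := h (s ^ (-(1 / (k - 1)))) (by positivity)
  rw [← Real.rpow_mul hs0.le, ← Real.rpow_mul hs0.le] at hR
  have e1 : -(1 / (k - 1)) * (1 - γ) = -q := by rw [hq]; ring
  have e2 : -(1 / (k - 1)) * (1 - k) = 1 := by field_simp; ring
  rw [e1, e2, Real.rpow_one, Real.rpow_neg hs0.le] at hR
  have hYs : 2 * C * n * (s * ((3 : ℝ) ^ (k - 1) * (1 + 2 * M))) = q / (1 + q) * (x / 3) := by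
    have : 2 * C * n * (s * ((3 : ℝ) ^ (k - 1) * (1 + 2 * M))) = s * Y := by rw [hY]; ring
    rw [this, hs]; field_simp
  rw [hYs] at hR
  have hsq : 0 < s ^ q := by positivity
  have hstep : s ^ q * (x / 3 / (1 + q)) ≤ d := by
    have h1 : x / 3 / (1 + q) = x / 3 - q / (1 + q) * (x / 3) := by field_simp; ring
    have h2 : x / 3 / (1 + q) ≤ (s ^ q)⁻¹ * d := by linarith
    calc s ^ q * (x / 3 / (1 + q)) ≤ s ^ q * ((s ^ q)⁻¹ * d) :=
          mul_le_mul_of_nonneg_left h2 hsq.le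
      _ = d := by field_simp
  refine le_trans ?_ hstep
  -- expand both sides in powers of the parameters
  have f1 : (k - γ) / (k - 1) = q + 1 := by rw [hq]; field_simp; ring
  have f2 : (1 - γ) / (k - γ) = q / (1 + q) := by
    rw [hq]; field_simp; ring
  have f3 : (γ - 1) / (k - 1) = -q := by rw [hq]; ring
  have f4 : (k - 1) / ((3 : ℝ) ^ ((2 * k - γ * k - γ) / (k - 1)) * (1 - γ))
      = 1 / ((3 : ℝ) ^ ((2 * k - γ * k - γ) / (k - 1)) * q) := by
    rw [hq]; field_simp
  have hu : 0 < q / (1 + q) := by positivity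
  have g1 : s ^ q = (q / (1 + q)) ^ q * (x ^ q / (3 : ℝ) ^ q) /
      ((2 * C) ^ q * (1 + 2 * M) ^ q * n ^ q * (3 : ℝ) ^ (1 - γ)) := by
    rw [hs, hY, Real.div_rpow (by positivity) (by positivity),
      Real.mul_rpow (by positivity) (by positivity), Real.div_rpow hx0.le (by norm_num),
      Real.mul_rpow (by positivity) (by positivity), Real.mul_rpow (by positivity) hn.le,
      Real.mul_rpow (by positivity) hM1.le, ← Real.rpow_mul (by norm_num), mul_comm (k - 1), hqk]
  have g2 : (3 : ℝ) ^ q * (3 : ℝ) ^ (1 - γ) * 3 ≤ (3 : ℝ) ^ ((2 * k - γ * k - γ) / (k - 1)) := by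
    have : (3 : ℝ) ^ q * (3 : ℝ) ^ (1 - γ) * 3 = (3 : ℝ) ^ (q + (1 - γ) + 1) := by
      rw [Real.rpow_add_one (by norm_num), Real.rpow_add (by norm_num)]
    rw [this]
    refine Real.rpow_le_rpow_of_exponent_le (by norm_num) ?_
    rw [le_div_iff₀ hk1]
    nlinarith
  rw [f1, f2, f3, f4, g1, Real.rpow_neg hn.le, Real.rpow_add_one hu.ne', add_comm 1 q,
    Real.rpow_add_one hx0.ne']
  set E := (3 : ℝ) ^ ((2 * k - γ * k - γ) / (k - 1))
  have t1 : 0 < (3 : ℝ) ^ q := by positivity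
  have t2 : 0 < (3 : ℝ) ^ (1 - γ) := by positivity
  have t3 : 0 < (2 * C) ^ q := by positivity
  have t4 : 0 < (1 + 2 * M) ^ q := by positivity
  have t5 : 0 < n ^ q := by positivity
  have t6 : 0 < x ^ q := by positivity
  have t7 : 0 < (q / (q + 1)) ^ q := by positivity
  have hE : 0 < E := by positivity
  generalize (3 : ℝ) ^ q = a1 at *
  generalize (3 : ℝ) ^ (1 - γ) = a2 at *
  generalize (2 * C) ^ q = a3 at *
  generalize (1 + 2 * M) ^ q = a4 at *
  generalize n ^ q = a5 at *
  generalize x ^ q = a6 at *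
  generalize (q / (q + 1)) ^ q = a7 at *
  have hq1 : 0 < q + 1 := by linarith
  have l1 : 1 / (E * q) * (a7 * (q / (q + 1))) * (1 / (a3 * a4)) * a5⁻¹ * (a6 * x)
      = a7 * a6 * x / ((q + 1) * a3 * a4 * a5) * (1 / E) := by
    field_simp
  have l2 : a7 * (a6 / a1) / (a3 * a4 * a5 * a2) * (x / 3 / (q + 1))
      = a7 * a6 * x / ((q + 1) * a3 * a4 * a5) * (1 / (a1 * a2 * 3)) := by
    field_simp
  rw [l1, l2]
  exact mul_le_mul_of_nonneg_left (one_div_le_one_div_of_le (by positivity) g2) (by positivity)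

/-- The moments of the marginal law, read on the sphere. -/
theorem lintegral_firstVelocity_eq_moment {F : KacSphere N → ℝ} (hF : IsDensity F) (p : ℝ) :
    ∫⁻ v, ENNReal.ofReal (|firstVelocity v| ^ p * F v) ∂(uniformMeasure N)
      = moment p (marginal F) := by
  have hm1 : Measurable (firstVelocity (N := N)) := by
    unfold firstVelocity
    split_ifs with h
    · exact (continuous_coord _).measurable
    · exact measurable_const
  have hm2 : Measurable fun x : ℝ => ENNReal.ofReal (|x| ^ p) :=
    ((measurable_id.abs).pow_const p).ennreal_ofReal
  rw [moment, marginal, lintegral_map hm2 hm1,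
    lintegral_withDensity_eq_lintegral_mul _ hF.measurable.ennreal_ofReal
      (g := fun v => ENNReal.ofReal (|firstVelocity v| ^ p)) (hm2.comp hm1)]
  refine lintegral_congr fun v => ?_
  rw [Pi.mul_apply, ENNReal.ofReal_mul (by positivity), mul_comm]

theorem entropy_mem_Icc (hN : 2 ≤ N) {F : KacSphere N → ℝ} (hF : IsDensity F)
    (hpos : ∀ v, 0 < F v) {B : ℝ} (hlog : ∀ v, |Real.log (F v)| ≤ B) : entropy F ∈ Icc 0 B := by
  have := isProbabilityMeasure_uniformMeasure hN
  have hi : Integrable (fun v => F v * Real.log (F v)) (uniformMeasure N) :=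
    hF.integrable.mul_bdd (c := B) hF.measurable.log.aestronglyMeasurable
      (Eventually.of_forall hlog)
  constructor
  · have h := integral_mono (hF.integrable.sub (integrable_const 1)) hi fun v => by
      have := mul_le_mul_of_nonneg_left (Real.one_sub_inv_le_log_of_pos (hpos v)) (hpos v).le
      rw [mul_sub, mul_one, mul_inv_cancel₀ (hpos v).ne'] at this
      exact this
    have h2 := integral_sub hF.integrable (integrable_const (μ := uniformMeasure N) (1 : ℝ))
    rw [hF.integral_eq_one] at h2
    simp only [Pi.sub_apply] at h
    rw [h2] at h
    simpa [entropy] using h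
  · have h := integral_mono hi (hF.integrable.mul_const B) fun v =>
      mul_le_mul_of_nonneg_left ((le_abs_self _).trans (hlog v)) (hpos v).le
    rwa [integral_mul_const, hF.integral_eq_one, one_mul] at h

theorem entropyProduction_div_ge_of_moment (hN : 2 ≤ N) {γ : ℝ} (hγ : γ ≤ 1)
    {F : KacSphere N → ℝ} (hF : IsDensity F) (hsymm : IsSymmetric F) {C : ℝ} (hC : 0 < C)
    (hpos : ∀ v, 0 < F v) (hlog : ∀ v, |Real.log (F v)| ≤ C * N) {k : ℝ} (hk : 1 < k)
    {M : ENNReal} (hM : M < ⊤) (hmom : moment (2 * k) (marginal F) ≤ M) :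
    rateConst k γ N C M.toReal * (entropy F / N) ^ (1 + (1 - γ) / (k - 1))
      ≤ entropyProduction γ F / N := by
  have := isProbabilityMeasure_uniformMeasure hN
  have hN0 : (0 : ℝ) < N := by exact_mod_cast (by omega : 0 < N)
  have hx : 0 ≤ entropy F / N := div_nonneg (entropy_mem_Icc hN hF hpos hlog).1 hN0.le
  have hcK : ∀ v, F v ∈ Icc (Real.exp (-(C * N))) (Real.exp (C * N)) := fun v =>
    ⟨(Real.le_log_iff_exp_le (hpos v)).1 (abs_le.1 (hlog v)).1,
      (Real.log_le_iff_le_exp (hpos v)).1 (abs_le.1 (hlog v)).2⟩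
  rcases hγ.eq_or_lt with rfl | hγ1
  · have h := entropy_le_entropyProduction_one hN hF (Real.exp_pos _) hcK
    rw [rateConst, if_pos rfl, sub_self, zero_div, add_zero, Real.rpow_one, div_mul_div_comm,
      div_le_div_iff₀ (by positivity) hN0]
    nlinarith
  rw [rateConst, if_neg hγ1.ne]
  refine rateConst_mul_rpow_le hk hγ1 hC ENNReal.toReal_nonneg hN0 hx
    (div_nonneg (entropyProduction_nonneg hN hγ hF.measurable (Real.exp_pos _) hcK) hN0.le)
    fun R hR => ?_
  have hcoord := integral_coord_le hN hF hsymm (h := fun x => |x| ^ (2 * k))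
    (measurable_id.abs.pow_const _) (fun x => by positivity) hM
    ((lintegral_firstVelocity_eq_moment hF (2 * k)).trans_le hmom)
  -- the domination of `(1 + v_i² + v_j²)^k` by one-particle moments
  have hdom : ∀ (i j : Fin N) (v : KacSphere N),
      R ^ (1 - k) * (1 + pairEnergy i j v) ^ k * F v ≤ R ^ (1 - k) * ((3 : ℝ) ^ (k - 1) *
        (F v + |(v : Velocities N) i| ^ (2 * k) * F v + |(v : Velocities N) j| ^ (2 * k) * F v)) := by
    intro i j v
    have h1 := mul_le_mul_of_nonneg_right (mul_le_mul_of_nonneg_left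
      (one_add_pairEnergy_rpow_le hk i j v) (Real.rpow_nonneg hR.le (1 - k))) (hpos v).le
    refine h1.trans_eq ?_
    ring
  have hint : ∀ i j : Fin N, Integrable (fun v : KacSphere N => R ^ (1 - k) * ((3 : ℝ) ^ (k - 1) *
        (F v + |(v : Velocities N) i| ^ (2 * k) * F v + |(v : Velocities N) j| ^ (2 * k) * F v)))
        (uniformMeasure N) := fun i j =>
    (((hF.integrable.add (hcoord i).1).add (hcoord j).1).const_mul _).const_mul _
  have hnn : ∀ (i j : Fin N) (v : KacSphere N),
      0 ≤ R ^ (1 - k) * (1 + pairEnergy i j v) ^ k * F v := fun i j v =>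
    mul_nonneg (mul_nonneg (Real.rpow_nonneg hR.le _) (rate_nonneg k i j v)) (hpos v).le
  refine entropy_le_of_rate_le hN hγ hF hpos hlog (g := fun w => R ^ (1 - k) * w ^ k)
    (fun w hw => by positivity) (fun w hw => le_rpow_mul_add hγ hk hR hw) (fun i j _ => ?_)
    fun i j _ => ?_
  · refine (hint i j).mono' (((measurable_rate k i j).const_mul _).mul
      hF.measurable).aestronglyMeasurable (Eventually.of_forall fun v => ?_)
    rw [Real.norm_eq_abs, abs_of_nonneg (hnn i j v)]
    exact hdom i j v
  · refine (integral_mono_of_nonneg (Eventually.of_forall (hnn i j)) (hint i j)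
      (Eventually.of_forall (hdom i j))).trans ?_
    rw [integral_const_mul, integral_const_mul]
    refine mul_le_mul_of_nonneg_left (mul_le_mul_of_nonneg_left ?_ (by positivity)) (by positivity)
    rw [integral_add (f := fun v : KacSphere N => F v + |(v : Velocities N) i| ^ (2 * k) * F v)
      (hF.integrable.add (hcoord i).1) (hcoord j).1, integral_add hF.integrable (hcoord i).1, hF.integral_eq_one]
    linarith [(hcoord i).2, (hcoord j).2]

/-! ### Exponential moments -/

/-- The inequality `e s ≤ exp s` at `s = a μ z / 4`, raised to the power `2 / μ`. -/
theorem rpow_le_const_mul_exp {a μ z : ℝ} (ha : 0 < a) (hμ : 0 < μ) (hz : 0 ≤ z) :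
    z ^ (2 / μ) ≤ (4 / (a * μ * Real.exp 1)) ^ (2 / μ) * Real.exp (a * z / 2) := by
  have h1 : z ≤ 4 / (a * μ * Real.exp 1) * Real.exp (a * μ * z / 4) := by
    have h := Real.add_one_le_exp (a * μ * z / 4 - 1)
    rw [sub_add_cancel, Real.exp_sub] at h
    have h2 : z = 4 / (a * μ) * (a * μ * z / 4) := by field_simp
    calc z = 4 / (a * μ) * (a * μ * z / 4) := h2
      _ ≤ 4 / (a * μ) * (Real.exp (a * μ * z / 4) / Real.exp 1) :=
        mul_le_mul_of_nonneg_left h (by positivity)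
      _ = _ := by field_simp
  refine (Real.rpow_le_rpow hz h1 (by positivity)).trans_eq ?_
  rw [Real.mul_rpow (by positivity) (by positivity), ← Real.exp_mul]
  congr 2
  field_simp
  norm_num

/-- Exponential bound for the large velocities; `Z` is the threshold for `(1/4 + v²/2)^(μ/2)`. -/
theorem tail_le_exp {a μ Z u : ℝ} (ha : 0 < a) (hμ : 0 < μ)
    (hu : 2 * Z ^ (2 / μ) < 1 / 2 + u ^ 2) :
    2 * (1 / 2 + u ^ 2) ≤ 4 * (4 / (a * μ * Real.exp 1)) ^ (2 / μ) *
      Real.exp (a / (2 : ℝ) ^ (μ / 2)) * Real.exp (-(a * Z / 2)) * Real.exp (a * |u| ^ μ) := by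
  set z := (1 / 4 + u ^ 2 / 2) ^ (μ / 2) with hz
  have hy0 : 0 ≤ 1 / 4 + u ^ 2 / 2 := by positivity
  have hz0 : 0 ≤ z := by positivity
  have hzp : z ^ (2 / μ) = 1 / 4 + u ^ 2 / 2 := by
    rw [hz, ← Real.rpow_mul hy0, div_mul_div_cancel₀ (by norm_num), div_self hμ.ne', Real.rpow_one]
  have hZz : Z ≤ z := by
    by_contra! hlt
    have := Real.rpow_le_rpow hz0 hlt.le (z := 2 / μ) (by positivity)
    rw [hzp] at this
    linarith
  have hzu : z ≤ 1 / (2 : ℝ) ^ (μ / 2) + |u| ^ μ := by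
    rcases le_total (u ^ 2) (1 / 2) with h | h
    · have h1 : z ≤ (1 / 2 : ℝ) ^ (μ / 2) :=
        Real.rpow_le_rpow hy0 (by linarith) (by positivity)
      rw [Real.div_rpow one_pos.le (by norm_num), Real.one_rpow] at h1
      have : 0 ≤ |u| ^ μ := by positivity
      linarith
    · have h1 : z ≤ (u ^ 2) ^ (μ / 2) := Real.rpow_le_rpow hy0 (by linarith) (by positivity)
      have h2 : (u ^ 2) ^ (μ / 2) = |u| ^ μ := by
        rw [← sq_abs, ← Real.rpow_natCast, ← Real.rpow_mul (abs_nonneg u)]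
        congr 1
        push_cast
        field_simp
      have : 0 ≤ 1 / (2 : ℝ) ^ (μ / 2) := by positivity
      linarith
  have h1 := rpow_le_const_mul_exp ha hμ hz0
  rw [hzp] at h1
  have h2 : Real.exp (a * z / 2) ≤ Real.exp (a / (2 : ℝ) ^ (μ / 2)) * Real.exp (-(a * Z / 2)) *
      Real.exp (a * |u| ^ μ) := by
    rw [← Real.exp_add, ← Real.exp_add]
    refine Real.exp_le_exp.2 ?_
    have h3 := mul_le_mul_of_nonneg_left hzu ha.le
    have h4 := mul_le_mul_of_nonneg_left hZz ha.le
    rw [mul_add, mul_one_div] at h3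
    linarith
  have h5 := mul_le_mul_of_nonneg_left h2
    (a := (4 / (a * μ * Real.exp 1)) ^ (2 / μ)) (by positivity)
  nlinarith

/-- Writing the rate as `(1/2 + v_i²) + (1/2 + v_j²)`, it is at most twice the larger term, which is
large if the rate is. -/
theorem indicator_rate_le {a μ Z : ℝ} (ha : 0 < a) (hμ : 0 < μ) (i j : Fin N) (v : KacSphere N) :
    (if 4 * Z ^ (2 / μ) < 1 + pairEnergy i j v then 1 + pairEnergy i j v else 0)
      ≤ 4 * (4 / (a * μ * Real.exp 1)) ^ (2 / μ) * Real.exp (a / (2 : ℝ) ^ (μ / 2)) *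
        Real.exp (-(a * Z / 2)) * (Real.exp (a * |(v : Velocities N) i| ^ μ)
          + Real.exp (a * |(v : Velocities N) j| ^ μ)) := by
  set κ := 4 * (4 / (a * μ * Real.exp 1)) ^ (2 / μ) * Real.exp (a / (2 : ℝ) ^ (μ / 2)) *
        Real.exp (-(a * Z / 2)) with hκ
  have hκ0 : 0 ≤ κ := by positivity
  have h1 := mul_nonneg hκ0 (Real.exp_pos (a * |(v : Velocities N) i| ^ μ)).le
  have h2 := mul_nonneg hκ0 (Real.exp_pos (a * |(v : Velocities N) j| ^ μ)).le
  rw [mul_add]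
  split_ifs with h
  · unfold pairEnergy at h ⊢
    rcases le_total (((v : Velocities N) i) ^ 2) (((v : Velocities N) j) ^ 2) with hle | hle
    · have := tail_le_exp (Z := Z) (u := (v : Velocities N) j) ha hμ (by linarith)
      linarith
    · have := tail_le_exp (Z := Z) (u := (v : Velocities N) i) ha hμ (by linarith)
      linarith
  · linarith

/-- The constant in front of the exponential moment is not small, which makes the threshold for the
velocities positive. -/
theorem half_le_const {a μ : ℝ} (ha : 0 < a) (hμ : 0 < μ) :
    1 / 2 ≤ (4 / (a * μ * Real.exp 1)) ^ (2 / μ) * Real.exp (a / (2 : ℝ) ^ (μ / 2)) := by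
  have h := rpow_le_const_mul_exp ha hμ (z := (1 / 2 : ℝ) ^ (μ / 2)) (by positivity)
  rw [← Real.rpow_mul (by norm_num), div_mul_div_cancel₀ (by norm_num), div_self hμ.ne',
    Real.rpow_one, Real.div_rpow one_pos.le (by norm_num), Real.one_rpow, mul_one_div] at h
  refine h.trans (mul_le_mul_of_nonneg_left (Real.exp_le_exp.2 ?_) (by positivity))
  have : 0 ≤ a / (2 : ℝ) ^ (μ / 2) := by positivity
  linarith

theorem entropyProduction_div_ge_of_expMoment (hN : 2 ≤ N) {γ : ℝ} (hγ : γ ≤ 1)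
    {F : KacSphere N → ℝ} (hF : IsDensity F) (hsymm : IsSymmetric F) {C : ℝ} (hC : 0 < C)
    (hpos : ∀ v, 0 < F v) (hlog : ∀ v, |Real.log (F v)| ≤ C * N) {a μ : ℝ} (ha : 0 < a)
    (hμ : 0 < μ) {M : ENNReal} (hM : M < ⊤)
    (hmom : ∫⁻ v, ENNReal.ofReal (Real.exp (a * |firstVelocity v| ^ μ) * F v) ∂(uniformMeasure N)
      ≤ M) :
    1 / (6 * (4 : ℝ) ^ (1 - γ) *
      (2 / a * Real.log (96 * C * (4 / (a * μ * Real.exp 1)) ^ (2 / μ) *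
          Real.exp (a / (2 : ℝ) ^ (μ / 2)) * M.toReal) +
        2 / a * Real.log (N / (entropy F / N))) ^ (2 * (1 - γ) / μ)) * (entropy F / N)
      ≤ entropyProduction γ F / N := by
  have := isProbabilityMeasure_uniformMeasure hN
  have hN2 : (2 : ℝ) ≤ N := by exact_mod_cast hN
  have hN0 : (0 : ℝ) < N := by linarith
  have hcK : ∀ v, F v ∈ Icc (Real.exp (-(C * N))) (Real.exp (C * N)) := fun v =>
    ⟨(Real.le_log_iff_exp_le (hpos v)).1 (abs_le.1 (hlog v)).1,
      (Real.log_le_iff_le_exp (hpos v)).1 (abs_le.1 (hlog v)).2⟩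
  have hH := entropy_mem_Icc hN hF hpos hlog
  have hx : 0 ≤ entropy F / N := div_nonneg hH.1 hN0.le
  have hd : 0 ≤ entropyProduction γ F / N :=
    div_nonneg (entropyProduction_nonneg hN hγ hF.measurable (Real.exp_pos _) hcK) hN0.le
  rcases hx.eq_or_lt with hx0 | hx0
  · rw [← hx0, mul_zero]
    exact hd
  have hxC : entropy F / N ≤ C := by
    rw [div_le_iff₀ hN0]
    exact hH.2
  set x := entropy F / N with hxdef
  have hcoord := integral_coord_le hN hF hsymm (h := fun x => Real.exp (a * |x| ^ μ))
    (Real.measurable_exp.comp ((measurable_id.abs.pow_const _).const_mul a))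
    (fun x => (Real.exp_pos _).le) hM hmom
  have hM1 : 1 ≤ M.toReal := by
    have h0 := hcoord ⟨0, by omega⟩
    refine le_trans ?_ h0.2
    rw [← hF.integral_eq_one]
    refine integral_mono hF.integrable h0.1 fun v => le_mul_of_one_le_left (hpos v).le ?_
    exact Real.one_le_exp (by positivity)
  set K₀ := (4 / (a * μ * Real.exp 1)) ^ (2 / μ) with hK₀
  set K₁ := Real.exp (a / (2 : ℝ) ^ (μ / 2)) with hK₁
  have hK₀0 : 0 < K₀ := by positivity
  have hK₁0 : 0 < K₁ := Real.exp_pos _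
  have hK : 1 / 2 ≤ K₀ * K₁ := half_le_const ha hμ
  set m := M.toReal with hm
  have hm0 : 0 < m := by linarith
  have hΛ0 : 0 < 96 * C * K₀ * K₁ * m := by positivity
  set Z := 2 / a * Real.log (96 * C * K₀ * K₁ * m) + 2 / a * Real.log (N / x) with hZ
  have hZeq : Z = 2 / a * Real.log (96 * C * K₀ * K₁ * m * (N / x)) := by
    rw [hZ, Real.log_mul hΛ0.ne' (by positivity)]; ring
  have hexp : Real.exp (-(a * Z / 2)) = x / (96 * C * K₀ * K₁ * m * N) := by
    have h1 : a * Z / 2 = Real.log (96 * C * K₀ * K₁ * m * (N / x)) := by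
      rw [hZeq]; field_simp
    rw [h1, Real.exp_neg, Real.exp_log (by positivity)]
    field_simp
  have hZ0 : 0 < Z := by
    rw [hZeq]
    refine mul_pos (by positivity) (Real.log_pos ?_)
    rw [← mul_div_assoc, lt_div_iff₀ hx0, one_mul]
    have h1 : C ≤ C * m := le_mul_of_one_le_right hC.le hM1
    have h2 : C * m * 1 ≤ C * m * (K₀ * K₁ * 2) :=
      mul_le_mul_of_nonneg_left (by linarith) (by positivity)
    have h3 : C * m * (K₀ * K₁) * 2 ≤ C * m * (K₀ * K₁) * N :=
      mul_le_mul_of_nonneg_left hN2 (by positivity)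
    have h4 : 0 < C * m * (K₀ * K₁) * N := by positivity
    linarith
  -- the rates above the threshold `4 Z^(2/μ)` contribute at most `x / 6`
  have hR0 : 0 < 4 * Z ^ (2 / μ) := by positivity
  have key := entropy_le_of_rate_le hN hγ hF hpos hlog (A := (4 * Z ^ (2 / μ)) ^ (1 - γ))
    (g := fun w => if 4 * Z ^ (2 / μ) < w then w else 0) (G := x / (12 * C * N))
    (fun w hw => by split_ifs <;> linarith)
    (fun w hw => by
      have hw0 : 0 < w := by linarith
      split_ifs with h
      · have : 0 ≤ (4 * Z ^ (2 / μ)) ^ (1 - γ) * w ^ γ := by positivity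
        linarith
      · have h1 : w = w ^ (1 - γ) * w ^ γ := by
          rw [← Real.rpow_add hw0, sub_add_cancel, Real.rpow_one]
        have h2 : w ^ (1 - γ) * w ^ γ ≤ (4 * Z ^ (2 / μ)) ^ (1 - γ) * w ^ γ :=
          mul_le_mul_of_nonneg_right (Real.rpow_le_rpow hw0.le (not_lt.1 h) (by linarith))
            (by positivity)
        linarith)
    (fun i j _ => ?_) fun i j _ => ?_
  · have h1 : (4 * Z ^ (2 / μ)) ^ (1 - γ) = (4 : ℝ) ^ (1 - γ) * Z ^ (2 * (1 - γ) / μ) := by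
      rw [Real.mul_rpow (by norm_num) (by positivity), ← Real.rpow_mul hZ0.le]
      congr 2
      ring
    have h2 : 2 * C * N * (x / (12 * C * N)) = x / 6 := by
      field_simp
      norm_num
    rw [h1, h2] at key
    have h3 : 0 < (4 : ℝ) ^ (1 - γ) * Z ^ (2 * (1 - γ) / μ) := by positivity
    rw [one_div, inv_mul_le_iff₀ (by positivity)]
    linarith
  all_goals
    set κ := 4 * K₀ * K₁ * Real.exp (-(a * Z / 2)) with hκ
    have hdom : ∀ v : KacSphere N,
        (if 4 * Z ^ (2 / μ) < 1 + pairEnergy i j v then 1 + pairEnergy i j v else 0) * F v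
        ≤ κ * (Real.exp (a * |(v : Velocities N) i| ^ μ) * F v
          + Real.exp (a * |(v : Velocities N) j| ^ μ) * F v) := by
      intro v
      have := mul_le_mul_of_nonneg_right (indicator_rate_le (Z := Z) ha hμ i j v) (hpos v).le
      refine this.trans_eq ?_
      rw [hκ]
      ring
    have hnn : ∀ v : KacSphere N,
        0 ≤ (if 4 * Z ^ (2 / μ) < 1 + pairEnergy i j v then 1 + pairEnergy i j v else 0) * F v := by
      intro v
      refine mul_nonneg ?_ (hpos v).le
      split_ifs
      · linarith [pairEnergy_nonneg i j v]
      · exact le_rfl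
    have hint := ((hcoord i).1.add (hcoord j).1).const_mul κ
  · have hwm : Measurable fun v : KacSphere N => 1 + pairEnergy i j v :=
      (continuous_pairEnergy i j).measurable.const_add 1
    refine hint.mono' ((Measurable.ite (measurableSet_lt measurable_const hwm) hwm
      measurable_const).mul hF.measurable).aestronglyMeasurable (Eventually.of_forall fun v => ?_)
    rw [Real.norm_eq_abs, abs_of_nonneg (hnn v)]
    exact hdom v
  · refine (integral_mono_of_nonneg (Eventually.of_forall hnn) hint
      (Eventually.of_forall hdom)).trans ?_
    refine (integral_const_mul κ _).le.trans ?_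
    have hadd := integral_add (hcoord i).1 (hcoord j).1
    have h1 := mul_le_mul_of_nonneg_left (add_le_add (hcoord i).2 (hcoord j).2)
      (a := κ) (by positivity)
    rw [← hadd] at h1
    refine h1.trans_eq ?_
    rw [hκ, hexp]
    field_simp
    norm_num

end KacWalk

end

theorem theorem1 (γ : ℝ) (hγ0 : 0 ≤ γ) (hγ1 : γ ≤ 1)
    (F : (N : ℕ) → KacWalk.KacSphere N → ℝ)
    (hF : ∀ N : ℕ, 2 ≤ N → KacWalk.IsDensity (F N))
    (hsymm : ∀ N : ℕ, 2 ≤ N → KacWalk.IsSymmetric (F N))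
    (C_F : ℝ) (hC : 0 < C_F) (hlog : KacWalk.IsLogScalable F C_F) :
    (∀ k : ℝ, 1 < k → KacWalk.supMoment F (2 * k) < ⊤ →
      ∀ N : ℕ, 2 ≤ N →
        KacWalk.entropyProduction γ (F N) / N ≥
          KacWalk.rateConst k γ N C_F (KacWalk.supMoment F (2 * k)).toReal *
            (KacWalk.entropy (F N) / N) ^ (1 + (1 - γ) / (k - 1))) ∧
    (∀ a μ : ℝ, 0 < a → 0 < μ → KacWalk.supExpMoment F a μ < ⊤ →
      ∀ N : ℕ, 2 ≤ N →
        KacWalk.entropyProduction γ (F N) / N ≥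
          1 / (6 * (4 : ℝ) ^ (1 - γ) *
            (2 / a * Real.log (96 * C_F * (4 / (a * μ * Real.exp 1)) ^ (2 / μ) *
                Real.exp (a / (2 : ℝ) ^ (μ / 2)) * (KacWalk.supExpMoment F a μ).toReal) +
              2 / a * Real.log (N / (KacWalk.entropy (F N) / N))) ^ (2 * (1 - γ) / μ)) *
            (KacWalk.entropy (F N) / N)) := by
  refine ⟨fun k hk hM N hN => ?_, fun a μ ha hμ hM N hN => ?_⟩
  · exact KacWalk.entropyProduction_div_ge_of_moment hN hγ1 (hF N hN) (hsymm N hN) hC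
      (fun v => (hlog N hN v).1) (fun v => (hlog N hN v).2) hk hM
      (le_iSup₂ (f := fun (n : ℕ) (_ : 2 ≤ n) =>
        KacWalk.moment (2 * k) (KacWalk.marginal (F n))) N hN)
  · exact KacWalk.entropyProduction_div_ge_of_expMoment hN hγ1 (hF N hN) (hsymm N hN) hC
      (fun v => (hlog N hN v).1) (fun v => (hlog N hN v).2) ha hμ hM
      (le_iSup₂ (f := fun (n : ℕ) (_ : 2 ≤ n) =>
        ∫⁻ v, ENNReal.ofReal (Real.exp (a * |KacWalk.firstVelocity v| ^ μ) * F n v)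
          ∂(KacWalk.uniformMeasure n)) N hN)
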